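/- Let $\Psi_1(x)=\frac{x^2}{2}-\frac{x^3}{3}$, $\Psi_2(x)=\frac{x^2}{2}+\frac{x^3}{3}$, $H^+(x,y)=y^2+\Psi_1(x)$ and $H^-(x,y)=y^2+\Psi_2(x)$. For real $a_0^\pm,a_1^\pm$ and a real parameter $\varepsilon$ consider the piecewise smooth system with switching line $x=0$ (solutions in the sense of Filippov) $$(\dot x,\dot y)=\begin{cases}\bigl(2y,\;x(x-1)+\varepsilon(a_0^++a_1^+x)y\bigr),& x>0,\\ \bigl(2y,\;-x(x+1)+\varepsilon(a_0^-+a_1^-x)y\bigr),& x<0.\end{cases}$$ For $h\in(0,1/6)$ put $A(h)=(0,\sqrt h)$, $B(h)=(0,-\sqrt h)$. Then the following hold. 1. For $x\in(0,1)$ and $z\in(-1,0)$ we have $\Psi_1(x)=\Psi_2(z)$ if and only if $z=-x$; that is, the involution is $\sigma_1(x)=-x$. 2. For every $h\in(0,1/6)$ the oval $\Gamma_h=\{H^+=h,\ 0\le x<1\}\cup\{H^-=h,\ -1<x\le 0\}$ is a periodic orbit of the system with $\varepsilon=0$. There is an orbital arc $\Gamma_h^+$ of the right subsystem with $\varepsilon=0$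 from $A(h)$ to $B(h)$ lying in $\{x>0,\ H^+=h\}$, and an orbital arc $\Gamma_h^-$ of the left subsystem with $\varepsilon=0$ from $B(h)$ to $A(h)$ lying in $\{x<0,\ H^-=h\}$ (endpoints excepted). 3. Let $I_i(h)=\int_{\Gamma_h^+}x^iy\,dx$ and $J_i(h)=\int_{\Gamma_h^-}x^iy\,dx$ for $i=0,1$. Then $J_i=(-1)^iI_i$ on $(0,1/6)$. With $q^\pm=(a_0^\pm+a_1^\pm x)y$ and $p^\pm=0$, the first order Melnikov function $$M(h)=\frac{H_y^+(A)}{H_y^-(A)}\left[\frac{H_y^-(B)}{H_y^+(B)}\int_{\Gamma_h^+}q^+dx-p^+dy+\int_{\Gamma_h^-}q^-dx-p^-dy\right],\qquad h\in(0,1/6),$$ equals $a_0^+I_0+a_0^-J_0+a_1^+I_1+a_1^-J_1$, and this reduces to $a_0I_0+a_1I_1$ with $a_0=a_0^++a_0^-$, $a_1=a_1^+-a_1^-$. 4. $(1,x)$ is an ECT-system on $(0,1)$, and $(I_0,I_1)$ is an ECT-system on $(0,1/6)$. Here $(f_0,\dots,f_{n-1})$ is an ECT-system on an open interval if the $f_i$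 are real analytic there and, for each $k=1,\dots,n$, every nontrivial linear combination of $f_0,\dots,f_{k-1}$ is not identically zero and has at most $k-1$ zeros in the interval, counted with multiplicity. 5. For all $a_0^\pm,a_1^\pm$, at most one limit cycle bifurcates from the period annulus $\mathcal A=\bigcup_{0<h<1/6}\Gamma_h$. That is, for every compact $K\subset\mathcal A$ there is $\varepsilon_0>0$ such that for $0<|\varepsilon|<\varepsilon_0$ the system has at most one limit cycle contained in $K$. Here a limit cycle is a periodic orbit having a neighbourhood that contains no other periodic orbit. -/

import Mathlib

open Set MeasureTheory

noncomputable section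

/-! ### Extended complete Chebyshev systems -/

/-- The ordered family `f 0, …, f (n-1)` is an ECT-system on `I`: the functions are real analytic
on `I` and, for every `1 ≤ k ≤ n`, every nontrivial linear combination of the first `k` functions
has at most `k - 1` zeros in `I`, counted with multiplicity. (A combination vanishing near a point
has order `⊤` there, so nontrivial combinations are in particular not identically zero.) -/
def IsECTSystem {n : ℕ} (f : Fin n → ℝ → ℝ) (I : Set ℝ) : Prop :=
  (∀ i, AnalyticOnNhd ℝ (f i) I) ∧
  ∀ k : ℕ, 1 ≤ k → k ≤ n → ∀ α : Fin n → ℝ, α ≠ 0 → (∀ i : Fin n, k ≤ (i : ℕ) → α i = 0) →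
    ∀ S : Finset ℝ, (S : Set ℝ) ⊆ I →
      ∑ x ∈ S, analyticOrderAt (fun t => ∑ i, α i * f i t) x ≤ ((k - 1 : ℕ) : ℕ∞)

/-! ### Planar vector fields, orbital arcs and line integrals -/

/-- The Hamiltonian vector field `(H_y, -H_x)`. -/
def hamField (H : ℝ × ℝ → ℝ) (z : ℝ × ℝ) : ℝ × ℝ :=
  (deriv (fun y => H (z.1, y)) z.2, -deriv (fun x => H (x, z.2)) z.1)

/-- The perturbed Hamiltonian vector field `(H_y + ε p, -H_x + ε q)`. -/
def perturbedField (H p q : ℝ × ℝ → ℝ) (ε : ℝ) (z : ℝ × ℝ) : ℝ × ℝ :=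
  hamField H z + ε • (p z, q z)

/-- `γ` is an orbital arc of the vector field `X` from `A` to `B` whose interior lies in `S`:
after the linear time change `t = T s`, it solves `ż = X z`. -/
def IsOrbitalArc (X : ℝ × ℝ → ℝ × ℝ) (S : Set (ℝ × ℝ)) {A B : ℝ × ℝ} (γ : Path A B) : Prop :=
  ∃ T : ℝ, 0 < T ∧ ∀ s ∈ Ioo (0 : ℝ) 1,
    γ.extend s ∈ S ∧ HasDerivAt γ.extend (T • X (γ.extend s)) s

/-- The differential form `P dx + Q dy`. -/
def lineForm (P Q : ℝ × ℝ → ℝ) (z : ℝ × ℝ) : ℝ × ℝ →L[ℝ] ℝ :=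
  P z • ContinuousLinearMap.fst ℝ ℝ ℝ + Q z • ContinuousLinearMap.snd ℝ ℝ ℝ

/-- The line integral `∫_γ P dx + Q dy`. -/
def lineIntegral (P Q : ℝ × ℝ → ℝ) {A B : ℝ × ℝ} (γ : Path A B) : ℝ :=
  curveIntegral (lineForm P Q) γ

/-- The partial derivative `H_y`. -/
def partialY (H : ℝ × ℝ → ℝ) (z : ℝ × ℝ) : ℝ := deriv (fun y => H (z.1, y)) z.2

/-- The first order Melnikov function of the piecewise Hamiltonian system with Hamiltonians
`Hp, Hm` and perturbations `ε (pp, qp)`, `ε (pm, qm)` in `x > 0`, `x < 0`, evaluated on the closed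
curve that consists of the arc `γp` from `A` to `B` and the arc `γm` from `B` to `A`. -/
def melnikov (Hp Hm pp qp pm qm : ℝ × ℝ → ℝ) {A B : ℝ × ℝ} (γp : Path A B) (γm : Path B A) : ℝ :=
  partialY Hp A / partialY Hm A *
    (partialY Hm B / partialY Hp B * lineIntegral qp (fun z => -pp z) γp
      + lineIntegral qm (fun z => -pm z) γm)

/-! ### Piecewise smooth systems with switching line `x = 0`, and their limit cycles -/

/-- Filippov's set-valued field for `Zp` in `x > 0` and `Zm` in `x < 0`. -/
def filippovSet (Zp Zm : ℝ × ℝ → ℝ × ℝ) (z : ℝ × ℝ) : Set (ℝ × ℝ) :=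
  if 0 < z.1 then {Zp z} else if z.1 < 0 then {Zm z} else segment ℝ (Zp z) (Zm z)

/-- Solutions (on the whole line) of the piecewise smooth system in the sense of Filippov. -/
def IsFilippovSolution (Zp Zm : ℝ × ℝ → ℝ × ℝ) (γ : ℝ → ℝ × ℝ) : Prop :=
  (∀ a b : ℝ, AbsolutelyContinuousOnInterval γ a b) ∧
  ∀ᵐ t : ℝ, ∃ v ∈ filippovSet Zp Zm (γ t), HasDerivAt γ v t

/-- `C` is the trace of a nonconstant periodic solution. -/
def IsPeriodicOrbit (Zp Zm : ℝ × ℝ → ℝ × ℝ) (C : Set (ℝ × ℝ)) : Prop :=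
  ∃ (γ : ℝ → ℝ × ℝ) (T : ℝ), 0 < T ∧ IsFilippovSolution Zp Zm γ ∧ Function.Periodic γ T ∧
    (∃ t, γ t ≠ γ 0) ∧ C = range γ

/-- A limit cycle is a periodic orbit that has a neighbourhood containing no other periodic
orbit. -/
def IsLimitCycle (Zp Zm : ℝ × ℝ → ℝ × ℝ) (C : Set (ℝ × ℝ)) : Prop :=
  IsPeriodicOrbit Zp Zm C ∧
    ∃ U : Set (ℝ × ℝ), IsOpen U ∧ C ⊆ U ∧ ∀ C', IsPeriodicOrbit Zp Zm C' → C' ⊆ U → C' = C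

/-- At most `n` limit cycles of the family `(Zp ε, Zm ε)` bifurcate from the period annulus `𝒜`
of the system at `ε = 0`: for every compact `K ⊆ 𝒜` and all sufficiently small `ε ≠ 0`, at most
`n` limit cycles lie in `K`. -/
def AtMostBifurcate (Zp Zm : ℝ → ℝ × ℝ → ℝ × ℝ) (𝒜 : Set (ℝ × ℝ)) (n : ℕ) : Prop :=
  ∀ K : Set (ℝ × ℝ), IsCompact K → K ⊆ 𝒜 →
    ∃ ε₀ : ℝ, 0 < ε₀ ∧ ∀ ε : ℝ, 0 < |ε| → |ε| < ε₀ →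
      {C : Set (ℝ × ℝ) | IsLimitCycle (Zp ε) (Zm ε) C ∧ C ⊆ K}.encard ≤ (n : ℕ∞)

/-! ### The system `Ψ₁ = x²/2 - x³/3`, `Ψ₂ = x²/2 + x³/3` -/

def PsiOne (x : ℝ) : ℝ := x ^ 2 / 2 - x ^ 3 / 3

def PsiTwo (x : ℝ) : ℝ := x ^ 2 / 2 + x ^ 3 / 3

def HamPlus (z : ℝ × ℝ) : ℝ := z.2 ^ 2 + PsiOne z.1

def HamMinus (z : ℝ × ℝ) : ℝ := z.2 ^ 2 + PsiTwo z.1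

/-- The perturbation term `(a₀ + a₁ x) y`. -/
def pertY (a₀ a₁ : ℝ) (z : ℝ × ℝ) : ℝ := (a₀ + a₁ * z.1) * z.2

/-- The vector field in `x > 0`. -/
def fieldPlus (a₀ a₁ ε : ℝ) : ℝ × ℝ → ℝ × ℝ := perturbedField HamPlus (fun _ => 0) (pertY a₀ a₁) ε

/-- The vector field in `x < 0`. -/
def fieldMinus (a₀ a₁ ε : ℝ) : ℝ × ℝ → ℝ × ℝ :=
  perturbedField HamMinus (fun _ => 0) (pertY a₀ a₁) ε

theorem fieldPlus_apply (a₀ a₁ ε x y : ℝ) :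
    fieldPlus a₀ a₁ ε (x, y) = (2 * y, x * (x - 1) + ε * ((a₀ + a₁ * x) * y)) := by
  have h1 : HasDerivAt (fun t : ℝ => t ^ 2 + PsiOne x) (2 * y) y := by
    simpa using (hasDerivAt_pow 2 y).add_const (PsiOne x)
  have h2 : HasDerivAt (fun t : ℝ => y ^ 2 + (t ^ 2 / 2 - t ^ 3 / 3))
      (2 * x / 2 - 3 * x ^ 2 / 3) x := by
    simpa using (((hasDerivAt_pow 2 x).div_const 2).sub
      ((hasDerivAt_pow 3 x).div_const 3)).const_add (y ^ 2)
  have h2' : deriv (fun t : ℝ => HamPlus (t, y)) x = 2 * x / 2 - 3 * x ^ 2 / 3 := h2.deriv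
  have h1' : deriv (fun t : ℝ => HamPlus (x, t)) y = 2 * y := h1.deriv
  ext
  · simp [fieldPlus, perturbedField, hamField, h1']
  · simp only [fieldPlus, perturbedField, hamField, pertY, h2', Prod.snd_add, Prod.smul_snd,
      smul_eq_mul]
    ring

theorem fieldMinus_apply (a₀ a₁ ε x y : ℝ) :
    fieldMinus a₀ a₁ ε (x, y) = (2 * y, -x * (x + 1) + ε * ((a₀ + a₁ * x) * y)) := by
  have h1 : HasDerivAt (fun t : ℝ => t ^ 2 + PsiTwo x) (2 * y) y := by
    simpa using (hasDerivAt_pow 2 y).add_const (PsiTwo x)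
  have h2 : HasDerivAt (fun t : ℝ => y ^ 2 + (t ^ 2 / 2 + t ^ 3 / 3))
      (2 * x / 2 + 3 * x ^ 2 / 3) x := by
    simpa using (((hasDerivAt_pow 2 x).div_const 2).add
      ((hasDerivAt_pow 3 x).div_const 3)).const_add (y ^ 2)
  have h2' : deriv (fun t : ℝ => HamMinus (t, y)) x = 2 * x / 2 + 3 * x ^ 2 / 3 := h2.deriv
  have h1' : deriv (fun t : ℝ => HamMinus (x, t)) y = 2 * y := h1.deriv
  ext
  · simp [fieldMinus, perturbedField, hamField, h1']
  · simp only [fieldMinus, perturbedField, hamField, pertY, h2', Prod.snd_add, Prod.smul_snd,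
      smul_eq_mul]
    ring

/-- The upper crossing point `A(h) = (0, √h)` of the oval with the switching line. -/
def ptA (h : ℝ) : ℝ × ℝ := (0, √h)

/-- The lower crossing point `B(h) = (0, -√h)` of the oval with the switching line. -/
def ptB (h : ℝ) : ℝ × ℝ := (0, -√h)

/-- `γ` is the arc `Γ_h⁺` of the unperturbed system, from `A(h)` to `B(h)` in `x > 0`. -/
def IsArcPlus (h : ℝ) (γ : Path (ptA h) (ptB h)) : Prop :=
  IsOrbitalArc (hamField HamPlus) {z | 0 < z.1 ∧ HamPlus z = h} γ

/-- `γ` is the arc `Γ_h⁻` of the unperturbed system, from `B(h)` to `A(h)` in `x < 0`. -/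
def IsArcMinus (h : ℝ) (γ : Path (ptB h) (ptA h)) : Prop :=
  IsOrbitalArc (hamField HamMinus) {z | z.1 < 0 ∧ HamMinus z = h} γ

/-- The oval `Γ_h` around the origin, including its two points on the switching line. -/
def oval (h : ℝ) : Set (ℝ × ℝ) :=
  {z | 0 ≤ z.1 ∧ z.1 < 1 ∧ HamPlus z = h} ∪ {z | -1 < z.1 ∧ z.1 ≤ 0 ∧ HamMinus z = h}

/-- The period annulus of the unperturbed system. -/
def periodAnnulus : Set (ℝ × ℝ) := ⋃ h ∈ Ioo (0 : ℝ) (1 / 6), oval h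

end

/-! ### The signed square root of the potential and its inverse. -/

noncomputable section

/-! Both half-systems lead to one scalar equation. Since `PsiTwo x = PsiOne (-x)`, reflecting x and
reversing time turns the left field with coefficients (b₀, b₁) into a right field with coefficients
(-b₀, b₁). Put y = √h cos θ and `psiRoot` |x| = √h sin θ, so that A and B are θ = 0 and θ = π. Each
half-turn then satisfies dh/dθ = ε `rate`(h, θ, ε). A periodic orbit in a compact part of the
annulus becomes a pair of solutions on [0, π], one per side, that agree at both ends
(`exists_turnSet_eq`). Closing only after several turns is impossible because one turn preserves the
strict order of levels.

At ε = 0 the integral of `rate` over [0, π] is ∫ (a + bx) y dx along the arc, whatever the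
parametrization (`integral_arc_eq`). Reflection gives Jᵢ = (-1)ⁱ Iᵢ, hence M = (a₀ + b₀) I₀ + (a₁ -
b₁) I₁.

The Chebyshev property rests on I₁' I₀ - I₀' I₁ > 0 (`wronskian_arcInt_pos`). With ν =
1/`psiRootDeriv`, the quotients I₁/I₀ and I₁'/I₀' are the means of x for the weights cos²θ ν and ν.
Since x grows with sin θ while cos²θ decreases, Chebyshev's correlation inequality makes the first
mean the smaller one. So I₁/I₀ is strictly increasing, and a combination with nonzero I₁-coefficient
has at most one zero, which is simple. Analyticity (`analyticAt_arcInt`) comes from rescaling x = Xs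
by the turning point X, which leaves an integrand holomorphic in X.

For the limit cycles, suppose first that M is not identically zero but two periodic orbits exist for
a sequence ε → 0. Along a subsequence their initial levels tend to zeros of M, hence to one level.
On each half-turn the logarithm of the gap between the orbits changes by ε times an integral of
difference quotients of `rate`. The two changes agree, so M' vanishes at that level too, against
simplicity (`exists_unique_closing`). If M vanishes identically, the system is reversible,
neighbouring orbits close as well, and no periodic orbit is isolated (`not_isLimitCycle_of_symm`).
-/

/-- The signed square root of `PsiOne` on `x ≤ 3/2`. -/
def psiRoot (x : ℝ) : ℝ := x * √(1 / 2 - x / 3)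

/-- The derivative of `psiRoot`. -/
def psiRootDeriv (x : ℝ) : ℝ := (1 - x) / (2 * √(1 / 2 - x / 3))

/-- The inverse of `psiRoot` on `[-1/2, 1]`. -/
def psiInv (u : ℝ) : ℝ := Function.invFunOn psiRoot (Icc (-1 / 2) 1) u

theorem psiRoot_zero : psiRoot 0 = 0 := by simp [psiRoot]

theorem psiRoot_sq {x : ℝ} (hx : x ≤ 3 / 2) : psiRoot x ^ 2 = PsiOne x := by
  rw [psiRoot, mul_pow, Real.sq_sqrt (by linarith), PsiOne]
  ring

theorem continuous_psiRoot : Continuous psiRoot := by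
  unfold psiRoot; fun_prop

theorem psiRootDeriv_pos {x : ℝ} (hx : x < 1) : 0 < psiRootDeriv x := by
  have : 0 < √(1 / 2 - x / 3) := Real.sqrt_pos.2 (by linarith)
  unfold psiRootDeriv
  have : 0 < 1 - x := by linarith
  positivity

theorem two_mul_psiRoot_mul_deriv {x : ℝ} (hx : x < 3 / 2) :
    2 * psiRoot x * psiRootDeriv x = x * (1 - x) := by
  have : √(1 / 2 - x / 3) ≠ 0 := (Real.sqrt_pos.2 (by linarith)).ne'
  unfold psiRootDeriv psiRoot
  generalize √(1 / 2 - x / 3) = s at this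
  field_simp

theorem hasDerivAt_psiRoot {x : ℝ} (hx : x < 3 / 2) :
    HasDerivAt psiRoot (psiRootDeriv x) x := by
  have h0 : (0 : ℝ) < 1 / 2 - x / 3 := by linarith
  have h1 : HasDerivAt (fun x : ℝ => 1 / 2 - x / 3) (-(1 / 3)) x := by
    exact (((hasDerivAt_id x).div_const 3).const_sub (1 / 2)).congr_deriv (by norm_num)
  have h2 := (hasDerivAt_id x).mul (h1.sqrt h0.ne')
  have hs : √(1 / 2 - x / 3) ≠ 0 := (Real.sqrt_pos.2 h0).ne'
  have hsq : √(1 / 2 - x / 3) ^ 2 = 1 / 2 - x / 3 := Real.sq_sqrt h0.le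
  refine (h2.congr_deriv ?_ : HasDerivAt psiRoot _ x)
  simp only [psiRootDeriv, id]
  generalize √(1 / 2 - x / 3) = s at hs hsq
  field_simp
  linear_combination 6 * hsq

/-- The derivative has the sign of 1 - x. The endpoints are the points where `psiRoot` equals
∓√(1/6), the root of the saddle level. The negative part is kept so that 0 is an interior point and
the polar coordinates are smooth at θ = 0 and θ = π. -/
theorem strictMonoOn_psiRoot : StrictMonoOn psiRoot (Icc (-1 / 2) 1) := by
  refine strictMonoOn_of_deriv_pos (convex_Icc _ _) continuous_psiRoot.continuousOn ?_
  intro x hx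
  rw [interior_Icc] at hx
  rw [(hasDerivAt_psiRoot (by linarith [hx.2])).deriv]
  exact psiRootDeriv_pos hx.2

theorem psiRoot_one : psiRoot 1 = √(1 / 6) := by norm_num [psiRoot]

theorem psiRoot_neg_half : psiRoot (-1 / 2) = -√(1 / 6) := by
  have : (1 / 2 - (-1 / 2) / 3 : ℝ) = 2 ^ 2 * (1 / 6) := by norm_num
  rw [psiRoot, this, Real.sqrt_mul (by norm_num), Real.sqrt_sq (by norm_num)]
  ring

theorem surjOn_psiRoot : SurjOn psiRoot (Icc (-1 / 2) 1) (Icc (-√(1 / 6)) (√(1 / 6))) := by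
  have := intermediate_value_Icc (show (-1 / 2 : ℝ) ≤ 1 by norm_num)
    continuous_psiRoot.continuousOn
  rwa [psiRoot_one, psiRoot_neg_half] at this

theorem psiInv_mem {u : ℝ} (hu : u ∈ Icc (-√(1 / 6)) (√(1 / 6))) : psiInv u ∈ Icc (-1 / 2 : ℝ) 1 :=
  Function.invFunOn_mem (surjOn_psiRoot hu)

theorem psiRoot_psiInv {u : ℝ} (hu : u ∈ Icc (-√(1 / 6)) (√(1 / 6))) : psiRoot (psiInv u) = u :=
  Function.invFunOn_eq (surjOn_psiRoot hu)

theorem psiInv_psiRoot {x : ℝ} (hx : x ∈ Icc (-1 / 2 : ℝ) 1) : psiInv (psiRoot x) = x :=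
  strictMonoOn_psiRoot.injOn.leftInvOn_invFunOn hx

theorem psiInv_mem_Ioo {u : ℝ} (hu : u ∈ Ioo (-√(1 / 6)) (√(1 / 6))) :
    psiInv u ∈ Ioo (-1 / 2 : ℝ) 1 := by
  have h := psiInv_mem (Ioo_subset_Icc_self hu)
  have h' := psiRoot_psiInv (Ioo_subset_Icc_self hu)
  refine ⟨lt_of_le_of_ne h.1 fun e => ?_, lt_of_le_of_ne h.2 fun e => ?_⟩
  · rw [← e, psiRoot_neg_half] at h'
    exact hu.1.ne h'
  · rw [e, psiRoot_one] at h'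
    exact hu.2.ne' h'

theorem psiInv_zero : psiInv 0 = 0 := by
  conv_lhs => rw [← psiRoot_zero]
  exact psiInv_psiRoot (by norm_num)

theorem psiInv_nonneg {u : ℝ} (h0 : 0 ≤ u) (hu : u < √(1 / 6)) : 0 ≤ psiInv u := by
  have hr : 0 < √(1 / 6 : ℝ) := by positivity
  have hm : u ∈ Icc (-√(1 / 6)) (√(1 / 6)) := ⟨by linarith, hu.le⟩
  by_contra! h
  have := strictMonoOn_psiRoot (psiInv_mem hm) (show (0 : ℝ) ∈ Icc (-1 / 2 : ℝ) 1 by norm_num) h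
  rw [psiRoot_psiInv hm, psiRoot_zero] at this
  linarith

theorem psiInv_pos {u : ℝ} (h0 : 0 < u) (hu : u < √(1 / 6)) : 0 < psiInv u := by
  refine lt_of_le_of_ne (psiInv_nonneg h0.le hu) fun e => ?_
  have hr : 0 < √(1 / 6 : ℝ) := by positivity
  have := psiRoot_psiInv (u := u) ⟨by linarith, hu.le⟩
  rw [← e, psiRoot_zero] at this
  exact h0.ne this

theorem strictMonoOn_psiInv : StrictMonoOn psiInv (Icc (-√(1 / 6)) (√(1 / 6))) := by
  intro u hu v hv huv
  by_contra! h
  have := strictMonoOn_psiRoot.monotoneOn (psiInv_mem hv) (psiInv_mem hu) h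
  rw [psiRoot_psiInv hu, psiRoot_psiInv hv] at this
  linarith

theorem analyticAt_psiRoot {x : ℝ} (hx : x < 3 / 2) : AnalyticAt ℝ psiRoot x := by
  refine ContDiffAt.analyticAt ?_
  unfold psiRoot
  refine contDiffAt_id.mul (ContDiffAt.sqrt (by fun_prop) ?_)
  linarith

theorem contDiffAt_psiRootDeriv {x : ℝ} (hx : x < 3 / 2) {n : WithTop ℕ∞} :
    ContDiffAt ℝ n psiRootDeriv x := by
  have h0 : (0 : ℝ) < 1 / 2 - x / 3 := by linarith
  unfold psiRootDeriv
  refine ContDiffAt.div (by fun_prop) (contDiffAt_const.mul (ContDiffAt.sqrt (by fun_prop) h0.ne'))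
    ?_
  have := Real.sqrt_pos.2 h0
  positivity

/-- `psiInv` is defined by choice, so it is compared with the analytic local inverse. Near u the
latter takes values in (-1/2, 1), where `psiRoot` is injective, and the two must agree. -/
theorem analyticAt_psiInv {u : ℝ} (hu : u ∈ Ioo (-√(1 / 6)) (√(1 / 6))) :
    AnalyticAt ℝ psiInv u := by
  have hx := psiInv_mem_Ioo hu
  have hx' := psiRoot_psiInv (Ioo_subset_Icc_self hu)
  set x := psiInv u with hxdef
  have ha : AnalyticAt ℝ psiRoot x := analyticAt_psiRoot (by linarith [hx.2])
  have hd : deriv psiRoot x ≠ 0 := by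
    rw [(hasDerivAt_psiRoot (by linarith [hx.2])).deriv]
    exact (psiRootDeriv_pos hx.2).ne'
  have hinv := ha.analyticAt_localInverse hd
  rw [hx'] at hinv
  refine hinv.congr ?_
  have h1 : ∀ᶠ v in nhds (psiRoot x),
      psiRoot (ha.hasStrictDerivAt.localInverse _ _ _ hd v) = v :=
    HasStrictDerivAt.eventually_right_inverse ha.hasStrictDerivAt hd
  have h2 : ha.hasStrictDerivAt.localInverse _ _ _ hd (psiRoot x) = x :=
    HasStrictFDerivAt.localInverse_apply_image ..
  have h3 : ∀ᶠ v in nhds (psiRoot x),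
      ha.hasStrictDerivAt.localInverse _ _ _ hd v ∈ Ioo (-1 / 2 : ℝ) 1 := by
    have hc := (ha.analyticAt_localInverse hd).continuousAt
    refine hc.eventually_mem ?_
    rw [h2]
    exact Ioo_mem_nhds hx.1 hx.2
  rw [hx'] at h1 h3
  filter_upwards [h1, h3] with v hv1 hv2
  rw [← psiInv_psiRoot (Ioo_subset_Icc_self hv2), hv1]

theorem hasDerivAt_psiInv {u : ℝ} (hu : u ∈ Ioo (-√(1 / 6)) (√(1 / 6))) :
    HasDerivAt psiInv (psiRootDeriv (psiInv u))⁻¹ u := by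
  have hx := psiInv_mem_Ioo hu
  refine HasDerivAt.of_local_left_inverse (analyticAt_psiInv hu).continuousAt
    (hasDerivAt_psiRoot (by linarith [hx.2])) (psiRootDeriv_pos hx.2).ne' ?_
  filter_upwards [Ioo_mem_nhds hu.1 hu.2] with v hv
  exact psiRoot_psiInv (Ioo_subset_Icc_self hv)

theorem PsiOne_psiInv {u : ℝ} (hu : u ∈ Icc (-√(1 / 6)) (√(1 / 6))) : PsiOne (psiInv u) = u ^ 2 := by
  rw [← psiRoot_sq (by linarith [(psiInv_mem hu).2]), psiRoot_psiInv hu]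

theorem PsiTwo_eq (x : ℝ) : PsiTwo x = PsiOne (-x) := by
  unfold PsiOne PsiTwo; ring

theorem PsiOne_one : PsiOne 1 = 1 / 6 := by norm_num [PsiOne]

theorem psiRoot_nonneg {x : ℝ} (hx : 0 ≤ x) : 0 ≤ psiRoot x :=
  mul_nonneg hx (Real.sqrt_nonneg _)

/-- After reflecting z, both sides are squares of nonnegative values of `psiRoot` on its interval of
injectivity. -/
theorem involution_iff {x z : ℝ} (hx : x ∈ Ioo (0 : ℝ) 1) (hz : z ∈ Ioo (-1 : ℝ) 0) :
    PsiOne x = PsiTwo z ↔ z = -x := by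
  constructor
  · intro h
    rw [PsiTwo_eq] at h
    have h1 : psiRoot x = psiRoot (-z) := by
      rw [← psiRoot_sq (by linarith [hx.2]), ← psiRoot_sq (by linarith [hz.1])] at h
      exact (sq_eq_sq₀ (psiRoot_nonneg hx.1.le) (psiRoot_nonneg (by linarith [hz.2]))).1 h
    have := strictMonoOn_psiRoot.injOn ⟨by linarith [hx.1], hx.2.le⟩
      ⟨by linarith [hz.2], by linarith [hz.1]⟩ h1
    linarith
  · rintro rfl
    rw [PsiTwo_eq, neg_neg]

end

noncomputable section

/-! ### Polar coordinates -/

/-- The abscissa of the point of the right half-oval of level `h` with angle `θ`. -/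
def polX (h θ : ℝ) : ℝ := psiInv (√h * Real.sin θ)

/-- The angular speed `dθ/dt` along the right system with perturbation `ε (a + b x) y`. -/
def angSpeed (a b h θ ε : ℝ) : ℝ :=
  2 * psiRootDeriv (polX h θ) - ε * (Real.sin θ * Real.cos θ * (a + b * polX h θ))

/-- The function `rate` for which `dh/dθ = ε * rate` along the right system. -/
def rate (a b h θ ε : ℝ) : ℝ :=
  2 * h * Real.cos θ ^ 2 * (a + b * polX h θ) / angSpeed a b h θ ε

theorem sqrt_mul_sin_mem {h : ℝ} (hh : h ∈ Ioo (0 : ℝ) (1 / 6)) (θ : ℝ) :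
    √h * Real.sin θ ∈ Ioo (-√(1 / 6)) (√(1 / 6)) := by
  have h1 : √h < √(1 / 6) := Real.sqrt_lt_sqrt hh.1.le hh.2
  have h2 : |√h * Real.sin θ| ≤ √h := by
    rw [abs_mul, abs_of_nonneg (Real.sqrt_nonneg h)]
    exact mul_le_of_le_one_right (Real.sqrt_nonneg h) (Real.abs_sin_le_one θ)
  exact abs_lt.1 (h2.trans_lt h1)

theorem polX_mem {h : ℝ} (hh : h ∈ Ioo (0 : ℝ) (1 / 6)) (θ : ℝ) :
    polX h θ ∈ Ioo (-1 / 2 : ℝ) 1 :=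
  psiInv_mem_Ioo (sqrt_mul_sin_mem hh θ)

theorem polX_nonneg {h θ : ℝ} (hh : h ∈ Ioo (0 : ℝ) (1 / 6)) (hθ : θ ∈ Icc 0 Real.pi) :
    0 ≤ polX h θ :=
  psiInv_nonneg (mul_nonneg (Real.sqrt_nonneg h) (Real.sin_nonneg_of_mem_Icc hθ))
    (sqrt_mul_sin_mem hh θ).2

theorem polX_pos {h θ : ℝ} (hh : h ∈ Ioo (0 : ℝ) (1 / 6)) (hθ : θ ∈ Ioo 0 Real.pi) :
    0 < polX h θ :=
  psiInv_pos (mul_pos (Real.sqrt_pos.2 hh.1) (Real.sin_pos_of_mem_Ioo hθ))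
    (sqrt_mul_sin_mem hh θ).2

theorem psiRoot_polX {h : ℝ} (hh : h ∈ Ioo (0 : ℝ) (1 / 6)) (θ : ℝ) :
    psiRoot (polX h θ) = √h * Real.sin θ :=
  psiRoot_psiInv (Ioo_subset_Icc_self (sqrt_mul_sin_mem hh θ))

/-- The idle third coordinate stands for ε, so that this composes with `angSpeed` and `rate`, which
need joint smoothness in (h, θ, ε). -/
theorem contDiffAt_polX {q : ℝ × ℝ × ℝ} (hq : q.1 ∈ Ioo (0 : ℝ) (1 / 6)) :
    ContDiffAt ℝ 1 (fun q : ℝ × ℝ × ℝ => polX q.1 q.2.1) q := by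
  have h1 : ContDiffAt ℝ 1 (fun q : ℝ × ℝ × ℝ => √q.1 * Real.sin q.2.1) q :=
    (contDiffAt_fst.sqrt hq.1.ne').mul (by fun_prop)
  exact (analyticAt_psiInv (sqrt_mul_sin_mem hq q.2.1)).contDiffAt.comp q h1

theorem contDiffAt_psiRootDeriv_polX {q : ℝ × ℝ × ℝ} (hq : q.1 ∈ Ioo (0 : ℝ) (1 / 6)) :
    ContDiffAt ℝ 1 (fun q : ℝ × ℝ × ℝ => psiRootDeriv (polX q.1 q.2.1)) q :=
  ContDiffAt.comp q (contDiffAt_psiRootDeriv (by linarith [(polX_mem hq q.2.1).2]))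
    (contDiffAt_polX hq)

theorem contDiffAt_angSpeed (a b : ℝ) {q : ℝ × ℝ × ℝ} (hq : q.1 ∈ Ioo (0 : ℝ) (1 / 6)) :
    ContDiffAt ℝ 1 (fun q : ℝ × ℝ × ℝ => angSpeed a b q.1 q.2.1 q.2.2) q := by
  have h1 := contDiffAt_polX hq
  have h2 := contDiffAt_psiRootDeriv_polX hq
  unfold angSpeed
  fun_prop

theorem contDiffAt_rate (a b : ℝ) {q : ℝ × ℝ × ℝ} (hq : q.1 ∈ Ioo (0 : ℝ) (1 / 6))
    (hw : angSpeed a b q.1 q.2.1 q.2.2 ≠ 0) :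
    ContDiffAt ℝ 1 (fun q : ℝ × ℝ × ℝ => rate a b q.1 q.2.1 q.2.2) q := by
  have h1 := contDiffAt_polX hq
  have h2 := contDiffAt_angSpeed a b hq
  unfold rate
  exact ContDiffAt.div (by fun_prop) h2 hw

/-- The derivative of `rate` with respect to `h`. -/
def rateDeriv (a b h θ ε : ℝ) : ℝ :=
  fderiv ℝ (fun q : ℝ × ℝ × ℝ => rate a b q.1 q.2.1 q.2.2) (h, θ, ε) (1, 0, 0)

theorem hasDerivAt_rate {a b h θ ε : ℝ} (hh : h ∈ Ioo (0 : ℝ) (1 / 6))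
    (hw : angSpeed a b h θ ε ≠ 0) :
    HasDerivAt (fun h => rate a b h θ ε) (rateDeriv a b h θ ε) h := by
  have h1 : HasFDerivAt (fun q : ℝ × ℝ × ℝ => rate a b q.1 q.2.1 q.2.2) _ (h, θ, ε) :=
    ((contDiffAt_rate a b (q := (h, θ, ε)) hh hw).differentiableAt one_ne_zero).hasFDerivAt
  have h2 : HasDerivAt (fun t : ℝ => ((t, θ, ε) : ℝ × ℝ × ℝ)) (1, 0, 0) h :=
    (hasDerivAt_id h).prodMk (hasDerivAt_const h (θ, ε))
  exact h1.comp_hasDerivAt h h2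

theorem continuousAt_rateDeriv (a b : ℝ) {q : ℝ × ℝ × ℝ} (hq : q.1 ∈ Ioo (0 : ℝ) (1 / 6))
    (hw : angSpeed a b q.1 q.2.1 q.2.2 ≠ 0) :
    ContinuousAt (fun q : ℝ × ℝ × ℝ => rateDeriv a b q.1 q.2.1 q.2.2) q :=
  ((contDiffAt_rate a b hq hw).continuousAt_fderiv one_ne_zero).clm_apply continuousAt_const

theorem angSpeed_zero_pos {a b h : ℝ} (hh : h ∈ Ioo (0 : ℝ) (1 / 6)) (θ : ℝ) :
    0 < angSpeed a b h θ 0 := by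
  have := psiRootDeriv_pos (polX_mem hh θ).2
  simp only [angSpeed, zero_mul, sub_zero]
  positivity

/-! ### Bounds on a compact range of levels -/

/-- Positivity of the angular speed and bounds for the rate and its derivative on `[c, d]`. -/
structure RateBounds (a b c d ε L : ℝ) : Prop where
  c_pos : 0 < c
  d_lt : d < 1 / 6
  L_nonneg : 0 ≤ L
  pos : ∀ h ∈ Icc c d, ∀ θ ∈ Icc 0 Real.pi, 0 < angSpeed a b h θ ε
  le : ∀ h ∈ Icc c d, ∀ θ ∈ Icc 0 Real.pi, |rate a b h θ ε| ≤ L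
  deriv_le : ∀ h ∈ Icc c d, ∀ θ ∈ Icc 0 Real.pi, |rateDeriv a b h θ ε| ≤ L

theorem RateBounds.mem {a b c d ε L : ℝ} (H : RateBounds a b c d ε L) {h : ℝ} (hh : h ∈ Icc c d) :
    h ∈ Ioo (0 : ℝ) (1 / 6) :=
  ⟨H.c_pos.trans_le hh.1, hh.2.trans_lt H.d_lt⟩

theorem RateBounds.mono {a b c d ε L L' : ℝ} (H : RateBounds a b c d ε L) (hL : L ≤ L') :
    RateBounds a b c d ε L' :=
  ⟨H.c_pos, H.d_lt, H.L_nonneg.trans hL, H.pos, fun h hh θ hθ => (H.le h hh θ hθ).trans hL,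
    fun h hh θ hθ => (H.deriv_le h hh θ hθ).trans hL⟩

theorem exists_angSpeed_pos (a b : ℝ) {c d : ℝ} (hc : 0 < c) (hd : d < 1 / 6) :
    ∃ ε₁ : ℝ, 0 < ε₁ ∧ ∀ ε : ℝ, |ε| ≤ ε₁ → ∀ h ∈ Icc c d, ∀ θ ∈ Icc 0 Real.pi,
      0 < angSpeed a b h θ ε := by
  rcases lt_or_ge d c with hcd | hcd
  · exact ⟨1, one_pos, fun ε _ h hh => absurd (hh.1.trans hh.2) (not_le.2 hcd)⟩
  have hmem : ∀ h ∈ Icc c d, h ∈ Ioo (0 : ℝ) (1 / 6) := fun h hh =>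
    ⟨hc.trans_le hh.1, hh.2.trans_lt hd⟩
  have hcont : ContinuousOn (fun q : ℝ × ℝ × ℝ => psiRootDeriv (polX q.1 q.2.1))
      (Icc c d ×ˢ Icc 0 Real.pi ×ˢ {0}) := fun q hq =>
    (contDiffAt_psiRootDeriv_polX (hmem _ hq.1)).continuousAt.continuousWithinAt
  obtain ⟨q, hq, hmin⟩ := (isCompact_Icc.prod (isCompact_Icc.prod isCompact_singleton)
    ).exists_isMinOn ⟨(c, 0, 0), ⟨le_rfl, hcd⟩, ⟨le_rfl, Real.pi_pos.le⟩, rfl⟩ hcont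
  set μ := psiRootDeriv (polX q.1 q.2.1) with hμ
  have hμ0 : 0 < μ := psiRootDeriv_pos (polX_mem (hmem _ hq.1) _).2
  -- Since |x| ≤ 1, this choice keeps the perturbation term at most μ, while the unperturbed speed
  -- is at least 2μ.
  refine ⟨μ / (|a| + |b| + 1), by positivity, fun ε hε h hh θ hθ => ?_⟩
  have h1 : μ ≤ psiRootDeriv (polX h θ) := hmin (show ((h, θ, 0) : ℝ × ℝ × ℝ) ∈ _ from ⟨hh, hθ, rfl⟩)
  have hx := polX_mem (hmem h hh) θ
  have hxa : |polX h θ| ≤ 1 := abs_le.2 ⟨by linarith [hx.1], hx.2.le⟩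
  have h2 : |a + b * polX h θ| ≤ |a| + |b| := by
    refine (abs_add_le _ _).trans ?_
    rw [abs_mul]
    gcongr
    exact mul_le_of_le_one_right (abs_nonneg b) hxa
  have h3 : |Real.sin θ * Real.cos θ| ≤ 1 := by
    rw [abs_mul]
    exact mul_le_one₀ (Real.abs_sin_le_one θ) (abs_nonneg _) (Real.abs_cos_le_one θ)
  have h4 : |ε * (Real.sin θ * Real.cos θ * (a + b * polX h θ))| ≤
      μ / (|a| + |b| + 1) * (1 * (|a| + |b|)) := by
    rw [abs_mul, abs_mul (Real.sin θ * Real.cos θ)]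
    gcongr
  have h5 : μ / (|a| + |b| + 1) * (1 * (|a| + |b|)) ≤ μ := by
    rw [one_mul, div_mul_eq_mul_div, div_le_iff₀ (by positivity)]
    nlinarith [abs_nonneg a, abs_nonneg b]
  have := (abs_le.1 (h4.trans h5)).2
  unfold angSpeed
  linarith

/-- Where the angular speed is positive, `rate` is jointly C¹, so it and its h-derivative are
bounded on the compact set of (h, θ, ε). One constant serves all small ε, which is what the limit ε
→ 0 needs. -/
theorem exists_rateBounds (a b : ℝ) {c d : ℝ} (hc : 0 < c) (hd : d < 1 / 6) :
    ∃ ε₁ L : ℝ, 0 < ε₁ ∧ ∀ ε : ℝ, |ε| ≤ ε₁ → RateBounds a b c d ε L := by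
  obtain ⟨ε₁, hε₁, hpos⟩ := exists_angSpeed_pos a b hc hd
  have hmem : ∀ h ∈ Icc c d, h ∈ Ioo (0 : ℝ) (1 / 6) := fun h hh =>
    ⟨hc.trans_le hh.1, hh.2.trans_lt hd⟩
  have hK : IsCompact (Icc c d ×ˢ Icc 0 Real.pi ×ˢ Icc (-ε₁) ε₁) :=
    isCompact_Icc.prod (isCompact_Icc.prod isCompact_Icc)
  have hne : ∀ q ∈ Icc c d ×ˢ Icc 0 Real.pi ×ˢ Icc (-ε₁) ε₁,
      angSpeed a b q.1 q.2.1 q.2.2 ≠ 0 := fun q hq =>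
    (hpos _ (abs_le.2 hq.2.2) _ hq.1 _ hq.2.1).ne'
  obtain ⟨L₁, hL₁⟩ := hK.exists_bound_of_continuousOn
    (f := fun q : ℝ × ℝ × ℝ => rate a b q.1 q.2.1 q.2.2) fun q hq =>
    (contDiffAt_rate a b (hmem _ hq.1) (hne q hq)).continuousAt.continuousWithinAt
  obtain ⟨L₂, hL₂⟩ := hK.exists_bound_of_continuousOn
    (f := fun q : ℝ × ℝ × ℝ => rateDeriv a b q.1 q.2.1 q.2.2) fun q hq =>
    (continuousAt_rateDeriv a b (hmem _ hq.1) (hne q hq)).continuousWithinAt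
  refine ⟨ε₁, max 0 (max L₁ L₂), hε₁, fun ε hε => ⟨hc, hd, le_max_left _ _, hpos ε hε,
    fun h hh θ hθ => ?_, fun h hh θ hθ => ?_⟩⟩
  · exact (hL₁ (h, θ, ε) ⟨hh, hθ, abs_le.1 hε⟩).trans
      ((le_max_left _ _).trans (le_max_right _ _))
  · exact (hL₂ (h, θ, ε) ⟨hh, hθ, abs_le.1 hε⟩).trans
      ((le_max_right _ _).trans (le_max_right _ _))

theorem RateBounds.abs_sub_le {a b c d ε L : ℝ} (H : RateBounds a b c d ε L) {h k θ : ℝ}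
    (hh : h ∈ Icc c d) (hk : k ∈ Icc c d) (hθ : θ ∈ Icc 0 Real.pi) :
    |rate a b k θ ε - rate a b h θ ε| ≤ L * |k - h| :=
  (convex_Icc c d).norm_image_sub_le_of_norm_hasDerivWithin_le
    (f := fun h => rate a b h θ ε) (f' := fun h => rateDeriv a b h θ ε)
    (fun x hx => (hasDerivAt_rate (H.mem hx) (H.pos x hx θ hθ).ne').hasDerivWithinAt)
    (fun x hx => H.deriv_le x hx θ hθ) hh hk

theorem RateBounds.continuousOn_rate {a b c d ε L : ℝ} (H : RateBounds a b c d ε L) {f : ℝ → ℝ}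
    (hf : ContinuousOn f (Icc 0 Real.pi)) (hf' : ∀ θ ∈ Icc 0 Real.pi, f θ ∈ Icc c d) :
    ContinuousOn (fun θ => rate a b (f θ) θ ε) (Icc 0 Real.pi) := fun θ hθ =>
  ContinuousAt.comp_continuousWithinAt (g := fun q : ℝ × ℝ × ℝ => rate a b q.1 q.2.1 q.2.2)
    (f := fun θ => (f θ, θ, ε))
    (contDiffAt_rate a b (H.mem (hf' θ hθ)) (H.pos _ (hf' θ hθ) θ hθ).ne').continuousAt
    ((hf θ hθ).prodMk (continuousWithinAt_id.prodMk continuousWithinAt_const))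

/-! ### Half-turn solutions -/

/-- Solutions on a half-turn `[0, π]` of the equation for the level as a function of the angle. -/
structure IsHalfSol (a b c d ε : ℝ) (h : ℝ → ℝ) : Prop where
  cont : ContinuousOn h (Icc 0 Real.pi)
  mem : ∀ θ ∈ Icc 0 Real.pi, h θ ∈ Icc c d
  deriv : ∀ θ ∈ Ioo 0 Real.pi, HasDerivAt h (ε * rate a b (h θ) θ ε) θ

/-- A two-sided Grönwall estimate. -/
theorem abs_le_exp_mul_of_abs_deriv_le {f f' : ℝ → ℝ} {L α β : ℝ}
    (hc : ContinuousOn f (Icc α β)) (hd : ∀ t ∈ Ioo α β, HasDerivAt f (f' t) t)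
    (hb : ∀ t ∈ Ioo α β, |f' t| ≤ L * |f t|) {s t : ℝ} (hs : s ∈ Icc α β) (ht : t ∈ Icc α β)
    (hst : s ≤ t) :
    |f t| ≤ Real.exp (L * (t - s)) * |f s| ∧ |f s| ≤ Real.exp (L * (t - s)) * |f t| := by
  -- Squaring avoids differentiating |f|. The weight with σ = -1 gives a decreasing function and the
  -- forward bound, σ = 1 an increasing one and the backward bound.
  have key : ∀ σ : ℝ, ∀ x ∈ Ioo α β, HasDerivAt (fun t => f t ^ 2 * Real.exp (σ * (2 * L) * t))
      ((2 * f x * f' x + σ * (2 * L) * f x ^ 2) * Real.exp (σ * (2 * L) * x)) x := by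
    intro σ x hx
    have h1 : HasDerivAt (fun t : ℝ => Real.exp (σ * (2 * L) * t))
        (Real.exp (σ * (2 * L) * x) * (σ * (2 * L))) x := by
      simpa using ((hasDerivAt_id x).const_mul (σ * (2 * L))).exp
    refine (((hd x hx).pow 2).mul h1).congr_deriv ?_
    simp only [Pi.pow_apply]
    push_cast
    ring
  have hcont : ∀ σ : ℝ, ContinuousOn (fun t => f t ^ 2 * Real.exp (σ * (2 * L) * t)) (Icc α β) :=
    fun σ => (hc.pow 2).mul (by fun_prop)
  have hbd : ∀ x ∈ Ioo α β, |f x * f' x| ≤ L * f x ^ 2 := by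
    intro x hx
    rw [abs_mul, ← sq_abs (f x)]
    nlinarith [hb x hx, abs_nonneg (f x)]
  have e1 : ∀ u v : ℝ, Real.exp (2 * L * (u - v)) = Real.exp (L * (u - v)) ^ 2 := by
    intro u v
    rw [← Real.exp_nat_mul]
    push_cast
    ring_nf
  have fin : ∀ u v : ℝ, f u ^ 2 ≤ Real.exp (2 * L * (t - s)) * f v ^ 2 →
      |f u| ≤ Real.exp (L * (t - s)) * |f v| := by
    intro u v h
    refine abs_le_of_sq_le_sq' ?_ (by positivity) |> fun h => abs_le.2 h
    rw [mul_pow, ← e1, sq_abs]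
    exact h
  constructor
  · refine fin t s ?_
    have hanti : AntitoneOn (fun t => f t ^ 2 * Real.exp (-1 * (2 * L) * t)) (Icc α β) := by
      refine antitoneOn_of_deriv_nonpos (convex_Icc α β) (hcont _) ?_ ?_
      · rw [interior_Icc]
        exact fun x hx => (key _ x hx).differentiableAt.differentiableWithinAt
      · rw [interior_Icc]
        intro x hx
        rw [(key _ x hx).deriv]
        refine mul_nonpos_of_nonpos_of_nonneg ?_ (Real.exp_pos _).le
        linarith [(abs_le.1 (hbd x hx)).2]
    have h := hanti hs ht hst
    simp only at h
    calc f t ^ 2 = f t ^ 2 * Real.exp (-1 * (2 * L) * t) * Real.exp (2 * L * t) := by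
          rw [mul_assoc, ← Real.exp_add]; simp
      _ ≤ f s ^ 2 * Real.exp (-1 * (2 * L) * s) * Real.exp (2 * L * t) := by gcongr
      _ = _ := by rw [mul_assoc, ← Real.exp_add, mul_comm]; congr 2; ring
  · refine fin s t ?_
    have hmono : MonotoneOn (fun t => f t ^ 2 * Real.exp (1 * (2 * L) * t)) (Icc α β) := by
      refine monotoneOn_of_deriv_nonneg (convex_Icc α β) (hcont _) ?_ ?_
      · rw [interior_Icc]
        exact fun x hx => (key _ x hx).differentiableAt.differentiableWithinAt
      · rw [interior_Icc]
        intro x hx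
        rw [(key _ x hx).deriv]
        refine mul_nonneg ?_ (Real.exp_pos _).le
        linarith [(abs_le.1 (hbd x hx)).1]
    have h := hmono hs ht hst
    simp only at h
    calc f s ^ 2 = f s ^ 2 * Real.exp (1 * (2 * L) * s) * Real.exp (-(2 * L * s)) := by
          rw [mul_assoc, ← Real.exp_add]; simp
      _ ≤ f t ^ 2 * Real.exp (1 * (2 * L) * t) * Real.exp (-(2 * L * s)) := by gcongr
      _ = _ := by rw [mul_assoc, ← Real.exp_add, mul_comm]; congr 2; ring

namespace IsHalfSol

variable {a b c d ε L : ℝ} {h k : ℝ → ℝ}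

theorem abs_sub_le (H : RateBounds a b c d ε L) (hh : IsHalfSol a b c d ε h)
    (hk : IsHalfSol a b c d ε k) {s t : ℝ} (hs : s ∈ Icc 0 Real.pi) (ht : t ∈ Icc 0 Real.pi) :
    |k t - h t| ≤ Real.exp (|ε| * L * |t - s|) * |k s - h s| := by
  have key := fun s t (hs : s ∈ Icc 0 Real.pi) (ht : t ∈ Icc 0 Real.pi) (hst : s ≤ t) =>
    abs_le_exp_mul_of_abs_deriv_le (L := |ε| * L) (hk.cont.sub hh.cont)
    (fun t ht => (hk.deriv t ht).sub (hh.deriv t ht)) (fun t ht => ?_) hs ht hst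
  · rcases le_total s t with hst | hst
    · rw [abs_of_nonneg (sub_nonneg.2 hst)]
      exact (key s t hs ht hst).1
    · rw [abs_of_nonpos (sub_nonpos.2 hst), neg_sub]
      exact (key t s ht hs hst).2
  · have ht' := Ioo_subset_Icc_self ht
    rw [← mul_sub, abs_mul, mul_assoc]
    gcongr
    exact H.abs_sub_le (hh.mem t ht') (hk.mem t ht') ht'

theorem eqOn (H : RateBounds a b c d ε L) (hh : IsHalfSol a b c d ε h)
    (hk : IsHalfSol a b c d ε k) {s : ℝ} (hs : s ∈ Icc 0 Real.pi) (e : h s = k s) :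
    EqOn h k (Icc 0 Real.pi) := by
  intro t ht
  have := abs_sub_le H hh hk hs ht
  rw [e, sub_self, abs_zero, mul_zero] at this
  exact (sub_eq_zero.1 (abs_nonpos_iff.1 this)).symm

/-- Graphs of solutions of a scalar equation cannot cross: a meeting point would force equality
everywhere by uniqueness. -/
theorem lt_of_lt (H : RateBounds a b c d ε L) (hh : IsHalfSol a b c d ε h)
    (hk : IsHalfSol a b c d ε k) {s t : ℝ} (hs : s ∈ Icc 0 Real.pi) (ht : t ∈ Icc 0 Real.pi)
    (hlt : h s < k s) : h t < k t := by
  by_contra! hle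
  obtain ⟨r, hr, hr'⟩ := isPreconnected_Icc.intermediate_value₂ hs ht hh.cont hk.cont hlt.le hle
  exact hlt.ne (eqOn H hh hk hr hr' hs)

theorem abs_sub_initial_le (H : RateBounds a b c d ε L) (hh : IsHalfSol a b c d ε h) {t : ℝ}
    (ht : t ∈ Icc 0 Real.pi) : |h t - h 0| ≤ |ε| * L * Real.pi := by
  rcases ht.1.eq_or_lt with rfl | h0
  · simpa using mul_nonneg (mul_nonneg (abs_nonneg ε) H.L_nonneg) Real.pi_pos.le
  obtain ⟨x, hx, hx'⟩ := exists_hasDerivAt_eq_slope h _ h0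
    (hh.cont.mono (Icc_subset_Icc_right ht.2)) fun x hx => hh.deriv x ⟨hx.1, hx.2.trans_le ht.2⟩
  have hxm : x ∈ Icc 0 Real.pi := ⟨hx.1.le, hx.2.le.trans ht.2⟩
  rw [sub_zero, eq_div_iff h0.ne'] at hx'
  rw [← hx', abs_mul, abs_mul, abs_of_pos h0]
  have := H.le _ (hh.mem x hxm) x hxm
  have h2 := ht.2
  have h3 := H.L_nonneg
  gcongr

end IsHalfSol

end

noncomputable section

/-! ### Absolutely continuous functions and time changes -/

theorem AbsolutelyContinuousOnInterval.comp_lipschitz {X Y : Type*} [PseudoMetricSpace X]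
    [PseudoMetricSpace Y] {f : ℝ → X} {a b : ℝ} (hf : AbsolutelyContinuousOnInterval f a b)
    {g : X → Y} (hg : LipschitzWith 1 g) : AbsolutelyContinuousOnInterval (fun t => g (f t)) a b := by
  unfold AbsolutelyContinuousOnInterval at *
  refine squeeze_zero (fun E => Finset.sum_nonneg fun _ _ => dist_nonneg) (fun E => ?_) hf
  refine Finset.sum_le_sum fun i _ => ?_
  simpa using hg.dist_le_mul (f (E.2 i).1) (f (E.2 i).2)

theorem AbsolutelyContinuousOnInterval.prodMk {X Y : Type*} [PseudoMetricSpace X]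
    [PseudoMetricSpace Y] {f : ℝ → X} {g : ℝ → Y} {a b : ℝ}
    (hf : AbsolutelyContinuousOnInterval f a b) (hg : AbsolutelyContinuousOnInterval g a b) :
    AbsolutelyContinuousOnInterval (fun t => (f t, g t)) a b := by
  unfold AbsolutelyContinuousOnInterval at *
  have h := hf.add hg
  rw [add_zero] at h
  refine squeeze_zero (fun E => Finset.sum_nonneg fun _ _ => dist_nonneg) (fun E => ?_) h
  rw [← Finset.sum_add_distrib]
  refine Finset.sum_le_sum fun i _ => ?_
  rw [Prod.dist_eq]
  exact max_le_add_of_nonneg dist_nonneg dist_nonneg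

/-- By the fundamental theorem with countably many exceptions, f is a constant plus the integral of
f', so it has the increments of an absolutely continuous function. This admits curves with a corner
at each crossing of the switching line. -/
theorem absolutelyContinuousOnInterval_of_hasDerivAt_off_countable {f f' : ℝ → ℝ} {s : Set ℝ}
    (hf : Continuous f) (hs : s.Countable) (hd : ∀ t ∉ s, HasDerivAt f (f' t) t) {a b : ℝ}
    (hi : IntervalIntegrable f' volume a b) : AbsolutelyContinuousOnInterval f a b := by
  have h1 := hi.absolutelyContinuousOnInterval_intervalIntegral left_mem_uIcc
  have h2 : AbsolutelyContinuousOnInterval (fun _ : ℝ => f a) a b :=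
    ((LipschitzWith.const (f a)).lipschitzOnWith (s := uIcc a b)).absolutelyContinuousOnInterval
  unfold AbsolutelyContinuousOnInterval at *
  have h3 := h1.add h2
  rw [add_zero] at h3
  refine squeeze_zero' (Filter.Eventually.of_forall fun E =>
    Finset.sum_nonneg fun _ _ => dist_nonneg) ?_ h3
  have hE := Filter.mem_inf_of_right (f := AbsolutelyContinuousOnInterval.totalLengthFilter)
    (Filter.mem_principal_self (AbsolutelyContinuousOnInterval.disjWithin a b))
  filter_upwards [hE] with E hE
  rw [← Finset.sum_add_distrib]
  refine Finset.sum_le_sum fun i hi' => ?_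
  have hmem := hE.1 i hi'
  have key : ∀ t ∈ uIcc a b, f t = (∫ v in a..t, f' v) + f a := by
    intro t ht
    rw [integral_eq_of_hasDerivAt_off_countable f f' hs hf.continuousOn
      (fun x hx => hd x hx.2) (hi.mono_set (uIcc_subset_uIcc_left ht))]
    ring
  rw [key _ hmem.1, key _ hmem.2]
  simp

theorem eq_of_hasDerivAt_zero_off_countable {f : ℝ → ℝ} {s : Set ℝ} (hf : Continuous f)
    (hs : s.Countable) (hd : ∀ t ∉ s, HasDerivAt f 0 t) (a b : ℝ) : f a = f b := by
  have := integral_eq_of_hasDerivAt_off_countable f (fun _ => 0) hs hf.continuousOn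
    (fun x (hx : x ∈ Ioo (min b a) (max b a) \ s) => hd x hx.2) intervalIntegrable_const
  simp only [intervalIntegral.integral_zero] at this
  linarith

/-- This exchanges time and angle as independent variable. The uniform bound makes f(x) - mx
monotone, so f is unbounded in both directions and hence onto. -/
theorem exists_inverse_of_deriv_ge {f f' : ℝ → ℝ} {m : ℝ} (hm : 0 < m)
    (hd : ∀ x, HasDerivAt f (f' x) x) (hf' : ∀ x, m ≤ f' x) :
    StrictMono f ∧ ∃ g : ℝ → ℝ, (∀ t, f (g t) = t) ∧ (∀ x, g (f x) = x) ∧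
      ∀ t, HasDerivAt g (f' (g t))⁻¹ t := by
  have hmono : StrictMono f := strictMono_of_deriv_pos fun x => by
    rw [(hd x).deriv]; exact hm.trans_le (hf' x)
  have hcont : Continuous f := continuous_iff_continuousAt.2 fun x => (hd x).continuousAt
  have hdl : ∀ x, HasDerivAt (fun x => f x - m * x) (f' x - m * 1) x := fun x =>
    (hd x).sub ((hasDerivAt_id x).const_mul m)
  have hlin : Monotone fun x => f x - m * x := by
    refine monotone_of_deriv_nonneg (fun x => (hdl x).differentiableAt) fun x => ?_
    rw [(hdl x).deriv]
    linarith [hf' x]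
  have hsurj : Function.Surjective f := by
    refine hcont.surjective ?_ ?_
    · refine Filter.tendsto_atTop_mono' _ ?_
        (Filter.tendsto_atTop_add_const_left _ (f 0) (Filter.tendsto_id.const_mul_atTop hm))
      filter_upwards [Filter.eventually_ge_atTop 0] with x hx
      have := hlin hx
      simp only [id] at this ⊢
      linarith
    · refine Filter.tendsto_atBot_mono' _ ?_
        (Filter.tendsto_atBot_add_const_left _ (f 0) (Filter.tendsto_id.const_mul_atBot hm))
      filter_upwards [Filter.eventually_le_atBot 0] with x hx
      have := hlin hx
      simp only [id] at this ⊢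
      linarith
  set e := hmono.orderIsoOfSurjective f hsurj with he
  have h1 : ∀ t, f (e.symm t) = t := fun t => e.apply_symm_apply t
  have h2 : ∀ x, e.symm (f x) = x := fun x => e.symm_apply_apply x
  refine ⟨hmono, e.symm, h1, h2, fun t => ?_⟩
  exact HasDerivAt.of_local_left_inverse e.symm.continuous.continuousAt (hd _)
    (hm.trans_le (hf' _)).ne' (Filter.Eventually.of_forall h1)

/-! ### Curves with prescribed levels -/

/-- The point of the right half-plane with level `h` and angle `θ`. -/
def rightPt (h θ : ℝ) : ℝ × ℝ := (polX h θ, √h * Real.cos θ)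

/-- The reflection of `rightPt` in the switching line. -/
def leftPt (h θ : ℝ) : ℝ × ℝ := (-polX h θ, √h * Real.cos θ)

/-- The closed curve with levels `h` on the right and `k` on the left half-turn. -/
def turnSet (h k : ℝ → ℝ) : Set (ℝ × ℝ) :=
  (fun θ => rightPt (h θ) θ) '' Icc 0 Real.pi ∪ (fun θ => leftPt (k θ) θ) '' Icc 0 Real.pi

/-- Derivatives of the Cartesian coordinates in terms of those of the level and the angle. -/
theorem hasDerivAt_cartesian {a b ε s t : ℝ} {h φ : ℝ → ℝ} (hh : h t ∈ Ioo (0 : ℝ) (1 / 6))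
    (hφ : HasDerivAt φ (s * angSpeed a b (h t) (φ t) ε) t)
    (hd : HasDerivAt h
      (s * (ε * (2 * h t * Real.cos (φ t) ^ 2 * (a + b * polX (h t) (φ t))))) t) :
    HasDerivAt (fun t => polX (h t) (φ t)) (s * (2 * (√(h t) * Real.cos (φ t)))) t ∧
    HasDerivAt (fun t => √(h t) * Real.cos (φ t)) (s * (polX (h t) (φ t) * (polX (h t) (φ t) - 1)
      + ε * ((a + b * polX (h t) (φ t)) * (√(h t) * Real.cos (φ t))))) t := by
  have hx := polX_mem hh (φ t)
  have hm := psiRootDeriv_pos hx.2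
  have hr : 0 < √(h t) := Real.sqrt_pos.2 hh.1
  have hrs : √(h t) ^ 2 = h t := Real.sq_sqrt hh.1.le
  have h1 := hd.sqrt hh.1.ne'
  have hu := h1.mul hφ.sin
  have hX := (hasDerivAt_psiInv (sqrt_mul_sin_mem hh (φ t))).comp t hu
  have hy := h1.mul hφ.cos
  have hroot := two_mul_psiRoot_mul_deriv (x := polX (h t) (φ t)) (by linarith [hx.2])
  rw [psiRoot_polX hh] at hroot
  have hsc := Real.sin_sq_add_cos_sq (φ t)
  constructor
  · refine (hX.congr_deriv ?_ : HasDerivAt (fun t => polX (h t) (φ t)) _ t)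
    change (psiRootDeriv (polX (h t) (φ t)))⁻¹ * _ = _
    rw [inv_mul_eq_iff_eq_mul₀ hm.ne']
    unfold angSpeed
    generalize psiRootDeriv (polX (h t) (φ t)) = m at *
    generalize polX (h t) (φ t) = X at *
    generalize √(h t) = r at *
    rw [← hrs]
    field_simp
    ring
  · refine (hy.congr_deriv ?_ : HasDerivAt (fun t => √(h t) * Real.cos (φ t)) _ t)
    unfold angSpeed
    -- The force is minus the derivative of `psiRoot`², which expresses it through √h sin θ.
    have e : polX (h t) (φ t) * (polX (h t) (φ t) - 1) =
      -(2 * (√(h t) * Real.sin (φ t)) * psiRootDeriv (polX (h t) (φ t))) := by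
      rw [hroot]; ring
    rw [e]
    generalize psiRootDeriv (polX (h t) (φ t)) = m at *
    generalize polX (h t) (φ t) = X at *
    generalize √(h t) = r at *
    rw [← hrs]
    field_simp
    linear_combination (ε * (a + b * X) * Real.cos (φ t) * s) * hsc

theorem continuous_polX_comp {h φ : ℝ → ℝ} (hh : Continuous h) (hφ : Continuous φ)
    (hm : ∀ t, h t ∈ Ioo (0 : ℝ) (1 / 6)) : Continuous fun t => polX (h t) (φ t) :=
  continuous_iff_continuousAt.2 fun t =>
    ContinuousAt.comp (g := fun q : ℝ × ℝ × ℝ => polX q.1 q.2.1) (f := fun t => (h t, φ t, 0))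
      (contDiffAt_polX (q := (h t, φ t, 0)) (hm t)).continuousAt (by fun_prop)

theorem continuous_angSpeed_comp (a b ε : ℝ) {h φ : ℝ → ℝ} (hh : Continuous h) (hφ : Continuous φ)
    (hm : ∀ t, h t ∈ Ioo (0 : ℝ) (1 / 6)) : Continuous fun t => angSpeed a b (h t) (φ t) ε :=
  continuous_iff_continuousAt.2 fun t =>
    ContinuousAt.comp (g := fun q : ℝ × ℝ × ℝ => angSpeed a b q.1 q.2.1 q.2.2)
      (f := fun t => (h t, φ t, ε))
      (contDiffAt_angSpeed a b (q := (h t, φ t, ε)) (hm t)).continuousAt (by fun_prop)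

end

noncomputable section

/-! ### Symmetric periodic orbits -/

/-- The triangle wave, the representative in `[0, π]` of an angle up to sign. -/
def foldAngle (θ : ℝ) : ℝ := Real.arccos (Real.cos θ)

theorem foldAngle_mem (θ : ℝ) : foldAngle θ ∈ Icc 0 Real.pi :=
  ⟨Real.arccos_nonneg _, Real.arccos_le_pi _⟩

theorem continuous_foldAngle : Continuous foldAngle :=
  Real.continuous_arccos.comp Real.continuous_cos

theorem cos_foldAngle (θ : ℝ) : Real.cos (foldAngle θ) = Real.cos θ :=
  Real.cos_arccos (Real.neg_one_le_cos θ) (Real.cos_le_one θ)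

theorem foldAngle_of_mem {θ : ℝ} (hθ : θ ∈ Icc 0 Real.pi) : foldAngle θ = θ :=
  Real.arccos_cos hθ.1 hθ.2

theorem foldAngle_neg (θ : ℝ) : foldAngle (-θ) = foldAngle θ := by simp [foldAngle]

theorem foldAngle_add_two_pi (θ : ℝ) : foldAngle (θ + 2 * Real.pi) = foldAngle θ := by
  simp [foldAngle]

theorem sin_foldAngle (θ : ℝ) : Real.sin (foldAngle θ) = |Real.sin θ| := by
  rw [foldAngle, Real.sin_arccos, ← Real.abs_sin_eq_sqrt_one_sub_cos_sq]

theorem foldAngle_mem_Ioo {θ : ℝ} (hθ : Real.sin θ ≠ 0) : foldAngle θ ∈ Ioo 0 Real.pi := by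
  have h := foldAngle_mem θ
  have h1 : Real.sin (foldAngle θ) ≠ 0 := by rw [sin_foldAngle]; exact abs_ne_zero.2 hθ
  refine ⟨lt_of_le_of_ne h.1 fun e => h1 ?_, lt_of_le_of_ne h.2 fun e => h1 ?_⟩
  · rw [← e, Real.sin_zero]
  · rw [e, Real.sin_pi]

/-- The side of the switching line on which the point with angle `θ` lies. -/
def side (θ : ℝ) : ℝ := if 0 ≤ Real.sin θ then 1 else -1

theorem measurable_side : Measurable side :=
  Measurable.ite (measurableSet_le measurable_const Real.measurable_sin) measurable_const
    measurable_const

theorem abs_side (θ : ℝ) : |side θ| = 1 := by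
  unfold side; split_ifs <;> simp

theorem side_mul_self (θ : ℝ) : side θ * side θ = 1 := by
  unfold side; split_ifs <;> simp

theorem hasDerivAt_foldAngle {θ : ℝ} (hθ : Real.sin θ ≠ 0) :
    HasDerivAt foldAngle (side θ) θ := by
  have h := foldAngle_mem_Ioo hθ
  have hc := cos_foldAngle θ
  have h1 : Real.cos θ ≠ -1 := by
    intro e
    have := Real.sin_sq_add_cos_sq θ
    rw [e] at this
    exact hθ (by nlinarith)
  have h2 : Real.cos θ ≠ 1 := by
    intro e
    have := Real.sin_sq_add_cos_sq θ
    rw [e] at this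
    exact hθ (by nlinarith)
  have h3 := (Real.hasDerivAt_arccos h1 h2).comp θ (Real.hasDerivAt_cos θ)
  refine (h3.congr_deriv ?_ : HasDerivAt foldAngle _ θ)
  rw [← Real.abs_sin_eq_sqrt_one_sub_cos_sq]
  unfold side
  split_ifs with hs
  · rw [abs_of_nonneg hs]; field_simp
  · rw [abs_of_neg (not_le.1 hs)]; field_simp

theorem eventually_side_eq {θ : ℝ} (hθ : Real.sin θ ≠ 0) : ∀ᶠ φ in nhds θ, side φ = side θ := by
  rcases lt_or_gt_of_ne hθ with h | h
  · filter_upwards [Real.continuous_sin.continuousAt.eventually_lt_const h] with φ hφ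
    simp [side, not_le.2 h, not_le.2 hφ]
  · filter_upwards [Real.continuous_sin.continuousAt.eventually_const_lt h] with φ hφ
    simp [side, h.le, hφ.le]

theorem countable_sin_eq_zero : {θ : ℝ | Real.sin θ = 0}.Countable := by
  refine (countable_range fun n : ℤ => (n : ℝ) * Real.pi).mono fun θ hθ => ?_
  obtain ⟨n, hn⟩ := Real.sin_eq_zero_iff.1 hθ
  exact ⟨n, hn⟩

/-- With left coefficients (-a, b) the system is reversible under x ↦ -x, t ↦ -t. An orbit therefore
runs back on the left through the mirror images of its points on the right, and closes whatever the
values of η at 0 and π. This yields both the unperturbed ovals and the closed orbits in the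
degenerate case. -/
theorem isPeriodicOrbit_turnSet {a b c d ε L : ℝ} (H : RateBounds a b c d ε L) {η : ℝ → ℝ}
    (hη : IsHalfSol a b c d ε η) :
    IsPeriodicOrbit (fieldPlus a b ε) (fieldMinus (-a) b ε) (turnSet η η) := by
  set lev : ℝ → ℝ := fun θ => η (foldAngle θ) with hlev
  have lev_mem : ∀ θ, lev θ ∈ Icc c d := fun θ => hη.mem _ (foldAngle_mem θ)
  have lev_mem' : ∀ θ, lev θ ∈ Ioo (0 : ℝ) (1 / 6) := fun θ => H.mem (lev_mem θ)
  have lev_cont : Continuous lev := hη.cont.comp_continuous continuous_foldAngle foldAngle_mem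
  set w : ℝ → ℝ := fun θ => angSpeed a b (lev θ) (foldAngle θ) ε with hw
  have w_pos : ∀ θ, 0 < w θ := fun θ => H.pos _ (lev_mem θ) _ (foldAngle_mem θ)
  have w_cont : Continuous w :=
    continuous_angSpeed_comp a b ε lev_cont continuous_foldAngle lev_mem'
  have w_per : Function.Periodic w (2 * Real.pi) := fun θ => by
    simp only [hw, hlev, foldAngle_add_two_pi]
  have winv_cont : Continuous fun θ => (w θ)⁻¹ := w_cont.inv₀ fun θ => (w_pos θ).ne'
  have winv_per : Function.Periodic (fun θ => (w θ)⁻¹) (2 * Real.pi) := fun θ => by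
    simp only [w_per θ]
  -- The speed depends only on the folded angle, so a minimum over [0, π] is a global one.
  obtain ⟨m, hm, hmw⟩ : ∃ m : ℝ, 0 < m ∧ ∀ θ, m ≤ (w θ)⁻¹ := by
    obtain ⟨θ₀, -, hθ₀⟩ := isCompact_Icc.exists_isMinOn (s := Icc 0 Real.pi)
      ⟨0, le_rfl, Real.pi_pos.le⟩ winv_cont.continuousOn
    refine ⟨(w θ₀)⁻¹, inv_pos.2 (w_pos _), fun θ => ?_⟩
    have := hθ₀ (foldAngle_mem θ)
    simpa only [mem_ofPred_eq, hw, hlev, foldAngle_of_mem (foldAngle_mem θ)] using this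
  set τ : ℝ → ℝ := fun θ => ∫ s in (0 : ℝ)..θ, (w s)⁻¹ with hτ
  have τ_deriv : ∀ θ, HasDerivAt τ (w θ)⁻¹ θ := fun θ => winv_cont.integral_hasStrictDerivAt 0 θ
    |>.hasDerivAt
  obtain ⟨τ_mono, Θ, hτΘ, hΘτ, Θ_deriv⟩ := exists_inverse_of_deriv_ge hm τ_deriv hmw
  simp only [inv_inv] at Θ_deriv
  have Θ_cont : Continuous Θ := continuous_iff_continuousAt.2 fun t => (Θ_deriv t).continuousAt
  have τ_add : ∀ θ, τ (θ + 2 * Real.pi) = τ θ + τ (2 * Real.pi) := by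
    intro θ
    have h1 := winv_per.intervalIntegral_add_eq θ 0
    have h2 := intervalIntegral.integral_add_adjacent_intervals
      (winv_cont.intervalIntegrable 0 θ (μ := volume))
      (winv_cont.intervalIntegrable θ (θ + 2 * Real.pi))
    rw [zero_add] at h1
    simp only [hτ]
    rw [← h2, h1]
  have τ_zero : τ 0 = 0 := by simp [hτ]
  have hT : 0 < τ (2 * Real.pi) := by
    rw [← τ_zero]; exact τ_mono (by positivity)
  have Θ_add : ∀ t, Θ (t + τ (2 * Real.pi)) = Θ t + 2 * Real.pi := by
    intro t
    apply τ_mono.injective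
    rw [hτΘ, τ_add, hτΘ]
  -- X is the abscissa after reflection into the right half-plane; the true abscissa is `side` times
  -- X.
  set X : ℝ → ℝ := fun t => polX (lev (Θ t)) (foldAngle (Θ t)) with hX
  set Y : ℝ → ℝ := fun t => √(lev (Θ t)) * Real.cos (foldAngle (Θ t)) with hY
  set S : Set ℝ := {t | Real.sin (Θ t) = 0} with hS
  have S_count : S.Countable :=
    countable_sin_eq_zero.preimage_of_injOn
      (Function.LeftInverse.injective hτΘ).injOn
  have X_cont : Continuous X := continuous_polX_comp (lev_cont.comp Θ_cont)
    (continuous_foldAngle.comp Θ_cont) fun t => lev_mem' _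
  have Y_cont : Continuous Y := (lev_cont.comp Θ_cont).sqrt.mul
    (Real.continuous_cos.comp (continuous_foldAngle.comp Θ_cont))
  have hXY : ∀ t ∉ S, HasDerivAt X (side (Θ t) * (2 * Y t)) t ∧ HasDerivAt Y
      (side (Θ t) * (X t * (X t - 1) + ε * ((a + b * X t) * Y t))) t := by
    intro t ht
    have hφ : HasDerivAt (fun t => foldAngle (Θ t)) (side (Θ t) * w (Θ t)) t :=
      (hasDerivAt_foldAngle ht).comp t (Θ_deriv t)
    have hl : HasDerivAt (fun t => lev (Θ t)) (side (Θ t) * (ε * (2 * lev (Θ t) *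
        Real.cos (foldAngle (Θ t)) ^ 2 * (a + b * polX (lev (Θ t)) (foldAngle (Θ t)))))) t := by
      refine ((hη.deriv _ (foldAngle_mem_Ioo ht)).comp t hφ).congr_deriv ?_
      have := (w_pos (Θ t)).ne'
      simp only [hw, hlev] at this
      simp only [rate, hw, hlev]
      field_simp
    exact hasDerivAt_cartesian (lev_mem' _) hφ hl
  have X_zero : ∀ t ∈ S, X t = 0 := by
    intro t ht
    simp only [hX, polX, sin_foldAngle]
    rw [show Real.sin (Θ t) = 0 from ht]
    simp [psiInv_zero]
  have X_pos : ∀ t ∉ S, 0 < X t := fun t ht => polX_pos (lev_mem' _) (foldAngle_mem_Ioo ht)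
  have x_cont : Continuous fun t => side (Θ t) * X t := by
    refine continuous_iff_continuousAt.2 fun t => ?_
    by_cases ht : t ∈ S
    · have h0 : Filter.Tendsto (fun t => |X t|) (nhds t) (nhds 0) := by
        have := X_cont.abs.continuousAt (x := t)
        rwa [ContinuousAt, X_zero t ht, abs_zero] at this
      rw [ContinuousAt, X_zero t ht, mul_zero]
      refine squeeze_zero_norm (fun s => ?_) h0
      rw [norm_mul, Real.norm_eq_abs, abs_side, one_mul, Real.norm_eq_abs]
    · refine (X_cont.continuousAt.const_mul (side (Θ t))).congr ?_
      filter_upwards [Θ_cont.continuousAt.eventually (eventually_side_eq ht)] with s hs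
      rw [hs]
  have x_deriv : ∀ t ∉ S, HasDerivAt (fun t => side (Θ t) * X t) (2 * Y t) t := by
    intro t ht
    have h1 := (hXY t ht).1.const_mul (side (Θ t))
    rw [← mul_assoc, side_mul_self, one_mul] at h1
    refine h1.congr_of_eventuallyEq ?_
    filter_upwards [Θ_cont.continuousAt.eventually (eventually_side_eq ht)] with s hs
    rw [hs]
  -- The period is the time of a full turn. The curve is nonconstant because at angle π its ordinate
  -- is negative and at angle 0 positive.
  refine ⟨fun t => (side (Θ t) * X t, Y t), τ (2 * Real.pi), hT, ⟨fun u v => ?_, ?_⟩, fun t => ?_,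
    ⟨τ Real.pi, ?_⟩, ?_⟩
  · refine AbsolutelyContinuousOnInterval.prodMk
      (absolutelyContinuousOnInterval_of_hasDerivAt_off_countable x_cont S_count x_deriv
        ((continuous_const.mul Y_cont).intervalIntegrable u v))
      (absolutelyContinuousOnInterval_of_hasDerivAt_off_countable Y_cont S_count
        (fun t ht => (hXY t ht).2) ?_)
    -- The derivative of the ordinate may jump with `side`, but `side` is measurable and bounded.
    refine IntervalIntegrable.mul_continuousOn ?_ (by fun_prop)
    refine (intervalIntegrable_const (c := (1 : ℝ))).mono_fun
      (measurable_side.comp Θ_cont.measurable).aestronglyMeasurable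
      (Filter.Eventually.of_forall fun t => ?_)
    simp [abs_side]
  · filter_upwards [S_count.ae_notMem volume] with t ht
    refine ⟨_, ?_, (x_deriv t ht).prodMk (hXY t ht).2⟩
    have h0 := X_pos t ht
    unfold filippovSet
    by_cases hs : 0 ≤ Real.sin (Θ t)
    · have hs1 : side (Θ t) = 1 := by simp [side, hs]
      simp only [hs1, one_mul, h0, if_true, mem_singleton_iff, fieldPlus_apply]
    · have hs1 : side (Θ t) = -1 := by simp [side, hs]
      have h1 : ¬ (0 < -X t) := by linarith
      have h2 : -X t < 0 := by linarith
      simp only [hs1, neg_one_mul, h1, h2, if_false, if_true, mem_singleton_iff, fieldMinus_apply,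
        Prod.mk.injEq, true_and]
      ring
  · have hside : side (Θ t + 2 * Real.pi) = side (Θ t) := by simp [side]
    simp only [hX, hY, hlev, Θ_add, foldAngle_add_two_pi, hside]
  · intro e
    have h2 := congrArg Prod.snd e
    simp only [hY, hΘτ] at h2
    rw [← τ_zero, hΘτ, foldAngle_of_mem ⟨Real.pi_pos.le, le_rfl⟩,
      foldAngle_of_mem ⟨le_rfl, Real.pi_pos.le⟩, Real.cos_pi, Real.cos_zero] at h2
    have h3 := Real.sqrt_pos.2 (lev_mem' Real.pi).1
    have h4 := Real.sqrt_pos.2 (lev_mem' 0).1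
    linarith
  · apply Subset.antisymm
    · rintro z (⟨θ, hθ, rfl⟩ | ⟨θ, hθ, rfl⟩)
      · refine ⟨τ θ, ?_⟩
        have hs1 : side θ = 1 := by simp [side, Real.sin_nonneg_of_mem_Icc hθ]
        simp only [hX, hY, hΘτ, hlev, foldAngle_of_mem hθ, hs1, one_mul, rightPt]
      · refine ⟨τ (-θ), ?_⟩
        simp only [hX, hY, hΘτ, hlev, foldAngle_neg, foldAngle_of_mem hθ, leftPt, Prod.mk.injEq,
          and_true]
        rcases (Real.sin_nonneg_of_mem_Icc hθ).eq_or_lt with h0 | h0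
        · simp [polX, ← h0, psiInv_zero]
        · have hs1 : side (-θ) = -1 := by simp [side, h0]
          rw [hs1, neg_one_mul]
    · rintro z ⟨t, rfl⟩
      by_cases hs : 0 ≤ Real.sin (Θ t)
      · have hs1 : side (Θ t) = 1 := by simp [side, hs]
        refine Or.inl ⟨foldAngle (Θ t), foldAngle_mem _, ?_⟩
        simp only [hs1, one_mul, rightPt, hX, hY, hlev]
      · have hs1 : side (Θ t) = -1 := by simp [side, hs]
        refine Or.inr ⟨foldAngle (Θ t), foldAngle_mem _, ?_⟩
        simp only [hs1, neg_one_mul, leftPt, hX, hY, hlev]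

end

noncomputable section

/-! ### The ovals and their orbital arcs -/

theorem hamField_plus_apply (x y : ℝ) : hamField HamPlus (x, y) = (2 * y, x * (x - 1)) := by
  have := fieldPlus_apply 0 0 0 x y
  simpa [fieldPlus, perturbedField] using this

theorem hamField_minus_apply (x y : ℝ) : hamField HamMinus (x, y) = (2 * y, -x * (x + 1)) := by
  have := fieldMinus_apply 0 0 0 x y
  simpa [fieldMinus, perturbedField] using this

theorem fieldPlus_zero (a b : ℝ) : fieldPlus a b 0 = hamField HamPlus := by
  funext z; simp [fieldPlus, perturbedField]

theorem fieldMinus_zero (a b : ℝ) : fieldMinus a b 0 = hamField HamMinus := by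
  funext z; simp [fieldMinus, perturbedField]

theorem sqrt_mul_sin_arccos {h y u : ℝ} (hh : 0 < h) (hu : 0 ≤ u) (e : y ^ 2 + u ^ 2 = h) :
    √h * Real.sin (Real.arccos (y / √h)) = u ∧ √h * Real.cos (Real.arccos (y / √h)) = y := by
  have hr : 0 < √h := Real.sqrt_pos.2 hh
  have hrs : √h ^ 2 = h := Real.sq_sqrt hh.le
  have habs : |y / √h| ≤ 1 := by
    rw [abs_div, abs_of_pos hr, div_le_one hr]
    refine Real.abs_le_sqrt ?_
    nlinarith [sq_nonneg u]
  refine ⟨?_, ?_⟩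
  · rw [Real.sin_arccos]
    have : 1 - (y / √h) ^ 2 = (u / √h) ^ 2 := by
      rw [div_pow, div_pow, hrs]
      field_simp
      linarith
    rw [this, Real.sqrt_sq (by positivity)]
    field_simp
  · rw [Real.cos_arccos (abs_le.1 habs).1 (abs_le.1 habs).2]
    field_simp

theorem rightPt_arccos {h x y : ℝ} (hh : 0 < h) (hx0 : 0 ≤ x) (hx1 : x < 1)
    (e : y ^ 2 + PsiOne x = h) : rightPt h (Real.arccos (y / √h)) = (x, y) := by
  rw [← psiRoot_sq (by linarith)] at e
  obtain ⟨h1, h2⟩ := sqrt_mul_sin_arccos hh (psiRoot_nonneg hx0) e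
  simp only [rightPt, polX, h1, h2, psiInv_psiRoot (show x ∈ Icc (-1 / 2 : ℝ) 1 from
    ⟨by linarith, hx1.le⟩)]

theorem sq_add_PsiOne_polX {h : ℝ} (hh : h ∈ Ioo (0 : ℝ) (1 / 6)) (θ : ℝ) :
    (√h * Real.cos θ) ^ 2 + PsiOne (polX h θ) = h := by
  rw [← psiRoot_sq (by linarith [(polX_mem hh θ).2]), psiRoot_polX hh]
  have := Real.sin_sq_add_cos_sq θ
  have := Real.sq_sqrt hh.1.le
  rw [mul_pow, mul_pow, this]
  linear_combination h * ‹Real.sin θ ^ 2 + Real.cos θ ^ 2 = 1›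

theorem oval_eq_turnSet {h : ℝ} (hh : h ∈ Ioo (0 : ℝ) (1 / 6)) :
    oval h = turnSet (fun _ => h) (fun _ => h) := by
  apply Subset.antisymm
  · rintro ⟨x, y⟩ (⟨h0, h1, e⟩ | ⟨h1, h0, e⟩)
    · exact Or.inl ⟨_, ⟨Real.arccos_nonneg _, Real.arccos_le_pi _⟩,
        rightPt_arccos hh.1 h0 h1 e⟩
    · refine Or.inr ⟨Real.arccos (y / √h), ⟨Real.arccos_nonneg _, Real.arccos_le_pi _⟩, ?_⟩
      simp only at h0 h1 e
      have := rightPt_arccos (x := -x) (y := y) hh.1 (by linarith) (by linarith)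
        (by rw [← PsiTwo_eq]; exact e)
      simp only [rightPt, Prod.mk.injEq] at this
      simp only [leftPt, this.1, this.2, neg_neg]
  · rintro z (⟨θ, hθ, rfl⟩ | ⟨θ, hθ, rfl⟩)
    · exact Or.inl ⟨polX_nonneg hh hθ, (polX_mem hh θ).2, sq_add_PsiOne_polX hh θ⟩
    · refine Or.inr ⟨?_, ?_, ?_⟩
      · have := (polX_mem hh θ).2
        simp only [leftPt]; linarith
      · have := polX_nonneg hh hθ
        simp only [leftPt]; linarith
      · simp only [leftPt, HamMinus, PsiTwo_eq, neg_neg]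
        exact sq_add_PsiOne_polX hh θ

theorem isPeriodicOrbit_oval {h : ℝ} (hh : h ∈ Ioo (0 : ℝ) (1 / 6)) :
    IsPeriodicOrbit (hamField HamPlus) (hamField HamMinus) (oval h) := by
  -- The level interval is degenerate, c = d = h: at ε = 0 the half-turn solution is the constant h.
  obtain ⟨ε₁, L, hε₁, H⟩ := exists_rateBounds 0 0 hh.1 hh.2
  have hsol : IsHalfSol 0 0 h h 0 (fun _ => h) :=
    ⟨continuousOn_const, fun _ _ => ⟨le_rfl, le_rfl⟩, fun θ _ => by
      simpa using hasDerivAt_const θ h⟩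
  have := isPeriodicOrbit_turnSet (H 0 (by simpa using hε₁.le)) hsol
  rwa [fieldPlus_zero, fieldMinus_zero, ← oval_eq_turnSet hh] at this

/-- On a fixed level the angle obeys an autonomous equation with positive speed. It is solved by
inverting the time function, the integral of the reciprocal speed. -/
theorem exists_angle_time {h : ℝ} (hh : h ∈ Ioo (0 : ℝ) (1 / 6)) :
    ∃ (T : ℝ) (Θ : ℝ → ℝ), 0 < T ∧ Θ 0 = 0 ∧ Θ T = Real.pi ∧ StrictMono Θ ∧
      ∀ t, HasDerivAt Θ (angSpeed 0 0 h (Θ t) 0) t := by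
  have hwc : Continuous fun θ => angSpeed 0 0 h θ 0 :=
    continuous_angSpeed_comp 0 0 0 continuous_const continuous_id fun _ => hh
  have hpos : ∀ θ, 0 < angSpeed 0 0 h θ 0 := angSpeed_zero_pos hh
  have hinv : Continuous fun θ => (angSpeed 0 0 h θ 0)⁻¹ := hwc.inv₀ fun θ => (hpos θ).ne'
  -- At ε = 0 the speed sees θ only through sin θ, so every value already occurs on [-π, π].
  have hper : ∀ θ, angSpeed 0 0 h (foldAngle θ) 0 = angSpeed 0 0 h θ 0 ∨
      angSpeed 0 0 h (-foldAngle θ) 0 = angSpeed 0 0 h θ 0 := by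
    intro θ
    have h1 := sin_foldAngle θ
    rcases le_total 0 (Real.sin θ) with hs | hs
    · left; simp only [angSpeed, polX, h1, abs_of_nonneg hs, zero_mul]
    · right; simp only [angSpeed, polX, Real.sin_neg, h1, abs_of_nonpos hs, neg_neg, zero_mul]
  obtain ⟨m, hm, hmw⟩ : ∃ m : ℝ, 0 < m ∧ ∀ θ, m ≤ (angSpeed 0 0 h θ 0)⁻¹ := by
    obtain ⟨θ₀, -, hθ₀⟩ := isCompact_Icc.exists_isMinOn (s := Icc (-Real.pi) Real.pi)
      ⟨0, by linarith [Real.pi_pos], Real.pi_pos.le⟩ hinv.continuousOn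
    refine ⟨_, inv_pos.2 (hpos θ₀), fun θ => ?_⟩
    have hf := foldAngle_mem θ
    rcases hper θ with e | e <;> rw [← e]
    · exact hθ₀ (show foldAngle θ ∈ _ from ⟨by linarith [hf.1, Real.pi_pos], hf.2⟩)
    · exact hθ₀ (show -foldAngle θ ∈ _ from ⟨by linarith [hf.2], by linarith [hf.1, Real.pi_pos]⟩)
  set τ : ℝ → ℝ := fun θ => ∫ s in (0 : ℝ)..θ, (angSpeed 0 0 h s 0)⁻¹ with hτ
  obtain ⟨τ_mono, Θ, hτΘ, hΘτ, Θ_deriv⟩ := exists_inverse_of_deriv_ge (f := τ) hm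
    (fun θ => (hinv.integral_hasStrictDerivAt 0 θ).hasDerivAt) hmw
  simp only [inv_inv] at Θ_deriv
  have τ_zero : τ 0 = 0 := by simp [hτ]
  refine ⟨τ Real.pi, Θ, ?_, ?_, hΘτ _, fun s t hst => ?_, Θ_deriv⟩
  · rw [← τ_zero]; exact τ_mono Real.pi_pos
  · conv_lhs => rw [← τ_zero]
    exact hΘτ 0
  · rw [← τ_mono.lt_iff_lt, hτΘ, hτΘ]; exact hst

theorem exists_isArcPlus_isArcMinus {h : ℝ} (hh : h ∈ Ioo (0 : ℝ) (1 / 6)) :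
    (∃ γ : Path (ptA h) (ptB h), IsArcPlus h γ) ∧ ∃ γ : Path (ptB h) (ptA h), IsArcMinus h γ := by
  obtain ⟨T, Θ, hT, h0, h1, hmono, hd⟩ := exists_angle_time hh
  have hc : Continuous Θ := continuous_iff_continuousAt.2 fun t => (hd t).continuousAt
  have hXc : Continuous fun t => polX h (Θ t) :=
    continuous_polX_comp continuous_const hc fun _ => hh
  have hXY := fun t => hasDerivAt_cartesian (a := 0) (b := 0) (ε := 0) (s := 1) (t := t)
    (h := fun _ => h) (φ := Θ) hh (by simpa using hd t) (by simpa using hasDerivAt_const t h)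
  simp only [one_mul, zero_mul, add_zero] at hXY
  have hΘ : ∀ s ∈ Ioo (0 : ℝ) 1, Θ (T * s) ∈ Ioo 0 Real.pi := fun s hs =>
    ⟨by rw [← h0]; exact hmono (mul_pos hT hs.1),
      by rw [← h1]; exact hmono (by nlinarith [hs.2])⟩
  have hext : ∀ {A B : ℝ × ℝ} (f : ℝ → ℝ × ℝ) (γ : Path A B)
      (_ : ∀ s : unitInterval, γ s = f s), ∀ s ∈ Ioo (0 : ℝ) 1, γ.extend =ᶠ[nhds s] f := by
    intro A B f γ hγ s hs
    filter_upwards [Ioo_mem_nhds hs.1 hs.2] with r hr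
    rw [Path.extend_apply _ (Ioo_subset_Icc_self hr), hγ]
  constructor
  · let γ : Path (ptA h) (ptB h) :=
      { toFun := fun s => rightPt h (Θ (T * s))
        continuous_toFun := by
          unfold rightPt
          exact (hXc.comp (by fun_prop)).prodMk (by fun_prop)
        source' := by simp [rightPt, h0, polX, psiInv_zero, ptA]
        target' := by simp [rightPt, h1, polX, psiInv_zero, ptB] }
    refine ⟨γ, T, hT, fun s hs => ?_⟩
    have he := hext (fun s => rightPt h (Θ (T * s))) γ (fun _ => rfl) s hs
    rw [he.eq_of_nhds]
    refine ⟨⟨polX_pos hh (hΘ s hs), sq_add_PsiOne_polX hh _⟩, ?_⟩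
    have hlin : HasDerivAt (fun s : ℝ => T * s) T s := by
      simpa using (hasDerivAt_id s).const_mul T
    refine HasDerivAt.congr_of_eventuallyEq ?_ he
    refine ((((hXY _).1.comp s hlin).prodMk ((hXY _).2.comp s hlin)) : HasDerivAt
      (fun s => rightPt h (Θ (T * s))) _ s).congr_deriv ?_
    rw [rightPt, hamField_plus_apply]
    simp only [Prod.smul_mk, smul_eq_mul, Prod.mk.injEq]
    constructor <;> ring
  · let γ : Path (ptB h) (ptA h) :=
      -- The left arc is the mirror image of the right arc run backwards.
      { toFun := fun s => leftPt h (Θ (T * (1 - s)))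
        continuous_toFun := by
          unfold leftPt
          exact ((hXc.comp (by fun_prop)).neg).prodMk (by fun_prop)
        source' := by simp [leftPt, h1, polX, psiInv_zero, ptB]
        target' := by simp [leftPt, h0, polX, psiInv_zero, ptA] }
    refine ⟨γ, T, hT, fun s hs => ?_⟩
    have he := hext (fun s => leftPt h (Θ (T * (1 - s)))) γ (fun _ => rfl) s hs
    rw [he.eq_of_nhds]
    have hs' : 1 - s ∈ Ioo (0 : ℝ) 1 := ⟨by linarith [hs.2], by linarith [hs.1]⟩
    refine ⟨⟨neg_neg_of_pos (polX_pos hh (hΘ _ hs')), ?_⟩, ?_⟩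
    · simp only [leftPt, HamMinus, PsiTwo_eq, neg_neg]
      exact sq_add_PsiOne_polX hh _
    have hlin : HasDerivAt (fun s : ℝ => T * (1 - s)) (-T) s := by
      simpa using ((hasDerivAt_id s).const_sub 1).const_mul T
    refine HasDerivAt.congr_of_eventuallyEq ?_ he
    refine ((((hXY _).1.comp s hlin).neg.prodMk ((hXY _).2.comp s hlin)) : HasDerivAt
      (fun s => leftPt h (Θ (T * (1 - s)))) _ s).congr_deriv ?_
    rw [leftPt, hamField_minus_apply]
    simp only [Prod.smul_mk, smul_eq_mul, Prod.mk.injEq]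
    constructor <;> ring

end

noncomputable section

/-! ### Line integrals along the arcs -/

/-- The integral of `(a + b x) y dx` along the right arc of level `h`. -/
def arcInt (a b h : ℝ) : ℝ := ∫ θ in (0 : ℝ)..Real.pi, rate a b h θ 0

theorem rate_zero (a b h θ : ℝ) :
    rate a b h θ 0 = h * Real.cos θ ^ 2 * (a + b * polX h θ) / psiRootDeriv (polX h θ) := by
  rw [rate, angSpeed, zero_mul, sub_zero]
  rw [mul_assoc 2 h, mul_assoc 2 (h * _), mul_div_mul_left _ _ two_ne_zero]

theorem continuous_rate_zero (a b : ℝ) {h : ℝ} (hh : h ∈ Ioo (0 : ℝ) (1 / 6)) :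
    Continuous fun θ => rate a b h θ 0 :=
  continuous_iff_continuousAt.2 fun θ =>
    ContinuousAt.comp (g := fun q : ℝ × ℝ × ℝ => rate a b q.1 q.2.1 q.2.2)
      (f := fun θ => (h, θ, 0))
      (contDiffAt_rate a b (q := (h, θ, 0)) hh (angSpeed_zero_pos hh θ).ne').continuousAt
      (by fun_prop)

theorem arcInt_eq (a b : ℝ) {h : ℝ} (hh : h ∈ Ioo (0 : ℝ) (1 / 6)) :
    arcInt a b h = a * arcInt 1 0 h + b * arcInt 0 1 h := by
  unfold arcInt
  rw [← intervalIntegral.integral_const_mul, ← intervalIntegral.integral_const_mul,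
    ← intervalIntegral.integral_add
      (((continuous_rate_zero 1 0 hh).const_mul a).intervalIntegrable _ _)
      (((continuous_rate_zero 0 1 hh).const_mul b).intervalIntegrable _ _)]
  congr 1
  funext θ
  simp only [rate_zero]
  ring

/-- Along any such arc the polar angle arccos (y/√h) runs from 0 to π, and substituting it turns the
line integral into the integral of `rate` at ε = 0. The value thus does not depend on the chosen
arc. -/
theorem integral_arc_eq {h T a b : ℝ} (hh : h ∈ Ioo (0 : ℝ) (1 / 6)) {x y : ℝ → ℝ}
    (hx : ContinuousOn x (Icc 0 1)) (hy : ContinuousOn y (Icc 0 1))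
    (hx0 : x 0 = 0) (hx1 : x 1 = 0) (hy0 : y 0 = √h) (hy1 : y 1 = -√h)
    (hpos : ∀ s ∈ Ioo (0 : ℝ) 1, 0 < x s) (hlev : ∀ s ∈ Ioo (0 : ℝ) 1, y s ^ 2 + PsiOne (x s) = h)
    (hyd : ∀ s ∈ Ioo (0 : ℝ) 1, HasDerivAt y (T * (x s * (x s - 1))) s) :
    ∫ s in (0 : ℝ)..1, (a + b * x s) * y s * (T * (2 * y s)) = arcInt a b h := by
  have hr : 0 < √h := Real.sqrt_pos.2 hh.1
  have hrs : √h ^ 2 = h := Real.sq_sqrt hh.1.le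
  have hends : ∀ s ∈ Icc (0 : ℝ) 1, s = 0 ∨ s = 1 ∨ s ∈ Ioo (0 : ℝ) 1 := by
    intro s hs
    rcases hs.1.eq_or_lt with e | h0
    · exact Or.inl e.symm
    rcases hs.2.eq_or_lt with e | h1
    · exact Or.inr (Or.inl e)
    exact Or.inr (Or.inr ⟨h0, h1⟩)
  have hlev' : ∀ s ∈ Icc (0 : ℝ) 1, y s ^ 2 + PsiOne (x s) = h := by
    intro s hs
    rcases hends s hs with rfl | rfl | hs
    · simp [hx0, hy0, hrs, PsiOne]
    · simp [hx1, hy1, hrs, PsiOne]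
    · exact hlev s hs
  have hpos' : ∀ s ∈ Icc (0 : ℝ) 1, 0 ≤ x s := by
    intro s hs
    rcases hends s hs with rfl | rfl | hs
    · exact hx0.ge
    · exact hx1.ge
    · exact (hpos s hs).le
  -- The arc starts at x = 0 and cannot pass x = 1, where the level is at least 1/6 > h.
  have hlt : ∀ s ∈ Icc (0 : ℝ) 1, x s < 1 := by
    intro s hs
    by_contra! hge
    obtain ⟨r, hr1, hr2⟩ := isPreconnected_Icc.intermediate_value₂
      (left_mem_Icc.2 zero_le_one) hs hx continuousOn_const
      (show x 0 ≤ 1 by rw [hx0]; exact zero_le_one) hge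
    have := hlev' r hr1
    rw [hr2, PsiOne_one] at this
    linarith [sq_nonneg (y r), hh.2]
  set φ : ℝ → ℝ := fun s => Real.arccos (y s / √h) with hφ
  have hpt : ∀ s ∈ Icc (0 : ℝ) 1, rightPt h (φ s) = (x s, y s) := fun s hs =>
    rightPt_arccos hh.1 (hpos' s hs) (hlt s hs) (hlev' s hs)
  have hX : ∀ s ∈ Icc (0 : ℝ) 1, polX h (φ s) = x s := fun s hs => congrArg Prod.fst (hpt s hs)
  have hY : ∀ s ∈ Icc (0 : ℝ) 1, √h * Real.cos (φ s) = y s := fun s hs =>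
    congrArg Prod.snd (hpt s hs)
  have hφc : ContinuousOn φ (Icc 0 1) :=
    Real.continuous_arccos.comp_continuousOn (hy.div_const _)
  have hφd : ∀ s ∈ Ioo (0 : ℝ) 1, HasDerivAt φ (2 * T * psiRootDeriv (x s)) s := by
    intro s hs
    have hs' := Ioo_subset_Icc_self hs
    have hm : √h * Real.sin (φ s) = psiRoot (x s) := by
      rw [← psiRoot_polX hh, hX s hs']
    have hmpos : 0 < psiRoot (x s) :=
      mul_pos (hpos s hs) (Real.sqrt_pos.2 (by linarith [hlt s hs']))
    have hsin : 0 < Real.sin (φ s) := by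
      rw [← hm] at hmpos
      exact (mul_pos_iff_of_pos_left hr).1 hmpos
    have hcos : Real.cos (φ s) = y s / √h := by
      rw [← hY s hs']; field_simp
    have hsc := Real.sin_sq_add_cos_sq (φ s)
    have hsq : √(1 - (y s / √h) ^ 2) = Real.sin (φ s) := by
      rw [hφ, Real.sin_arccos]
    have hne : y s / √h ≠ -1 ∧ y s / √h ≠ 1 := by
      rw [← hcos]
      constructor <;> intro e <;> rw [e] at hsc <;> nlinarith
    refine ((Real.hasDerivAt_arccos hne.1 hne.2).comp s ((hyd s hs).div_const _)).congr_deriv ?_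
    rw [hsq]
    have h2 := two_mul_psiRoot_mul_deriv (x := x s) (by linarith [hlt s hs'])
    rw [← hm] at h2
    field_simp
    linear_combination -T * h2
  have hdc : ContinuousOn (fun s => 2 * T * psiRootDeriv (x s)) (Icc 0 1) := by
    refine continuousOn_const.mul fun s hs => ?_
    exact ((contDiffAt_psiRootDeriv (n := 0)
      (by linarith [hlt s hs])).continuousAt).comp_continuousWithinAt (hx s hs)
  have hg := continuous_rate_zero a b hh
  have hu : uIcc (0 : ℝ) 1 = Icc 0 1 := uIcc_of_le zero_le_one
  have hsub := intervalIntegral.integral_comp_mul_deriv''' (a := 0) (b := 1) (f := φ)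
    (f' := fun s => 2 * T * psiRootDeriv (x s)) (g := fun θ => rate a b h θ 0)
    (by rwa [hu]) (fun s hs => (hφd s (by simpa using hs)).hasDerivWithinAt) hg.continuousOn
    (by
      rw [hu]
      exact hg.continuousOn.integrableOn_compact (isCompact_Icc.image_of_continuousOn hφc))
    (by
      rw [hu]
      exact ((hg.comp_continuousOn hφc).mul hdc).integrableOn_compact isCompact_Icc)
  have e0 : φ 0 = 0 := by simp [hφ, hy0, hr.ne']
  have e1 : φ 1 = Real.pi := by simp [hφ, hy1, hr.ne']
  rw [e0, e1] at hsub
  rw [arcInt, ← hsub]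
  refine intervalIntegral.integral_congr fun s hs => ?_
  rw [hu] at hs
  have hm := (psiRootDeriv_pos (hlt s hs)).ne'
  simp only [Function.comp, rate_zero, hX s hs]
  rw [← hY s hs]
  field_simp
  rw [hrs]
  ring

theorem lineIntegral_eq_of_isOrbitalArc {X : ℝ × ℝ → ℝ × ℝ} {A B : ℝ × ℝ}
    {γ : Path A B} {T : ℝ} (p : ℝ × ℝ → ℝ)
    (hγ : ∀ s ∈ Ioo (0 : ℝ) 1, HasDerivAt γ.extend (T • X (γ.extend s)) s) :
    lineIntegral p (fun _ => 0) γ =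
      ∫ s in (0 : ℝ)..1, p (γ.extend s) * (T * (X (γ.extend s)).1) := by
  rw [lineIntegral, curveIntegral_eq_intervalIntegral_deriv]
  apply intervalIntegral.integral_congr_ae_restrict
  -- The equation of motion is known only in the open interval; the endpoints are null.
  rw [uIoc_of_le zero_le_one, ← restrict_Ioo_eq_restrict_Ioc]
  filter_upwards [ae_restrict_mem measurableSet_Ioo] with s hs
  rw [(hγ s hs).deriv]
  simp only [lineForm, zero_smul, add_zero, smul_eq_mul, FunLike.coe_smul, Pi.smul_apply,
    ContinuousLinearMap.coe_fst', Prod.smul_fst]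

theorem lineIntegral_arcPlus (a b : ℝ) {h : ℝ} (hh : h ∈ Ioo (0 : ℝ) (1 / 6))
    {γ : Path (ptA h) (ptB h)} (hγ : IsArcPlus h γ) :
    lineIntegral (pertY a b) (fun _ => 0) γ = arcInt a b h := by
  obtain ⟨T, hT, H⟩ := hγ
  have hc := γ.continuous_extend
  have hs0 := γ.extend_zero
  have hs1 := γ.extend_one
  rw [lineIntegral_eq_of_isOrbitalArc _ fun s hs => (H s hs).2]
  have key := integral_arc_eq (T := T) (a := a) (b := b) hh (x := fun s => (γ.extend s).1)
    (y := fun s => (γ.extend s).2) (by fun_prop) (by fun_prop) (congrArg Prod.fst hs0)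
    (congrArg Prod.fst hs1) (congrArg Prod.snd hs0) (congrArg Prod.snd hs1) (fun s hs => (H s hs).1.1) (fun s hs => (H s hs).1.2)
    fun s hs => by
      have := (H s hs).2.snd
      rw [← Prod.mk.eta (p := γ.extend s), hamField_plus_apply] at this
      exact this
  rw [← key]
  congr 1
  funext s
  rw [← Prod.mk.eta (p := γ.extend s), hamField_plus_apply]
  rfl

/-- Reflection and reversal of the parameter produce an arc of the right kind. The two signs of dx
cancel, and only the coefficient of x changes sign; this is the source of Jᵢ = (-1)ⁱ Iᵢ. -/
theorem lineIntegral_arcMinus (a b : ℝ) {h : ℝ} (hh : h ∈ Ioo (0 : ℝ) (1 / 6))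
    {γ : Path (ptB h) (ptA h)} (hγ : IsArcMinus h γ) :
    lineIntegral (pertY a b) (fun _ => 0) γ = arcInt a (-b) h := by
  obtain ⟨T, hT, H⟩ := hγ
  have hc := γ.continuous_extend
  have hx0 : (γ.extend 0).1 = 0 := congrArg Prod.fst γ.extend_zero
  have hy0 : (γ.extend 0).2 = -√h := congrArg Prod.snd γ.extend_zero
  have hx1 : (γ.extend 1).1 = 0 := congrArg Prod.fst γ.extend_one
  have hy1 : (γ.extend 1).2 = √h := congrArg Prod.snd γ.extend_one
  rw [lineIntegral_eq_of_isOrbitalArc _ fun s hs => (H s hs).2]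
  have hrev : ∀ s ∈ Ioo (0 : ℝ) 1, 1 - s ∈ Ioo (0 : ℝ) 1 := fun s hs =>
    ⟨by linarith [hs.2], by linarith [hs.1]⟩
  have key := integral_arc_eq (T := T) (a := a) (b := -b) hh (x := fun s => -(γ.extend (1 - s)).1)
    (y := fun s => (γ.extend (1 - s)).2) (by fun_prop) (by fun_prop) (by simpa using hx1) (by simpa using hx0)
    (by simpa using hy1) (by simpa using hy0) (fun s hs => neg_pos.2 (H _ (hrev s hs)).1.1)
    (fun s hs => by rw [← PsiTwo_eq]; exact (H _ (hrev s hs)).1.2)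
    fun s hs => by
      have h1 : HasDerivAt (fun s => (γ.extend s).2) _ (1 - s) := (H _ (hrev s hs)).2.snd
      rw [← Prod.mk.eta (p := γ.extend (1 - s)), hamField_minus_apply] at h1
      have h2 : HasDerivAt (fun s : ℝ => 1 - s) (-1) s := by
        simpa using (hasDerivAt_id s).const_sub 1
      refine (h1.comp s h2).congr_deriv ?_
      simp only [Prod.smul_snd, smul_eq_mul]
      ring
  rw [← key, intervalIntegral.integral_comp_sub_left (fun r => (a + -b * -(γ.extend r).1) *
    (γ.extend r).2 * (T * (2 * (γ.extend r).2))) 1]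
  simp only [sub_self, sub_zero]
  congr 1
  funext s
  rw [← Prod.mk.eta (p := γ.extend s), hamField_minus_apply]
  simp only [pertY]
  ring

theorem pow_mul_eq_pertY (i : Fin 2) :
    (fun z : ℝ × ℝ => z.1 ^ (i : ℕ) * z.2) = pertY (1 - (i : ℕ)) (i : ℕ) := by
  funext z
  fin_cases i <;> simp [pertY]

/-- Both Hamiltonians have y-derivative 2y, so the two quotients in the Melnikov formula equal 1. -/
theorem melnikov_eq {pp pm : ℝ × ℝ → ℝ} {h : ℝ} (hh : 0 < h)
    (γp : Path (ptA h) (ptB h)) (γm : Path (ptB h) (ptA h)) :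
    melnikov HamPlus HamMinus (fun _ => 0) pp (fun _ => 0) pm γp γm =
      lineIntegral pp (fun _ => 0) γp + lineIntegral pm (fun _ => 0) γm := by
  have hr : √h ≠ 0 := (Real.sqrt_pos.2 hh).ne'
  have h1 : ∀ z, partialY HamPlus z = 2 * z.2 := fun z => by
    have := congrArg Prod.fst (hamField_plus_apply z.1 z.2)
    exact this
  have h2 : ∀ z, partialY HamMinus z = 2 * z.2 := fun z => by
    have := congrArg Prod.fst (hamField_minus_apply z.1 z.2)
    exact this
  simp only [melnikov, h1, h2, ptA, ptB, neg_zero]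
  field_simp

end

noncomputable section

/-! ### The derivative of the arc integrals and the Wronskian -/

/-- The derivative of `arcInt a b`. -/
def arcIntDeriv (a b h : ℝ) : ℝ :=
  ∫ θ in (0 : ℝ)..Real.pi, (a + b * polX h θ) / (2 * psiRootDeriv (polX h θ))

theorem continuous_rateDeriv_zero (a b : ℝ) {h : ℝ} (hh : h ∈ Ioo (0 : ℝ) (1 / 6)) :
    Continuous fun θ => rateDeriv a b h θ 0 :=
  continuous_iff_continuousAt.2 fun θ =>
    ContinuousAt.comp (g := fun q : ℝ × ℝ × ℝ => rateDeriv a b q.1 q.2.1 q.2.2)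
      (f := fun θ => (h, θ, 0))
      (continuousAt_rateDeriv a b (q := (h, θ, 0)) hh (angSpeed_zero_pos hh θ).ne') (by fun_prop)

theorem continuous_polX {h : ℝ} (hh : h ∈ Ioo (0 : ℝ) (1 / 6)) : Continuous (polX h) :=
  continuous_polX_comp continuous_const continuous_id fun _ => hh

theorem continuous_psiRootDeriv_polX {h : ℝ} (hh : h ∈ Ioo (0 : ℝ) (1 / 6)) :
    Continuous fun θ => psiRootDeriv (polX h θ) :=
  continuous_iff_continuousAt.2 fun θ =>
    ((contDiffAt_psiRootDeriv (n := 0)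
      (by linarith [(polX_mem hh θ).2])).continuousAt).comp (continuous_polX hh).continuousAt

/-- This is the Gelfand–Leray formula d/dh ∫ (a + bx) y dx = ∫ (a + bx)/(2y) dx in polar form. The
two integrands differ by an exact θ-derivative. -/
theorem integral_rateDeriv_zero (a b : ℝ) {h : ℝ} (hh : h ∈ Ioo (0 : ℝ) (1 / 6)) :
    ∫ θ in (0 : ℝ)..Real.pi, rateDeriv a b h θ 0 = arcIntDeriv a b h := by
  have hr : 0 < √h := Real.sqrt_pos.2 hh.1
  have hrs : √h ^ 2 = h := Real.sq_sqrt hh.1.le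
  set w : ℝ → ℝ := fun u => (a + b * psiInv u) / psiRootDeriv (psiInv u) with hw
  have hwd : ∀ u ∈ Ioo (-√(1 / 6)) (√(1 / 6)), DifferentiableAt ℝ w u := by
    intro u hu
    have hx := psiInv_mem_Ioo hu
    have h1 := (analyticAt_psiInv hu).differentiableAt
    have h2 : DifferentiableAt ℝ (fun u => psiRootDeriv (psiInv u)) u :=
      ((contDiffAt_psiRootDeriv (n := 1) (by linarith [hx.2])).differentiableAt one_ne_zero).comp u h1
    exact DifferentiableAt.div (by fun_prop) h2 (psiRootDeriv_pos hx.2).ne'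
  have hwθ : ∀ θ, HasDerivAt w (deriv w (√h * Real.sin θ)) (√h * Real.sin θ) := fun θ =>
    (hwd _ (sqrt_mul_sin_mem hh θ)).hasDerivAt
  have hdh : ∀ θ, rateDeriv a b h θ 0 = Real.cos θ ^ 2 * w (√h * Real.sin θ) +
      h * Real.cos θ ^ 2 * (deriv w (√h * Real.sin θ) * (1 / (2 * √h) * Real.sin θ)) := by
    intro θ
    refine (hasDerivAt_rate hh (angSpeed_zero_pos hh θ).ne').unique ?_
    have h1 : HasDerivAt (fun h : ℝ => √h * Real.sin θ) (1 / (2 * √h) * Real.sin θ) h :=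
      (Real.hasDerivAt_sqrt hh.1.ne').mul_const _
    have h2 := (((hasDerivAt_id h).mul_const (Real.cos θ ^ 2))).mul
      (HasDerivAt.comp h (hwθ θ) h1)
    refine (h2.congr_deriv ?_).congr_of_eventuallyEq (Filter.Eventually.of_forall fun k => ?_)
    · simp
    · simp only [rate_zero, hw, polX, Pi.mul_apply, Function.comp, id]
      ring
  -- The primitive carries the factor sin θ, so it vanishes at both ends of [0, π].
  have hprim : ∀ θ, HasDerivAt (fun θ => Real.sin θ * Real.cos θ / 2 * w (√h * Real.sin θ))
      (rateDeriv a b h θ 0 - (a + b * polX h θ) / (2 * psiRootDeriv (polX h θ))) θ := by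
    intro θ
    have h1 : HasDerivAt (fun θ => √h * Real.sin θ) (√h * Real.cos θ) θ :=
      (Real.hasDerivAt_sin θ).const_mul _
    have h2 := (((Real.hasDerivAt_sin θ).mul (Real.hasDerivAt_cos θ)).div_const 2).mul
      (HasDerivAt.comp θ (hwθ θ) h1)
    refine (h2.congr_deriv ?_ : HasDerivAt
      (fun θ => Real.sin θ * Real.cos θ / 2 * w (√h * Real.sin θ)) _ θ)
    have e : (a + b * polX h θ) / (2 * psiRootDeriv (polX h θ)) = w (√h * Real.sin θ) / 2 := by
      simp only [hw, polX]
      rw [div_div, mul_comm 2]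
    have hsc := Real.sin_sq_add_cos_sq θ
    rw [e, hdh]
    simp only [Function.comp, Pi.mul_apply]
    generalize deriv w (√h * Real.sin θ) = w'
    generalize w (√h * Real.sin θ) = v
    have e2 : h * Real.cos θ ^ 2 * (w' * (1 / (2 * √h) * Real.sin θ)) =
        √h * Real.cos θ ^ 2 * w' * Real.sin θ / 2 := by
      rw [← hrs, Real.sqrt_sq hr.le]
      field_simp
    rw [e2]
    linear_combination (-v / 2) * hsc
  have hc1 := continuous_rateDeriv_zero a b hh
  have hc2 : Continuous fun θ => (a + b * polX h θ) / (2 * psiRootDeriv (polX h θ)) := by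
    have := continuous_polX hh
    have := continuous_psiRootDeriv_polX hh
    exact Continuous.div (by fun_prop) (by fun_prop) fun θ =>
      (mul_pos two_pos (psiRootDeriv_pos (polX_mem hh θ).2)).ne'
  have := intervalIntegral.integral_eq_sub_of_hasDerivAt (fun θ _ => hprim θ)
    ((hc1.sub hc2).intervalIntegrable 0 Real.pi)
  rw [intervalIntegral.integral_sub (hc1.intervalIntegrable _ _) (hc2.intervalIntegrable _ _)]
    at this
  simp only [Real.sin_pi, Real.sin_zero, zero_mul, zero_div, sub_self] at this
  rw [arcIntDeriv]
  linarith

theorem hasDerivAt_arcInt (a b : ℝ) {h : ℝ} (hh : h ∈ Ioo (0 : ℝ) (1 / 6)) :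
    HasDerivAt (arcInt a b) (arcIntDeriv a b h) h := by
  obtain ⟨ε₁, L, hε₁, H⟩ := exists_rateBounds a b (c := h / 2) (d := (h + 1 / 6) / 2)
    (by linarith [hh.1]) (by linarith [hh.2])
  have H0 := H 0 (by simpa using hε₁.le)
  rw [← integral_rateDeriv_zero a b hh]
  have hmem : ∀ᶠ k in nhds h, k ∈ Ioo (0 : ℝ) (1 / 6) := Ioo_mem_nhds hh.1 hh.2
  refine (intervalIntegral.hasDerivAt_integral_of_dominated_loc_of_deriv_le
    (F := fun h θ => rate a b h θ 0) (F' := fun h θ => rateDeriv a b h θ 0) (bound := fun _ => L)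
    (s := Icc (h / 2) ((h + 1 / 6) / 2))
    (Icc_mem_nhds (by linarith [hh.1]) (by linarith [hh.2])) ?_ ?_ ?_ ?_ ?_ ?_).2
  · filter_upwards [hmem] with k hk
    exact (continuous_rate_zero a b hk).aestronglyMeasurable
  · exact (continuous_rate_zero a b hh).intervalIntegrable _ _
  · exact (continuous_rateDeriv_zero a b hh).aestronglyMeasurable
  · refine Filter.Eventually.of_forall fun θ hθ k hk => ?_
    rw [uIoc_of_le Real.pi_pos.le] at hθ
    exact H0.deriv_le k hk θ (Ioc_subset_Icc_self hθ)
  · exact intervalIntegrable_const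
  · exact Filter.Eventually.of_forall fun θ hθ k hk =>
      hasDerivAt_rate (H0.mem hk) (angSpeed_zero_pos (H0.mem hk) θ).ne'

theorem arcInt_one_zero_pos {h : ℝ} (hh : h ∈ Ioo (0 : ℝ) (1 / 6)) : 0 < arcInt 1 0 h := by
  refine intervalIntegral.integral_pos Real.pi_pos (continuous_rate_zero 1 0 hh).continuousOn
    (fun θ _ => ?_) ⟨0, ⟨le_rfl, Real.pi_pos.le⟩, ?_⟩
  · rw [rate_zero]
    have := psiRootDeriv_pos (polX_mem hh θ).2
    have := hh.1
    simp only [zero_mul, add_zero, mul_one]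
    positivity
  · rw [rate_zero]
    have := psiRootDeriv_pos (polX_mem hh 0).2
    have := hh.1
    simp only [zero_mul, add_zero, mul_one, Real.cos_zero]
    positivity

theorem polX_le_polX {h θ φ : ℝ} (hh : h ∈ Ioo (0 : ℝ) (1 / 6))
    (hs : Real.sin θ ≤ Real.sin φ) : polX h θ ≤ polX h φ :=
  strictMonoOn_psiInv.monotoneOn (Ioo_subset_Icc_self (sqrt_mul_sin_mem hh θ))
    (Ioo_subset_Icc_self (sqrt_mul_sin_mem hh φ))
    (mul_le_mul_of_nonneg_left hs (Real.sqrt_nonneg h))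

/-- Chebyshev's correlation inequality for the weight ν. If q is the ν-mean of cos²θ, the Wronskian
is a positive multiple of ∫ x (q - cos²θ) ν. Since q - cos²θ has ν-integral 0, a constant may be
subtracted from x. Choosing the value of x where cos²θ = q gives both factors the same sign, because
x and -cos²θ both increase with sin θ. -/
theorem wronskian_arcInt_pos {h : ℝ} (hh : h ∈ Ioo (0 : ℝ) (1 / 6)) :
    0 < arcIntDeriv 0 1 h * arcInt 1 0 h - arcIntDeriv 1 0 h * arcInt 0 1 h := by
  have hpi := Real.pi_pos
  set ν : ℝ → ℝ := fun θ => (psiRootDeriv (polX h θ))⁻¹ with hν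
  have hνpos : ∀ θ, 0 < ν θ := fun θ => inv_pos.2 (psiRootDeriv_pos (polX_mem hh θ).2)
  have hXc := continuous_polX hh
  have hνc : Continuous ν := (continuous_psiRootDeriv_polX hh).inv₀ fun θ =>
    (psiRootDeriv_pos (polX_mem hh θ).2).ne'
  have hi : ∀ {f : ℝ → ℝ}, Continuous f → IntervalIntegrable f volume 0 Real.pi :=
    fun hf => hf.intervalIntegrable _ _
  set A := ∫ θ in (0 : ℝ)..Real.pi, ν θ with hA
  set Q := ∫ θ in (0 : ℝ)..Real.pi, Real.cos θ ^ 2 * ν θ with hQ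
  set P := ∫ θ in (0 : ℝ)..Real.pi, polX h θ * ν θ with hP
  set R := ∫ θ in (0 : ℝ)..Real.pi, polX h θ * (Real.cos θ ^ 2 * ν θ) with hR
  have e1 : arcIntDeriv 0 1 h = P / 2 := by
    rw [arcIntDeriv, hP, ← intervalIntegral.integral_div]
    congr 1; funext θ
    simp only [hν]; rw [zero_add, one_mul, div_mul_eq_div_div_swap, div_eq_mul_inv (polX h θ)]
  have e2 : arcIntDeriv 1 0 h = A / 2 := by
    rw [arcIntDeriv, hA, ← intervalIntegral.integral_div]
    congr 1; funext θ
    simp only [hν]; rw [zero_mul, add_zero, div_mul_eq_div_div_swap, one_div]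
  have e3 : arcInt 1 0 h = h * Q := by
    rw [arcInt, hQ, ← intervalIntegral.integral_const_mul]
    congr 1; funext θ
    simp only [hν, rate_zero]; ring
  have e4 : arcInt 0 1 h = h * R := by
    rw [arcInt, hR, ← intervalIntegral.integral_const_mul]
    congr 1; funext θ
    simp only [hν, rate_zero]; ring
  have hApos : 0 < A := intervalIntegral.intervalIntegral_pos_of_pos (hi hνc) hνpos hpi
  have hQ0 : 0 ≤ Q := intervalIntegral.integral_nonneg hpi.le fun θ _ =>
    mul_nonneg (sq_nonneg _) (hνpos θ).le
  have hQA : Q ≤ A := intervalIntegral.integral_mono_on hpi.le (hi (by fun_prop)) (hi hνc)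
    fun θ _ => mul_le_of_le_one_left (hνpos θ).le (Real.cos_sq_le_one θ)
  set q := Q / A with hq
  have hq0 : 0 ≤ q := div_nonneg hQ0 hApos.le
  have hq1 : q ≤ 1 := (div_le_one hApos).2 hQA
  set θ₀ := Real.arccos √q with hθ₀
  have hcos : Real.cos θ₀ ^ 2 = q := by
    rw [hθ₀, Real.cos_arccos (by linarith [Real.sqrt_nonneg q]) (Real.sqrt_le_one.2 hq1),
      Real.sq_sqrt hq0]
  have hθm : θ₀ ∈ Icc 0 Real.pi := ⟨Real.arccos_nonneg _, Real.arccos_le_pi _⟩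
  have key : 0 < ∫ θ in (0 : ℝ)..Real.pi,
      (polX h θ - polX h θ₀) * (q - Real.cos θ ^ 2) * ν θ := by
    refine intervalIntegral.integral_pos hpi (by fun_prop) (fun θ hθ => ?_) ?_
    · refine mul_nonneg ?_ (hνpos θ).le
      have hs1 := Real.sin_sq_add_cos_sq θ
      have hs2 := Real.sin_sq_add_cos_sq θ₀
      have hn1 := Real.sin_nonneg_of_mem_Icc (Ioc_subset_Icc_self hθ)
      have hn2 := Real.sin_nonneg_of_mem_Icc hθm
      rcases le_total (Real.sin θ) (Real.sin θ₀) with hs | hs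
      · refine mul_nonneg_of_nonpos_of_nonpos (sub_nonpos.2 (polX_le_polX hh hs)) ?_
        rw [← hcos]; nlinarith
      · refine mul_nonneg (sub_nonneg.2 (polX_le_polX hh hs)) ?_
        rw [← hcos]; nlinarith
    · have hX0 : polX h 0 = 0 := by simp [polX, psiInv_zero]
      -- Strictness needs a single point: θ = 0 if q < 1. The case q = 1 is treated at θ = π/2
      -- rather than excluded.
      rcases hq1.eq_or_lt with e | hlt
      · refine ⟨Real.pi / 2, ⟨by positivity, by linarith⟩, mul_pos ?_ (hνpos _)⟩
        have : polX h θ₀ = 0 := by rw [hθ₀, e]; simpa using hX0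
        rw [this, e, Real.cos_pi_div_two]
        have := polX_pos hh (θ := Real.pi / 2) ⟨by positivity, by linarith⟩
        simpa using this
      · refine ⟨0, ⟨le_rfl, hpi.le⟩, mul_pos (mul_pos_of_neg_of_neg ?_ ?_) (hνpos _)⟩
        · rw [hX0, zero_sub, neg_lt_zero]
          refine polX_pos hh ⟨?_, ?_⟩
          · refine Real.arccos_pos.2 ?_
            exact (Real.sqrt_lt_sqrt hq0 hlt).trans_eq Real.sqrt_one
          · refine lt_of_le_of_ne hθm.2 fun e => ?_
            rw [e, Real.cos_pi] at hcos
            norm_num at hcos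
            exact hlt.ne hcos.symm
        · rw [Real.cos_zero]; linarith
  have expand : ∫ θ in (0 : ℝ)..Real.pi, (polX h θ - polX h θ₀) * (q - Real.cos θ ^ 2) * ν θ =
      (q * P - R) - polX h θ₀ * (q * A - Q) := by
    rw [hP, hR, hA, hQ, ← intervalIntegral.integral_const_mul, ← intervalIntegral.integral_const_mul,
      ← intervalIntegral.integral_sub (hi (by fun_prop)) (hi (by fun_prop)),
      ← intervalIntegral.integral_sub (hi (by fun_prop)) (hi (by fun_prop)),
      ← intervalIntegral.integral_const_mul,
      ← intervalIntegral.integral_sub (hi (by fun_prop)) (hi (by fun_prop))]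
    congr 1; funext θ; ring
  have hqA : q * A = Q := div_mul_cancel₀ _ hApos.ne'
  rw [expand, hqA, sub_self, mul_zero, sub_zero] at key
  rw [e1, e2, e3, e4]
  have h1 := mul_pos hApos key
  have h2 : P / 2 * (h * Q) - A / 2 * (h * R) = h / 2 * (A * (q * P - R)) := by
    rw [← hqA]; ring
  rw [h2]
  exact mul_pos (half_pos hh.1) h1

end

noncomputable section

/-! ### Analyticity of the arc integrals -/

/-- `(PsiOne X - PsiOne (X s)) / (X² (1 - s))`. -/
def divDiff (X s : ℝ) : ℝ := (1 + s) / 2 - X * (1 + s + s ^ 2) / 3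

theorem PsiOne_sub_PsiOne_mul (X s : ℝ) :
    PsiOne X - PsiOne (X * s) = X ^ 2 * ((1 - s) * divDiff X s) := by
  unfold PsiOne divDiff; ring

/-- For complex X with real part below 1 the radicand has positive real part, so the principal root
is holomorphic in X. Differentiation under the integral gives a holomorphic function, whose
restriction to real X is the integral. -/
theorem analyticAt_integral_mul_sqrt_divDiff {φ : ℝ → ℝ} (hφ : Continuous φ) {X : ℝ} (hX : X < 1) :
    AnalyticAt ℝ (fun X => ∫ s in (0 : ℝ)..1, φ s * √(divDiff X s)) X := by
  set r : ℂ → ℝ → ℂ := fun z s => (1 + s) / 2 - z * (1 + s + s ^ 2) / 3 with hr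
  have hre : ∀ z : ℂ, z.re < 1 → ∀ s ∈ Icc (0 : ℝ) 1, 0 < (r z s).re := by
    intro z hz s hs
    have e : (r z s).re = (1 + s) / 2 - z.re * (1 + s + s ^ 2) / 3 := by
      have : r z s = ((1 + s) / 2 : ℝ) - z * ((1 + s + s ^ 2) / 3 : ℝ) := by
        simp only [hr]; push_cast; ring
      rw [this, Complex.sub_re, Complex.ofReal_re, Complex.re_mul_ofReal]
      ring
    rw [e]
    -- At Re z = 1 the expression equals (1 - s)(1 + 2s)/6 ≥ 0; it decreases strictly in Re z.
    nlinarith [hs.1, hs.2, mul_nonneg hs.1 (sub_nonneg.2 hs.2),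
      mul_pos (sub_pos.2 hz) (show (0 : ℝ) < 1 + s + s ^ 2 by nlinarith [hs.1])]
  set F : ℂ → ℝ → ℂ := fun z s => φ s * (r z s) ^ (1 / 2 : ℂ) with hF
  set F' : ℂ → ℝ → ℂ := fun z s =>
    φ s * ((1 / 2 : ℂ) * (r z s) ^ ((1 / 2 : ℂ) - 1) * (-((1 + s + s ^ 2) / 3))) with hF'
  have hrc : Continuous fun p : ℂ × ℝ => r p.1 p.2 := by simp only [hr]; fun_prop
  have hcontF' : ∀ p : ℂ × ℝ, p.1.re < 1 → p.2 ∈ Icc (0 : ℝ) 1 →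
      ContinuousAt (fun p : ℂ × ℝ => F' p.1 p.2) p := by
    intro p h1 h2
    have : ContinuousAt (fun p : ℂ × ℝ => r p.1 p.2 ^ ((1 / 2 : ℂ) - 1)) p :=
      hrc.continuousAt.cpow continuousAt_const (Or.inl (hre _ h1 _ h2))
    simp only [hF']
    fun_prop
  have hcontF : ∀ p : ℂ × ℝ, p.1.re < 1 → p.2 ∈ Icc (0 : ℝ) 1 →
      ContinuousAt (fun p : ℂ × ℝ => F p.1 p.2) p := by
    intro p h1 h2
    have : ContinuousAt (fun p : ℂ × ℝ => r p.1 p.2 ^ (1 / 2 : ℂ)) p :=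
      hrc.continuousAt.cpow continuousAt_const (Or.inl (hre _ h1 _ h2))
    simp only [hF]
    fun_prop
  have hsec : ∀ (G : ℂ → ℝ → ℂ), (∀ p : ℂ × ℝ, p.1.re < 1 → p.2 ∈ Icc (0 : ℝ) 1 →
      ContinuousAt (fun p : ℂ × ℝ => G p.1 p.2) p) → ∀ z : ℂ, z.re < 1 →
      ContinuousOn (G z) (Icc 0 1) := fun G hG z hz s hs =>
    (ContinuousAt.comp (g := fun p : ℂ × ℝ => G p.1 p.2) (f := fun s => (z, s))
      (hG (z, s) hz hs) (by fun_prop)).continuousWithinAt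
  have hu : uIcc (0 : ℝ) 1 = Icc 0 1 := uIcc_of_le zero_le_one
  have hopen : IsOpen {z : ℂ | z.re < 1} := isOpen_lt Complex.continuous_re continuous_const
  have hmeas : ∀ (f : ℝ → ℂ), ContinuousOn f (Icc 0 1) →
      AEStronglyMeasurable f (volume.restrict (uIoc 0 1)) := fun f hf => by
    rw [uIoc_of_le zero_le_one]
    exact (hf.mono Ioc_subset_Icc_self).aestronglyMeasurable measurableSet_Ioc
  have hdiff : DifferentiableOn ℂ (fun z => ∫ s in (0 : ℝ)..1, F z s) {z : ℂ | z.re < 1} := by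
    intro z₀ hz₀
    obtain ⟨δ, hδ, hball⟩ := Metric.nhds_basis_closedBall.mem_iff.1 (hopen.mem_nhds hz₀)
    obtain ⟨C, hC⟩ := ((isCompact_closedBall z₀ δ).prod
      (isCompact_Icc (a := (0 : ℝ)) (b := 1))).exists_bound_of_continuousOn
      (f := fun p : ℂ × ℝ => F' p.1 p.2)
      fun p hp => (hcontF' p (hball hp.1) hp.2).continuousWithinAt
    refine (intervalIntegral.hasDerivAt_integral_of_dominated_loc_of_deriv_le (F := F) (F' := F')
      (bound := fun _ => C) (Metric.closedBall_mem_nhds z₀ hδ) ?_ ?_ ?_ ?_ ?_ ?_).2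
      |>.differentiableAt.differentiableWithinAt
    · filter_upwards [hopen.mem_nhds hz₀] with z hz
      exact hmeas _ (hsec F hcontF z hz)
    · exact ContinuousOn.intervalIntegrable (by rw [hu]; exact hsec F hcontF z₀ hz₀)
    · exact hmeas _ (hsec F' hcontF' z₀ hz₀)
    · refine Filter.Eventually.of_forall fun s hs z hz => ?_
      rw [uIoc_of_le zero_le_one] at hs
      exact hC (z, s) ⟨hz, Ioc_subset_Icc_self hs⟩
    · exact intervalIntegrable_const
    · refine Filter.Eventually.of_forall fun s hs z hz => ?_
      rw [uIoc_of_le zero_le_one] at hs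
      have h1 : HasDerivAt (fun z => r z s) (-((1 + s + s ^ 2) / 3)) z := by
        have := (((hasDerivAt_id z).mul_const ((1 + s + s ^ 2 : ℂ))).div_const 3).const_sub
          ((1 + s : ℂ) / 2)
        exact this.congr_deriv (by rw [one_mul])
      exact (h1.cpow_const (Or.inl (hre z (hball hz) s (Ioc_subset_Icc_self hs)))).const_mul _
  have han : AnalyticAt ℂ (fun z => ∫ s in (0 : ℝ)..1, F z s) (X : ℂ) :=
    hdiff.analyticAt (hopen.mem_nhds (by simpa using hX))
  refine han.re_ofReal.congr ?_
  filter_upwards [Iio_mem_nhds hX] with Y hY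
  have e : ∀ s ∈ Icc (0 : ℝ) 1, F Y s = ((φ s * √(divDiff Y s) : ℝ) : ℂ) := by
    intro s hs
    have e1 : r Y s = (divDiff Y s : ℝ) := by simp only [hr, divDiff]; push_cast; ring
    have h0 : 0 ≤ divDiff Y s := by
      have := hre Y (by simpa using hY) s hs
      rw [e1, Complex.ofReal_re] at this
      exact this.le
    simp only [hF, e1]
    rw [Real.sqrt_eq_rpow, Complex.ofReal_mul, Complex.ofReal_cpow h0]
    push_cast
    rfl
  have : ∫ s in (0 : ℝ)..1, F Y s = ((∫ s in (0 : ℝ)..1, φ s * √(divDiff Y s) : ℝ) : ℂ) := by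
    rw [← intervalIntegral.integral_ofReal]
    refine intervalIntegral.integral_congr fun s hs => ?_
    rw [hu] at hs
    exact e s hs
  rw [this, Complex.ofReal_re]

/-- The arc is symmetric in y, so it suffices to integrate over its upper half, written as x = Xs
with X the turning point. There y² = `PsiOne` X - `PsiOne` (Xs), and the root singularity at the
turning point splits off as √(1 - s), independent of h. -/
theorem arcInt_eq_integral_divDiff (a b : ℝ) {h : ℝ} (hh : h ∈ Ioo (0 : ℝ) (1 / 6)) :
    arcInt a b h = 2 * psiInv √h ^ 2 * ∫ s in (0 : ℝ)..1,
      (a + b * psiInv √h * s) * √(1 - s) * √(divDiff (psiInv √h) s) := by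
  have hpi := Real.pi_pos
  have hr : 0 < √h := Real.sqrt_pos.2 hh.1
  have hpX : polX h (Real.pi / 2) = psiInv √h := by simp [polX]
  have hrlt : √h < √(1 / 6) := Real.sqrt_lt_sqrt hh.1.le hh.2
  set X := psiInv √h with hX
  have hXpos : 0 < X := psiInv_pos hr hrlt
  have hΨ : PsiOne X = h := by
    rw [hX, PsiOne_psiInv ⟨by linarith, hrlt.le⟩, Real.sq_sqrt hh.1.le]
  have hc := continuous_rate_zero a b hh
  have hsymm : ∫ θ in (Real.pi / 2)..Real.pi, rate a b h θ 0 =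
      ∫ θ in (0 : ℝ)..(Real.pi / 2), rate a b h θ 0 := by
    have := intervalIntegral.integral_comp_sub_left (fun θ => rate a b h θ 0) Real.pi
      (a := Real.pi / 2) (b := Real.pi)
    rw [sub_self, show Real.pi - Real.pi / 2 = Real.pi / 2 by ring] at this
    rw [← this]
    congr 1; funext θ
    simp only [rate_zero, polX, Real.sin_pi_sub, Real.cos_pi_sub, neg_sq]
  have hsplit : arcInt a b h = 2 * ∫ θ in (0 : ℝ)..(Real.pi / 2), rate a b h θ 0 := by
    rw [arcInt, ← intervalIntegral.integral_add_adjacent_intervals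
      (hc.intervalIntegrable 0 (Real.pi / 2)) (hc.intervalIntegrable (Real.pi / 2) Real.pi), hsymm]
    ring
  set g : ℝ → ℝ := fun s => (a + b * X * s) * √(1 - s) * √(divDiff X s) with hg
  have hgc : Continuous g := by simp only [hg, divDiff]; fun_prop
  have hsub := intervalIntegral.integral_comp_mul_deriv (a := 0) (b := Real.pi / 2)
    (f := fun θ => polX h θ / X)
    (f' := fun θ => (psiRootDeriv (polX h θ))⁻¹ * (√h * Real.cos θ) / X) (g := g)
    (fun θ _ => by
      have h1 : HasDerivAt (fun θ => √h * Real.sin θ) (√h * Real.cos θ) θ :=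
        (Real.hasDerivAt_sin θ).const_mul _
      exact ((hasDerivAt_psiInv (sqrt_mul_sin_mem hh θ)).comp θ h1).div_const X)
    (by
      have := (continuous_psiRootDeriv_polX hh).inv₀ fun θ =>
        (psiRootDeriv_pos (polX_mem hh θ).2).ne'
      exact ((this.mul (by fun_prop)).div_const X).continuousOn) hgc
  rw [hpX, div_self hXpos.ne', show polX h 0 = 0 by simp [polX, psiInv_zero], zero_div] at hsub
  rw [hsplit, ← hsub, mul_assoc]
  congr 1
  rw [← intervalIntegral.integral_const_mul]
  refine intervalIntegral.integral_congr fun θ hθ => ?_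
  rw [uIcc_of_le (by positivity)] at hθ
  have hcos : 0 ≤ Real.cos θ := Real.cos_nonneg_of_neg_pi_div_two_le_of_le (by linarith [hθ.1]) hθ.2
  set x := polX h θ with hx
  have hle : x ≤ X := by
    rw [hx, ← hpX]
    exact polX_le_polX hh (by rw [Real.sin_pi_div_two]; exact Real.sin_le_one θ)
  have hm := (psiRootDeriv_pos (polX_mem hh θ).2).ne'
  rw [← hx] at hm
  have hlev := sq_add_PsiOne_polX hh θ
  rw [← hx] at hlev
  have hroot : X * (√(1 - x / X) * √(divDiff X (x / X))) = √h * Real.cos θ := by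
    have h1 : 0 ≤ 1 - x / X := sub_nonneg.2 ((div_le_one hXpos).2 hle)
    have hsq : ∀ t, X * √t = √(X ^ 2 * t) := fun t => by
      rw [Real.sqrt_mul (sq_nonneg X), Real.sqrt_sq hXpos.le]
    rw [← Real.sqrt_mul h1, hsq, ← PsiOne_sub_PsiOne_mul, mul_div_cancel₀ _ hXpos.ne', hΨ]
    rw [show h - PsiOne x = (√h * Real.cos θ) ^ 2 by linarith]
    exact Real.sqrt_sq (mul_nonneg hr.le hcos)
  have hrs : √h ^ 2 = h := Real.sq_sqrt hh.1.le
  simp only [Function.comp, hg, rate_zero, ← hx]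
  have e2 : b * X * (x / X) = b * x := by field_simp
  rw [e2]
  calc h * Real.cos θ ^ 2 * (a + b * x) / psiRootDeriv x
      = (a + b * x) * (√h * Real.cos θ) * ((psiRootDeriv x)⁻¹ * (√h * Real.cos θ)) := by
        rw [← hrs, Real.sqrt_sq hr.le]; field_simp
    _ = (a + b * x) * (X * (√(1 - x / X) * √(divDiff X (x / X)))) *
          ((psiRootDeriv x)⁻¹ * (√h * Real.cos θ)) := by rw [hroot]
    _ = _ := by field_simp

/-- The turning point X = `psiInv` √h is analytic in h, and the rescaled integrals are analytic in
X. -/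
theorem analyticAt_arcInt (a b : ℝ) {h : ℝ} (hh : h ∈ Ioo (0 : ℝ) (1 / 6)) :
    AnalyticAt ℝ (arcInt a b) h := by
  have hrlt : √h < √(1 / 6) := Real.sqrt_lt_sqrt hh.1.le hh.2
  have hr : 0 < √h := Real.sqrt_pos.2 hh.1
  have hm : √h ∈ Ioo (-√(1 / 6)) (√(1 / 6)) := ⟨by linarith, hrlt⟩
  have hX : AnalyticAt ℝ (fun h => psiInv √h) h :=
    (analyticAt_psiInv hm).comp (Real.contDiffAt_sqrt hh.1.ne').analyticAt
  have h0 := AnalyticAt.comp (f := fun h => psiInv √h) (x := h)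
    (analyticAt_integral_mul_sqrt_divDiff (φ := fun s => √(1 - s)) (by fun_prop)
      (psiInv_mem_Ioo hm).2) hX
  have h1 := AnalyticAt.comp (f := fun h => psiInv √h) (x := h)
    (analyticAt_integral_mul_sqrt_divDiff (φ := fun s => s * √(1 - s)) (by fun_prop)
      (psiInv_mem_Ioo hm).2) hX
  have h2 := (((analyticAt_const (v := (2 : ℝ))).mul (hX.pow 2)).mul
    (((analyticAt_const (v := a)).mul h0).add (((analyticAt_const (v := b)).mul hX).mul h1)))
  refine h2.congr ?_
  filter_upwards [Ioo_mem_nhds hh.1 hh.2] with k hk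
  rw [arcInt_eq_integral_divDiff a b hk]
  simp only [Pi.mul_apply, Pi.add_apply, Pi.pow_apply, Function.comp]
  congr 1
  rw [← intervalIntegral.integral_const_mul, ← intervalIntegral.integral_const_mul,
    ← intervalIntegral.integral_add]
  · congr 1; funext s; ring
  · exact Continuous.intervalIntegrable (by simp only [divDiff]; fun_prop) _ _
  · exact Continuous.intervalIntegrable (by simp only [divDiff]; fun_prop) _ _

/-! ### ECT-systems of two functions -/

/-- The Wronskian is the numerator of (f₁/f₀)', so f₁/f₀ is strictly increasing and takes the value
-α/β at most once. -/
theorem injOn_of_wronskian_pos {f₀ f₁ f₀' f₁' : ℝ → ℝ} {u v α β : ℝ} (hβ : β ≠ 0)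
    (hd₀ : ∀ x ∈ Ioo u v, HasDerivAt f₀ (f₀' x) x) (hd₁ : ∀ x ∈ Ioo u v, HasDerivAt f₁ (f₁' x) x)
    (hpos : ∀ x ∈ Ioo u v, 0 < f₀ x) (hw : ∀ x ∈ Ioo u v, 0 < f₁' x * f₀ x - f₀' x * f₁ x)
    {x y : ℝ} (hx : x ∈ Ioo u v) (hy : y ∈ Ioo u v) (hzx : α * f₀ x + β * f₁ x = 0)
    (hzy : α * f₀ y + β * f₁ y = 0) : x = y := by
  have hdq : ∀ x ∈ Ioo u v, HasDerivAt (fun x => f₁ x / f₀ x)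
      ((f₁' x * f₀ x - f₁ x * f₀' x) / f₀ x ^ 2) x := fun x hx =>
    (hd₁ x hx).div (hd₀ x hx) (hpos x hx).ne'
  have hmono : StrictMonoOn (fun x => f₁ x / f₀ x) (Ioo u v) := by
    refine strictMonoOn_of_deriv_pos (convex_Ioo u v)
      (fun x hx => (hdq x hx).continuousAt.continuousWithinAt) fun x hx => ?_
    rw [interior_Ioo] at hx
    rw [(hdq x hx).deriv]
    have := hpos x hx
    have := hw x hx
    have e : f₁' x * f₀ x - f₁ x * f₀' x = f₁' x * f₀ x - f₀' x * f₁ x := by ring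
    rw [e]
    positivity
  refine hmono.injOn hx hy ?_
  have e : ∀ x ∈ Ioo u v, α * f₀ x + β * f₁ x = 0 → f₁ x / f₀ x = -α / β := by
    intro x hx hz
    rw [div_eq_div_iff (hpos x hx).ne' hβ]
    linarith
  simp only [e x hx hzx, e y hy hzy]

/-- A multiple of the positive function f₀ has no zero. A combination that involves f₁ has at most
one, and it has order 1: a common zero with the derivative would annihilate the Wronskian. -/
theorem isECTSystem_of_wronskian_pos {f : Fin 2 → ℝ → ℝ} {f₀' f₁' : ℝ → ℝ} {u v : ℝ}
    (han : ∀ i, AnalyticOnNhd ℝ (f i) (Ioo u v))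
    (hd₀ : ∀ x ∈ Ioo u v, HasDerivAt (f 0) (f₀' x) x)
    (hd₁ : ∀ x ∈ Ioo u v, HasDerivAt (f 1) (f₁' x) x) (hpos : ∀ x ∈ Ioo u v, 0 < f 0 x)
    (hw : ∀ x ∈ Ioo u v, 0 < f₁' x * f 0 x - f₀' x * f 1 x) : IsECTSystem f (Ioo u v) := by
  refine ⟨han, fun k hk1 hk2 α hα hαk S hS => ?_⟩
  have hsum : (fun t => ∑ i, α i * f i t) = fun t => α 0 * f 0 t + α 1 * f 1 t := by
    funext t; rw [Fin.sum_univ_two]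
  have hF : ∀ x ∈ Ioo u v, AnalyticAt ℝ (fun t => α 0 * f 0 t + α 1 * f 1 t) x := fun x hx =>
    ((analyticAt_const (v := α 0)).mul (han 0 x hx)).add
      ((analyticAt_const (v := α 1)).mul (han 1 x hx))
  rw [hsum]
  by_cases h1 : α 1 = 0
  · have h0 : α 0 ≠ 0 := fun h0 => hα (by funext i; fin_cases i <;> simp [h0, h1])
    have : ∀ x ∈ S, analyticOrderAt (fun t => α 0 * f 0 t + α 1 * f 1 t) x = 0 := by
      intro x hx
      refine (hF x (hS hx)).analyticOrderAt_eq_zero.2 ?_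
      rw [h1, zero_mul, add_zero]
      exact mul_ne_zero h0 (hpos x (hS hx)).ne'
    rw [Finset.sum_eq_zero this]
    exact zero_le
  · have hk : k = 2 := by
      by_contra hne
      exact h1 (hαk 1 (by simp; omega))
    subst hk
    have hord : ∀ x ∈ S, analyticOrderAt (fun t => α 0 * f 0 t + α 1 * f 1 t) x =
        if α 0 * f 0 x + α 1 * f 1 x = 0 then 1 else 0 := by
      intro x hx
      have hx' := hS hx
      split_ifs with hz
      · refine (hF x hx').analyticOrderAt_eq_one_of_zero_deriv_ne_zero hz ?_
        have hd : HasDerivAt (fun t => α 0 * f 0 t + α 1 * f 1 t) _ x :=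
          ((hd₀ x hx').const_mul (α 0)).add ((hd₁ x hx').const_mul (α 1))
        rw [hd.deriv]
        intro hz'
        have := hw x hx'
        have hne : α 1 * (f₁' x * f 0 x - f₀' x * f 1 x) = 0 := by
          linear_combination f 0 x * hz' - f₀' x * hz
        exact (mul_ne_zero h1 this.ne') hne
      · exact (hF x hx').analyticOrderAt_eq_zero.2 hz
    rw [Finset.sum_congr rfl hord, Finset.sum_ite, Finset.sum_const_zero, add_zero,
      Finset.sum_const, nsmul_one]
    have hcard : (S.filter fun x => α 0 * f 0 x + α 1 * f 1 x = 0).card ≤ 1 := by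
      refine Finset.card_le_one.2 fun x hx y hy => ?_
      rw [Finset.mem_filter] at hx hy
      exact injOn_of_wronskian_pos h1 hd₀ hd₁ hpos hw (hS hx.1) (hS hy.1) hx.2 hy.2
    exact_mod_cast hcard

end

noncomputable section

/-! ### Regularity of Filippov solutions away from the origin -/

/-- Both fields have horizontal component 2y, hence so has every convex combination of them on the
switching line. -/
theorem fst_eq_of_mem_filippovSet {a₀ a₁ b₀ b₁ ε : ℝ} {z v : ℝ × ℝ}
    (hv : v ∈ filippovSet (fieldPlus a₀ a₁ ε) (fieldMinus b₀ b₁ ε) z) : v.1 = 2 * z.2 := by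
  have h1 : (fieldPlus a₀ a₁ ε z).1 = 2 * z.2 := congrArg Prod.fst (fieldPlus_apply a₀ a₁ ε z.1 z.2)
  have h2 : (fieldMinus b₀ b₁ ε z).1 = 2 * z.2 :=
    congrArg Prod.fst (fieldMinus_apply b₀ b₁ ε z.1 z.2)
  unfold filippovSet at hv
  split_ifs at hv
  · rw [hv, h1]
  · rw [hv, h2]
  · obtain ⟨p, q, _, _, hpq, rfl⟩ := hv
    simp only [Prod.fst_add, Prod.smul_fst, smul_eq_mul, h1, h2]
    rw [← add_mul, hpq, one_mul]

/-- An absolutely continuous function is the integral of its derivative; if that agrees almost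
everywhere with a continuous function, the function is C¹ there. -/
theorem hasDerivAt_of_ae_eq_continuousOn {f g : ℝ → ℝ} {s : Set ℝ} {t : ℝ}
    (hac : ∀ a b : ℝ, AbsolutelyContinuousOnInterval f a b) (hg : Continuous g)
    (hs : s ∈ nhds t) (hd : ∀ᵐ r : ℝ, r ∈ s → HasDerivAt f (g r) r) : HasDerivAt f (g t) t := by
  obtain ⟨δ, hδ, hball⟩ := Metric.mem_nhds_iff.1 hs
  have key : f =ᶠ[nhds t] fun r => f t + ∫ v in t..r, g v := by
    filter_upwards [Metric.ball_mem_nhds t hδ] with r hr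
    rw [← intervalIntegral.integral_congr_ae (f := deriv f), (hac t r).integral_deriv_eq_sub]
    · ring
    · filter_upwards [hd] with v hv hvm
      refine (hv (hball ?_)).deriv
      rw [Real.ball_eq_Ioo] at hr ⊢
      exact ordConnected_Ioo.uIcc_subset ⟨by linarith, by linarith⟩ hr (uIoc_subset_uIcc hvm)
  exact ((hg.integral_hasStrictDerivAt t t).hasDerivAt.const_add (f t)).congr_of_eventuallyEq key

/-- Such zeros are isolated, and a discrete subset of the line is countable. -/
theorem countable_zeros_of_deriv_ne_zero {f f' : ℝ → ℝ} (hd : ∀ t, HasDerivAt f (f' t) t)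
    (hne : ∀ t, f t = 0 → f' t ≠ 0) : {t | f t = 0}.Countable := by
  have : DiscreteTopology {t | f t = 0} := by
    rw [discreteTopology_subtype_iff]
    intro t ht
    have h1 : ∀ᶠ r in nhdsWithin t {t}ᶜ, f r ≠ 0 := (hd t).eventually_ne (hne t ht)
    rw [← disjoint_iff, Filter.disjoint_principal_right]
    exact h1
  have hsep : Countable {t | f t = 0} := TopologicalSpace.separableSpace_iff_countable.1 inferInstance
  exact hsep.to_set

/-- The one-sided perturbation factor, in coordinates that reflect the left half-plane. -/
def sideCoeff (a₀ a₁ b₀ b₁ x : ℝ) : ℝ := if 0 < x then a₀ + a₁ * x else -b₀ - b₁ * x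

/-- The sign of `x`, for `x ≠ 0`. -/
def sgn (x : ℝ) : ℝ := if 0 < x then 1 else -1

/-- Away from the origin a Filippov solution crosses the switching line transversally, since x' = 2y
≠ 0 there. So there is no sliding, the crossing times are countable, and off them the solution is
classical. -/
theorem filippov_regularity {a₀ a₁ b₀ b₁ ε : ℝ} {γ : ℝ → ℝ × ℝ}
    (hγ : IsFilippovSolution (fieldPlus a₀ a₁ ε) (fieldMinus b₀ b₁ ε) γ)
    (hne : ∀ t, (γ t).1 = 0 → (γ t).2 ≠ 0) :
    Continuous γ ∧ (∀ t, HasDerivAt (fun t => (γ t).1) (2 * (γ t).2) t) ∧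
    {t | (γ t).1 = 0}.Countable ∧
    ∀ t, (γ t).1 ≠ 0 → HasDerivAt (fun t => (γ t).2) (sgn (γ t).1 * (|(γ t).1| * (|(γ t).1| - 1) +
      ε * (sideCoeff a₀ a₁ b₀ b₁ (γ t).1 * (γ t).2))) t := by
  obtain ⟨hac, hae⟩ := hγ
  have hx_ac : ∀ a b : ℝ, AbsolutelyContinuousOnInterval (fun t => (γ t).1) a b := fun a b =>
    (hac a b).comp_lipschitz LipschitzWith.prod_fst
  have hy_ac : ∀ a b : ℝ, AbsolutelyContinuousOnInterval (fun t => (γ t).2) a b := fun a b =>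
    (hac a b).comp_lipschitz LipschitzWith.prod_snd
  have hc : Continuous γ := continuous_iff_continuousAt.2 fun t =>
    ((hac (t - 1) (t + 1)).continuousOn).continuousAt (by
      rw [uIcc_of_le (by linarith)]; exact Icc_mem_nhds (by linarith) (by linarith))
  have hx : ∀ t, HasDerivAt (fun t => (γ t).1) (2 * (γ t).2) t := fun t =>
    hasDerivAt_of_ae_eq_continuousOn (g := fun t => 2 * (γ t).2) hx_ac (by fun_prop)
      Filter.univ_mem (by
        filter_upwards [hae] with r hr _
        obtain ⟨v, hv, hd⟩ := hr
        have : HasDerivAt (fun t => (γ t).1) v.1 r := hd.fst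
        rwa [fst_eq_of_mem_filippovSet hv] at this)
  refine ⟨hc, hx, countable_zeros_of_deriv_ne_zero hx fun t ht => mul_ne_zero two_ne_zero (hne t ht),
    fun t ht => ?_⟩
  rcases lt_or_gt_of_ne ht with hneg | hpos
  · have hs : ∀ᶠ r in nhds t, (γ r).1 < 0 := hc.fst.continuousAt.eventually_lt_const hneg
    have h := hasDerivAt_of_ae_eq_continuousOn (t := t)
      (g := fun t => -(γ t).1 * ((γ t).1 + 1) + ε * ((b₀ + b₁ * (γ t).1) * (γ t).2)) hy_ac
      (by fun_prop) hs (by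
        filter_upwards [hae] with r hr hr0
        obtain ⟨v, hv, hd⟩ := hr
        have hr0' : (γ r).1 < 0 := hr0
        simp only [filippovSet, not_lt.2 hr0'.le, hr0', if_true, if_false, mem_singleton_iff] at hv
        have : HasDerivAt (fun t => (γ t).2) v.2 r := hd.snd
        rw [hv, ← Prod.mk.eta (p := γ r), fieldMinus_apply] at this
        exact this)
    refine h.congr_deriv ?_
    simp only [sgn, sideCoeff, not_lt.2 hneg.le, if_false, abs_of_neg hneg]
    ring
  · have hs : ∀ᶠ r in nhds t, 0 < (γ r).1 := hc.fst.continuousAt.eventually_const_lt hpos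
    have h := hasDerivAt_of_ae_eq_continuousOn (t := t)
      (g := fun t => (γ t).1 * ((γ t).1 - 1) + ε * ((a₀ + a₁ * (γ t).1) * (γ t).2)) hy_ac
      (by fun_prop) hs (by
        filter_upwards [hae] with r hr hr0
        obtain ⟨v, hv, hd⟩ := hr
        have hr0' : 0 < (γ r).1 := hr0
        simp only [filippovSet, hr0', if_true, mem_singleton_iff] at hv
        have : HasDerivAt (fun t => (γ t).2) v.2 r := hd.snd
        rw [hv, ← Prod.mk.eta (p := γ r), fieldPlus_apply] at this
        exact this)
    refine h.congr_deriv ?_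
    simp only [sgn, sideCoeff, hpos, if_true, abs_of_pos hpos]
    ring

/-! ### The angle along a solution -/

/-- The level `y² + PsiOne |x|`. -/
def level (z : ℝ × ℝ) : ℝ := z.2 ^ 2 + PsiOne |z.1|

/-- The signed root of `PsiOne |x|`. -/
def signedRoot (x : ℝ) : ℝ := x * √(1 / 2 - |x| / 3)

/-- The point of level `h` and angle `θ`. -/
def polarPt (h θ : ℝ) : ℝ × ℝ := if 0 ≤ Real.sin θ then rightPt h θ else leftPt h (-θ)

theorem sgn_sq (x : ℝ) : sgn x * sgn x = 1 := by unfold sgn; split_ifs <;> norm_num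

theorem sgn_mul_abs {x : ℝ} (hx : x ≠ 0) : sgn x * |x| = x := by
  unfold sgn
  split_ifs with h
  · rw [abs_of_pos h, one_mul]
  · rw [abs_of_neg (lt_of_le_of_ne (not_lt.1 h) hx)]; ring

theorem eventually_sgn_eq {x : ℝ} (hx : x ≠ 0) : ∀ᶠ y in nhds x, sgn y = sgn x := by
  rcases lt_or_gt_of_ne hx with h | h
  · filter_upwards [Iio_mem_nhds h] with y hy
    rw [mem_Iio] at hy
    simp [sgn, not_lt.2 h.le, not_lt.2 hy.le]
  · filter_upwards [Ioi_mem_nhds h] with y hy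
    rw [mem_Ioi] at hy
    simp [sgn, h, hy]

theorem signedRoot_eq (x : ℝ) : signedRoot x = if 0 ≤ x then psiRoot |x| else -psiRoot |x| := by
  unfold signedRoot psiRoot
  split_ifs with h
  · rw [abs_of_nonneg h]
  · rw [abs_of_neg (not_le.1 h)]; ring

theorem signedRoot_eq_sgn {x : ℝ} (hx : x ≠ 0) : signedRoot x = sgn x * psiRoot |x| := by
  conv_lhs => rw [signedRoot, ← sgn_mul_abs hx]
  rw [psiRoot, sgn_mul_abs hx, ← mul_assoc, sgn_mul_abs hx]

theorem signedRoot_sq {x : ℝ} (hx : |x| < 1) : signedRoot x ^ 2 = PsiOne |x| := by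
  rw [← psiRoot_sq (by linarith), signedRoot, psiRoot, mul_pow, mul_pow, sq_abs]

end

/-! ### The angular speed on the plane and the lift of the angle along a solution. -/

noncomputable section

/-- The angular speed of the piecewise smooth system as a function on the plane. -/
def planeSpeed (a₀ a₁ b₀ b₁ ε : ℝ) (z : ℝ × ℝ) : ℝ :=
  2 * psiRootDeriv |z.1| - ε * ((if 0 ≤ z.1 then (a₀ + a₁ * z.1) * psiRoot z.1
    else (-b₀ - b₁ * z.1) * psiRoot (-z.1)) * z.2 / level z)

theorem planeSpeed_eq_of_nonneg {a₀ a₁ b₀ b₁ ε h φ : ℝ} {z : ℝ × ℝ} (hh : h ∈ Ioo (0 : ℝ) (1 / 6))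
    (hl : level z = h) (hz : 0 ≤ z.1) (hx : polX h φ = |z.1|) (hy : √h * Real.cos φ = z.2) :
    planeSpeed a₀ a₁ b₀ b₁ ε z = angSpeed a₀ a₁ h φ ε := by
  have hm := psiRoot_polX hh φ
  have hr : √h ≠ 0 := (Real.sqrt_pos.2 hh.1).ne'
  have hrs : √h ^ 2 = h := Real.sq_sqrt hh.1.le
  rw [abs_of_nonneg hz] at hx
  rw [planeSpeed, angSpeed, hl, if_pos hz, abs_of_nonneg hz, ← hx, hm, ← hy]
  congr 2
  generalize polX h φ = X
  rw [div_eq_iff hh.1.ne']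
  conv_rhs => rw [← hrs]
  ring

/-- The reflected, time-reversed left field is a right field with coefficients (-b₀, b₁), and the
two reversals cancel in the angular speed. -/
theorem planeSpeed_eq_of_neg {a₀ a₁ b₀ b₁ ε h φ : ℝ} {z : ℝ × ℝ} (hh : h ∈ Ioo (0 : ℝ) (1 / 6))
    (hl : level z = h) (hz : z.1 < 0) (hx : polX h φ = |z.1|) (hy : √h * Real.cos φ = z.2) :
    planeSpeed a₀ a₁ b₀ b₁ ε z = angSpeed (-b₀) b₁ h φ ε := by
  have hm := psiRoot_polX hh φ
  have hr : √h ≠ 0 := (Real.sqrt_pos.2 hh.1).ne'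
  have hrs : √h ^ 2 = h := Real.sq_sqrt hh.1.le
  rw [abs_of_neg hz] at hx
  have hx' : z.1 = -polX h φ := by linarith
  rw [planeSpeed, angSpeed, hl, if_neg (not_le.2 hz), abs_of_neg hz, ← hx, hm, ← hy, hx']
  congr 2
  generalize polX h φ = X
  rw [div_eq_iff hh.1.ne']
  conv_rhs => rw [← hrs]
  ring

theorem exists_angle_abs {z : ℝ × ℝ} (hz : |z.1| < 1) (hl : 0 < level z) :
    ∃ φ ∈ Icc 0 Real.pi, polX (level z) φ = |z.1| ∧ √(level z) * Real.cos φ = z.2 := by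
  have := rightPt_arccos (h := level z) (x := |z.1|) (y := z.2) hl (abs_nonneg _) hz rfl
  exact ⟨_, ⟨Real.arccos_nonneg _, Real.arccos_le_pi _⟩, congrArg Prod.fst this,
    congrArg Prod.snd this⟩

theorem planeSpeed_pos {a₀ a₁ b₀ b₁ c d ε L : ℝ} (Hp : RateBounds a₀ a₁ c d ε L)
    (Hm : RateBounds (-b₀) b₁ c d ε L) {z : ℝ × ℝ} (hz : |z.1| < 1) (hl : level z ∈ Icc c d) :
    0 < planeSpeed a₀ a₁ b₀ b₁ ε z := by
  obtain ⟨φ, hφ, h1, h2⟩ := exists_angle_abs hz (Hp.mem hl).1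
  rcases le_or_gt 0 z.1 with h0 | h0
  · rw [planeSpeed_eq_of_nonneg (Hp.mem hl) rfl h0 h1 h2]
    exact Hp.pos _ hl _ hφ
  · rw [planeSpeed_eq_of_neg (Hp.mem hl) rfl h0 h1 h2]
    exact Hm.pos _ hl _ hφ

theorem continuous_planeSpeed_comp {a₀ a₁ b₀ b₁ ε : ℝ} {γ : ℝ → ℝ × ℝ} (hγ : Continuous γ)
    (hx : ∀ t, |(γ t).1| < 1) (hl : ∀ t, 0 < level (γ t)) :
    Continuous fun t => planeSpeed a₀ a₁ b₀ b₁ ε (γ t) := by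
  have h1 : Continuous fun t => psiRootDeriv |(γ t).1| := continuous_iff_continuousAt.2 fun t =>
    ContinuousAt.comp (g := psiRootDeriv)
      (contDiffAt_psiRootDeriv (n := 0) (by linarith [hx t])).continuousAt (by fun_prop)
  have h2 : Continuous fun t => level (γ t) := by unfold level PsiOne; fun_prop
  have h4 := continuous_psiRoot
  have h3 : Continuous fun t => if 0 ≤ (γ t).1 then (a₀ + a₁ * (γ t).1) * psiRoot (γ t).1
      else (-b₀ - b₁ * (γ t).1) * psiRoot (-(γ t).1) := by
    -- The one-sided perturbation terms carry a factor `psiRoot`, which vanishes at x = 0, so the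
    -- speed is continuous across the switching line.
    refine Continuous.if_le (by fun_prop) (by fun_prop) continuous_const (by fun_prop) ?_
    intro t ht
    simp [← ht, psiRoot_zero]
  have h5 := fun t => (hl t).ne'
  unfold planeSpeed
  exact (h1.const_mul 2).sub (continuous_const.mul ((h3.mul (by fun_prop)).div h2 h5))

/-- The Hamiltonian part conserves the level, so only the perturbation contributes to its
derivative. -/
theorem hasDerivAt_level_signedRoot {x y : ℝ → ℝ} {t ε A : ℝ} (hx : HasDerivAt x (2 * y t) t)
    (hy : HasDerivAt y (sgn (x t) * (|x t| * (|x t| - 1) + ε * (A * y t))) t) (h0 : x t ≠ 0)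
    (h1 : |x t| < 1) :
    HasDerivAt (fun t => y t ^ 2 + PsiOne |x t|) (sgn (x t) * (ε * (2 * A * y t ^ 2))) t ∧
    HasDerivAt (fun t => signedRoot (x t)) (2 * psiRootDeriv |x t| * y t) t := by
  have hev := hx.continuousAt.eventually (eventually_sgn_eq h0)
  have hne := hx.continuousAt.eventually_ne h0
  have hX : HasDerivAt (fun t => |x t|) (sgn (x t) * (2 * y t)) t := by
    refine (hx.const_mul (sgn (x t))).congr_of_eventuallyEq ?_
    filter_upwards [hev, hne] with r hr hr0
    rw [← hr]
    unfold sgn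
    split_ifs with h
    · rw [abs_of_pos h, one_mul]
    · rw [abs_of_neg (lt_of_le_of_ne (not_lt.1 h) hr0), neg_one_mul]
  have hU : HasDerivAt (fun t => psiRoot |x t|) (psiRootDeriv |x t| * (sgn (x t) * (2 * y t))) t :=
    (hasDerivAt_psiRoot (by linarith)).comp t hX
  have hΨ : HasDerivAt PsiOne (|x t| * (1 - |x t|)) |x t| := by
    have h2 : HasDerivAt (fun x : ℝ => x ^ 2 / 2 - x ^ 3 / 3) _ |x t| :=
      ((hasDerivAt_pow 2 |x t|).div_const 2).sub ((hasDerivAt_pow 3 |x t|).div_const 3)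
    refine h2.congr_deriv ?_
    push_cast
    ring
  constructor
  · refine ((hy.pow 2).add (hΨ.comp t hX)).congr_deriv ?_
    push_cast
    ring
  · refine ((hU.const_mul (sgn (x t))).congr_deriv ?_).congr_of_eventuallyEq ?_
    · linear_combination (2 * psiRootDeriv |x t| * y t) * sgn_sq (x t)
    · filter_upwards [hev, hne] with r hr hr0
      rw [signedRoot_eq_sgn hr0, hr]

/-- The polar representation of a solution. -/
theorem exists_polar_angle {a₀ a₁ b₀ b₁ ε : ℝ} {γ : ℝ → ℝ × ℝ} (hc : Continuous γ)
    (hx : ∀ t, HasDerivAt (fun t => (γ t).1) (2 * (γ t).2) t)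
    (hS : {t | (γ t).1 = 0}.Countable)
    (hy : ∀ t, (γ t).1 ≠ 0 → HasDerivAt (fun t => (γ t).2) (sgn (γ t).1 * (|(γ t).1| *
      (|(γ t).1| - 1) + ε * (sideCoeff a₀ a₁ b₀ b₁ (γ t).1 * (γ t).2))) t)
    (h1 : ∀ t, |(γ t).1| < 1) (hl : ∀ t, 0 < level (γ t)) :
    ∃ θ : ℝ → ℝ, (∀ t, HasDerivAt θ (planeSpeed a₀ a₁ b₀ b₁ ε (γ t)) t) ∧
      ∀ t, (γ t).2 = √(level (γ t)) * Real.cos (θ t) ∧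
        signedRoot (γ t).1 = √(level (γ t)) * Real.sin (θ t) := by
  set w : ℝ → ℝ := fun t => planeSpeed a₀ a₁ b₀ b₁ ε (γ t) with hw
  have wc : Continuous w := continuous_planeSpeed_comp hc h1 hl
  have hr : ∀ t, 0 < √(level (γ t)) := fun t => Real.sqrt_pos.2 (hl t)
  have hrs : ∀ t, √(level (γ t)) ^ 2 = level (γ t) := fun t => Real.sq_sqrt (hl t).le
  obtain ⟨θ₀, hθ₀⟩ : ∃ θ₀, √(level (γ 0)) * Real.cos θ₀ = (γ 0).2 ∧
      √(level (γ 0)) * Real.sin θ₀ = signedRoot (γ 0).1 := by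
    have e : (γ 0).2 ^ 2 + psiRoot |(γ 0).1| ^ 2 = level (γ 0) := by
      rw [psiRoot_sq (by linarith [h1 0])]; rfl
    obtain ⟨e1, e2⟩ := sqrt_mul_sin_arccos (hl 0) (psiRoot_nonneg (abs_nonneg _)) e
    rw [signedRoot_eq]
    split_ifs
    · exact ⟨_, e2, e1⟩
    · exact ⟨-Real.arccos ((γ 0).2 / √(level (γ 0))), by rw [Real.cos_neg, e2],
        by rw [Real.sin_neg, mul_neg, e1]⟩
  -- The angle is obtained by integrating the expected speed and is identified afterwards.
  set θ : ℝ → ℝ := fun t => θ₀ + ∫ s in (0 : ℝ)..t, w s with hθ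
  have θd : ∀ t, HasDerivAt θ (w t) t := fun t =>
    (wc.integral_hasStrictDerivAt 0 t).hasDerivAt.const_add θ₀
  have θc : Continuous θ := continuous_iff_continuousAt.2 fun t => (θd t).continuousAt
  have hlc : Continuous fun t => level (γ t) := by unfold level PsiOne; fun_prop
  have huc : Continuous fun t => signedRoot (γ t).1 := by unfold signedRoot; fun_prop
  have hne := fun t => (hr t).ne'
  -- p and q are the coordinates of (y, `signedRoot` x)/√`level` in the frame rotated by θ. Both
  -- have derivative 0 off the countable crossing times, so they keep their initial values 1 and 0,
  -- which says that θ is the polar angle.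
  set p : ℝ → ℝ := fun t =>
    ((γ t).2 * Real.cos (θ t) + signedRoot (γ t).1 * Real.sin (θ t)) / √(level (γ t)) with hp
  set q : ℝ → ℝ := fun t =>
    (signedRoot (γ t).1 * Real.cos (θ t) - (γ t).2 * Real.sin (θ t)) / √(level (γ t)) with hq
  have pc : Continuous p := Continuous.div (by fun_prop) (by fun_prop) hne
  have qc : Continuous q := Continuous.div (by fun_prop) (by fun_prop) hne
  have hd : ∀ t ∉ {t | (γ t).1 = 0}, HasDerivAt p 0 t ∧ HasDerivAt q 0 t := by
    intro t ht
    have ht0 : (γ t).1 ≠ 0 := ht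
    obtain ⟨hH, hu⟩ := hasDerivAt_level_signedRoot (x := fun t => (γ t).1) (y := fun t => (γ t).2)
      (hx t) (hy t ht) ht (h1 t)
    have hR : HasDerivAt (fun t => √(level (γ t))) _ t := HasDerivAt.sqrt hH (hl t).ne'
    have hcos := (θd t).cos
    have hsin := (θd t).sin
    have hroot := two_mul_psiRoot_mul_deriv (x := |(γ t).1|) (by linarith [h1 t])
    have hwt : w t = 2 * psiRootDeriv |(γ t).1| - ε * (sgn (γ t).1 *
        sideCoeff a₀ a₁ b₀ b₁ (γ t).1 * signedRoot (γ t).1 * (γ t).2 / level (γ t)) := by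
      simp only [hw, planeSpeed]
      congr 4
      rw [signedRoot_eq_sgn ht0]
      rcases lt_or_gt_of_ne ht0 with hn | hn
      · simp only [not_le.2 hn, if_false, sgn, sideCoeff, not_lt.2 hn.le, abs_of_neg hn]; ring
      · simp only [hn.le, if_true, sgn, sideCoeff, hn, abs_of_pos hn]; ring
    have hyd : sgn (γ t).1 * (|(γ t).1| * (|(γ t).1| - 1) +
        ε * (sideCoeff a₀ a₁ b₀ b₁ (γ t).1 * (γ t).2)) =
        -2 * psiRootDeriv |(γ t).1| * signedRoot (γ t).1 +
        sgn (γ t).1 * (ε * (sideCoeff a₀ a₁ b₀ b₁ (γ t).1 * (γ t).2)) := by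
      rw [signedRoot_eq_sgn ht0]
      linear_combination (sgn (γ t).1) * hroot
    have hlev : level (γ t) = (γ t).2 ^ 2 + signedRoot (γ t).1 ^ 2 := by
      rw [signedRoot_sq (h1 t)]; rfl
    have hyt := hy t ht
    rw [hyd] at hyt
    rw [hwt] at hcos hsin
    have hrt := hr t
    have hrst := hrs t
    have hr2 := hrst.trans hlev
    obtain ⟨r, hrr⟩ : ∃ r, r = √(level (γ t)) := ⟨_, rfl⟩
    rw [← hrr] at hrt hrst hr2
    constructor
    · refine (((hyt.mul hcos).add (hu.mul hsin)).div hR (hne t)).congr_deriv ?_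
      simp only [Pi.add_apply, Pi.mul_apply]
      rw [← hrr, ← hrst]
      clear hrr hrst hlev hwt
      generalize psiRootDeriv |(γ t).1| = m
      generalize sideCoeff a₀ a₁ b₀ b₁ (γ t).1 = A
      generalize sgn (γ t).1 = s
      generalize signedRoot (γ t).1 = u at *
      generalize (γ t).2 = y at *
      field_simp
      linear_combination (s * ε * A * y * Real.cos (θ t)) * hr2
    · refine (((hu.mul hcos).sub (hyt.mul hsin)).div hR (hne t)).congr_deriv ?_
      simp only [Pi.sub_apply, Pi.mul_apply]
      rw [← hrr, ← hrst]
      clear hrr hrst hlev hwt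
      generalize psiRootDeriv |(γ t).1| = m
      generalize sideCoeff a₀ a₁ b₀ b₁ (γ t).1 = A
      generalize sgn (γ t).1 = s
      generalize signedRoot (γ t).1 = u at *
      generalize (γ t).2 = y at *
      field_simp
      linear_combination (-s * ε * A * y * Real.sin (θ t)) * hr2
  refine ⟨θ, θd, fun t => ?_⟩
  have e0 : θ 0 = θ₀ := by simp [hθ]
  have hp1 : p t = 1 := by
    rw [eq_of_hasDerivAt_zero_off_countable pc hS (fun t ht => (hd t ht).1) t 0]
    simp only [hp, e0]
    rw [div_eq_one_iff_eq (hne 0), ← hθ₀.1, ← hθ₀.2]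
    linear_combination √(level (γ 0)) * Real.sin_sq_add_cos_sq θ₀
  have hq0 : q t = 0 := by
    rw [eq_of_hasDerivAt_zero_off_countable qc hS (fun t ht => (hd t ht).2) t 0]
    simp only [hq, e0]
    rw [← hθ₀.1, ← hθ₀.2]
    ring
  simp only [hp] at hp1
  simp only [hq] at hq0
  rw [div_eq_one_iff_eq (hne t)] at hp1
  rw [div_eq_zero_iff, or_iff_left (hne t)] at hq0
  have hsc := Real.sin_sq_add_cos_sq (θ t)
  constructor
  · linear_combination Real.cos (θ t) * hp1 - Real.sin (θ t) * hq0 - (γ t).2 * hsc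
  · linear_combination Real.sin (θ t) * hp1 + Real.cos (θ t) * hq0 - signedRoot (γ t).1 * hsc

end

/-! ### The level as a function of the full angle. -/

noncomputable section

theorem signedRoot_neg_iff {x : ℝ} (h1 : |x| < 1) : signedRoot x < 0 ↔ x < 0 := by
  have : 0 < √(1 / 2 - |x| / 3) := Real.sqrt_pos.2 (by linarith)
  exact ⟨fun h => neg_of_mul_neg_left h this.le, fun h => mul_neg_of_neg_of_pos h this⟩

theorem polX_eq_abs {z : ℝ × ℝ} {θ : ℝ} (h1 : |z.1| < 1)
    (hr : signedRoot z.1 = √(level z) * Real.sin θ) :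
    (0 ≤ z.1 → polX (level z) θ = |z.1|) ∧ (z.1 < 0 → polX (level z) (-θ) = |z.1|) := by
  have key : psiInv (psiRoot |z.1|) = |z.1| :=
    psiInv_psiRoot ⟨by linarith [abs_nonneg z.1], h1.le⟩
  rw [signedRoot_eq] at hr
  constructor <;> intro h
  · rw [if_pos h] at hr
    rw [polX, ← hr, key]
  · rw [if_neg (not_le.2 h)] at hr
    rw [polX, Real.sin_neg, mul_neg, ← hr, neg_neg, key]

theorem sin_neg_iff_of_signedRoot {z : ℝ × ℝ} {θ : ℝ} (h1 : |z.1| < 1) (hl : 0 < level z)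
    (hr : signedRoot z.1 = √(level z) * Real.sin θ) : Real.sin θ < 0 ↔ z.1 < 0 := by
  rw [← signedRoot_neg_iff h1, hr]
  exact ⟨fun h => mul_neg_of_pos_of_neg (Real.sqrt_pos.2 hl) h,
    fun h => neg_of_mul_neg_right h (Real.sqrt_nonneg _)⟩

theorem eq_polarPt {z : ℝ × ℝ} {θ : ℝ} (h1 : |z.1| < 1) (hl : 0 < level z)
    (hy : z.2 = √(level z) * Real.cos θ) (hr : signedRoot z.1 = √(level z) * Real.sin θ) :
    z = polarPt (level z) θ := by
  have hs := sin_neg_iff_of_signedRoot h1 hl hr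
  obtain ⟨hp, hm⟩ := polX_eq_abs h1 hr
  unfold polarPt
  split_ifs with h
  · have h0 : 0 ≤ z.1 := not_lt.1 fun h' => (not_lt.2 h) (hs.2 h')
    rw [rightPt, hp h0, abs_of_nonneg h0, ← hy]
  · have h0 : z.1 < 0 := hs.1 (not_le.1 h)
    rw [leftPt, hm h0, abs_of_neg h0, Real.cos_neg, ← hy, neg_neg]

/-- A level function along the full angle, for the system with perturbations `(a₀ + a₁ x) y` on the
right and `(b₀ + b₁ x) y` on the left. -/
structure IsFullSol (a₀ a₁ b₀ b₁ c d ε : ℝ) (h : ℝ → ℝ) : Prop where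
  cont : Continuous h
  mem : ∀ θ, h θ ∈ Icc c d
  deriv_pos : ∀ θ, 0 < Real.sin θ → HasDerivAt h (ε * rate a₀ a₁ (h θ) θ ε) θ
  deriv_neg : ∀ θ, Real.sin θ < 0 → HasDerivAt h (-(ε * rate (-b₀) b₁ (h θ) (-θ) ε)) θ

/-- The angular speed is continuous, periodic and positive, hence bounded below, so the angle can
replace time. A period of the motion then becomes a whole number n of turns. -/
theorem exists_isFullSol {a₀ a₁ b₀ b₁ c d ε L : ℝ} (Hp : RateBounds a₀ a₁ c d ε L)
    (Hm : RateBounds (-b₀) b₁ c d ε L) {γ : ℝ → ℝ × ℝ} {T : ℝ} (hT : 0 < T)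
    (hγ : IsFilippovSolution (fieldPlus a₀ a₁ ε) (fieldMinus b₀ b₁ ε) γ)
    (hper : Function.Periodic γ T) (h1 : ∀ t, |(γ t).1| < 1) (hl : ∀ t, level (γ t) ∈ Icc c d) :
    ∃ (h : ℝ → ℝ) (n : ℕ), 0 < n ∧ IsFullSol a₀ a₁ b₀ b₁ c d ε h ∧
      (∀ θ, h (θ + n * (2 * Real.pi)) = h θ) ∧ range γ = range fun θ => polarPt (h θ) θ := by
  have hl0 : ∀ t, 0 < level (γ t) := fun t => (Hp.mem (hl t)).1
  obtain ⟨hc, hx, hS, hy⟩ := filippov_regularity hγ fun t h0 h2 => by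
    have := hl0 t
    simp [level, h0, h2, PsiOne] at this
  obtain ⟨θ, hθ, hpol⟩ := exists_polar_angle hc hx hS hy h1 hl0
  set w : ℝ → ℝ := fun t => planeSpeed a₀ a₁ b₀ b₁ ε (γ t) with hw
  have wc : Continuous w := continuous_planeSpeed_comp hc h1 hl0
  have wper : Function.Periodic w T := fun t => by simp only [hw, hper t]
  obtain ⟨t₀, -, ht₀⟩ := (isCompact_Icc (a := 0) (b := T)).exists_isMinOn
    ⟨0, le_rfl, hT.le⟩ wc.continuousOn
  have wpos : ∀ t, 0 < w t := fun t => planeSpeed_pos Hp Hm (h1 t) (hl t)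
  have wge : ∀ t, w t₀ ≤ w t := fun t => by
    obtain ⟨s, hs, e⟩ := wper.exists_mem_Ico₀ hT t
    rw [e]
    exact ht₀ (Ico_subset_Icc_self hs)
  obtain ⟨-, τ, hθτ, hτθ, hτ⟩ := exists_inverse_of_deriv_ge (wpos t₀) hθ wge
  have τc : Continuous τ := continuous_iff_continuousAt.2 fun t => (hτ t).continuousAt
  have lc : Continuous fun t => level (γ t) := by unfold level PsiOne; fun_prop
  have hpt : ∀ φ, γ (τ φ) = polarPt (level (γ (τ φ))) φ := fun φ => by
    have := hpol (τ φ)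
    rw [hθτ] at this
    exact eq_polarPt (h1 _) (hl0 _) this.1 this.2
  obtain ⟨D, hD⟩ : ∃ D, ∀ t, θ (t + T) = θ t + D := by
    refine ⟨θ (0 + T) - θ 0, fun t => ?_⟩
    have := eq_of_hasDerivAt_zero_off_countable (f := fun t => θ (t + T) - θ t)
      (s := ∅) (continuous_iff_continuousAt.2 fun t =>
        ((hθ (t + T)).comp_add_const t T |>.sub (hθ t)).continuousAt) countable_empty
      (fun t _ => ((hθ (t + T)).comp_add_const t T |>.sub (hθ t)).congr_deriv
        (by show w (t + T) - w t = 0; rw [wper t, sub_self])) t 0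
    linarith
  have hDpos : 0 < D := by
    have := (strictMono_of_deriv_pos (f := θ) fun t => by rw [(hθ t).deriv]; exact wpos t)
      (show (0 : ℝ) < 0 + T by linarith)
    rw [hD] at this
    linarith
  -- After time T the point is the same, so the angle gain D > 0 has cosine 1.
  obtain ⟨n, hn⟩ : ∃ n : ℕ, (n : ℝ) * (2 * Real.pi) = D := by
    have e0 := hpol 0
    have e1 := hpol (0 + T)
    rw [hper, hD] at e1
    have hne := (Real.sqrt_pos.2 (hl0 0)).ne'
    have c1 := mul_left_cancel₀ hne (e0.1.symm.trans e1.1)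
    have c2 := mul_left_cancel₀ hne (e0.2.symm.trans e1.2)
    have hcos : Real.cos D = 1 := by
      have : D = θ 0 + D - θ 0 := by ring
      rw [this, Real.cos_sub, ← c1, ← c2]
      linear_combination Real.sin_sq_add_cos_sq (θ 0)
    obtain ⟨n, hn⟩ := (Real.cos_eq_one_iff D).1 hcos
    have hn0 : 0 < n := by
      have h3 : (0 : ℝ) < n := pos_of_mul_pos_left (by rw [hn]; exact hDpos) Real.two_pi_pos.le
      exact_mod_cast h3
    lift n to ℕ using hn0.le
    exact ⟨n, by exact_mod_cast hn⟩
  have hτD : ∀ φ, τ (φ + D) = τ φ + T := fun φ => by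
    rw [← hτθ (τ φ + T), hD, hθτ]
  have hsgn : ∀ φ, Real.sin φ < 0 ↔ (γ (τ φ)).1 < 0 := fun φ => by
    have := (hpol (τ φ)).2
    rw [hθτ] at this
    exact sin_neg_iff_of_signedRoot (h1 _) (hl0 _) this
  have hderiv : ∀ φ, (γ (τ φ)).1 ≠ 0 → HasDerivAt (fun φ => level (γ (τ φ))) _ φ := fun φ h0 =>
    (hasDerivAt_level_signedRoot (x := fun t => (γ t).1) (y := fun t => (γ t).2)
      (hx (τ φ)) (hy (τ φ) h0) h0 (h1 (τ φ))).1.comp φ (hτ φ)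
  refine ⟨fun φ => level (γ (τ φ)), n, ?_, ⟨lc.comp τc, fun φ => hl _, fun φ hφ => ?_,
    fun φ hφ => ?_⟩, fun φ => ?_, ?_⟩
  · rcases Nat.eq_zero_or_pos n with rfl | h
    · simp at hn; linarith
    · exact h
  · have hp := hpol (τ φ)
    rw [hθτ] at hp
    have h0 : 0 ≤ (γ (τ φ)).1 := not_lt.1 fun h => (not_lt.2 hφ.le) ((hsgn φ).2 h)
    have hne : (γ (τ φ)).1 ≠ 0 := fun e => by
      rw [e, signedRoot, zero_mul] at hp
      exact (mul_pos (Real.sqrt_pos.2 (hl0 (τ φ))) hφ).ne hp.2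
    have hX := (polX_eq_abs (h1 _) hp.2).1 h0
    refine (hderiv φ hne).congr_deriv ?_
    rw [planeSpeed_eq_of_nonneg (Hp.mem (hl _)) rfl h0 hX hp.1.symm]
    have hpos : 0 < (γ (τ φ)).1 := lt_of_le_of_ne h0 hne.symm
    rw [rate, hX, sgn, sideCoeff, if_pos hpos, if_pos hpos, abs_of_pos hpos, hp.1, mul_pow,
      Real.sq_sqrt (hl0 _).le]
    simp only [div_eq_mul_inv]
    ring
  · have hp := hpol (τ φ)
    rw [hθτ] at hp
    have h0 : (γ (τ φ)).1 < 0 := (hsgn φ).1 hφ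
    have hX := (polX_eq_abs (h1 _) hp.2).2 h0
    refine (hderiv φ h0.ne).congr_deriv ?_
    rw [planeSpeed_eq_of_neg (Hp.mem (hl _)) rfl h0 hX (by rw [Real.cos_neg]; exact hp.1.symm)]
    rw [rate, hX, sgn, sideCoeff, if_neg (not_lt.2 h0.le), if_neg (not_lt.2 h0.le), abs_of_neg h0,
      hp.1, mul_pow, Real.sq_sqrt (hl0 _).le, Real.cos_neg]
    simp only [div_eq_mul_inv]
    ring
  · simp only [hn, hτD, hper (τ φ)]
  · ext z
    constructor
    · rintro ⟨t, rfl⟩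
      exact ⟨θ t, by simp only; rw [← hpt, hτθ]⟩
    · rintro ⟨φ, rfl⟩
      exact ⟨τ φ, hpt φ⟩

end

/-! ### Periodic orbits close after one turn. -/

noncomputable section

theorem rate_add_int_mul_two_pi (a b h θ ε : ℝ) (j : ℤ) :
    rate a b h (θ + j * (2 * Real.pi)) ε = rate a b h θ ε := by
  simp only [rate, angSpeed, polX, Real.sin_add_int_mul_two_pi, Real.cos_add_int_mul_two_pi]

theorem rightPt_add_int_mul_two_pi (h θ : ℝ) (j : ℤ) :
    rightPt h (θ + j * (2 * Real.pi)) = rightPt h θ := by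
  simp only [rightPt, polX, Real.sin_add_int_mul_two_pi, Real.cos_add_int_mul_two_pi]

theorem leftPt_add_int_mul_two_pi (h θ : ℝ) (j : ℤ) :
    leftPt h (θ + j * (2 * Real.pi)) = leftPt h θ := by
  simp only [leftPt, polX, Real.sin_add_int_mul_two_pi, Real.cos_add_int_mul_two_pi]

theorem polarPt_add_int_mul_two_pi (h θ : ℝ) (j : ℤ) :
    polarPt h (θ + j * (2 * Real.pi)) = polarPt h θ := by
  have : -(θ + j * (2 * Real.pi)) = -θ + ((-j : ℤ) : ℝ) * (2 * Real.pi) := by push_cast; ring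
  simp only [polarPt, Real.sin_add_int_mul_two_pi, rightPt_add_int_mul_two_pi, this,
    leftPt_add_int_mul_two_pi]

theorem polarPt_of_mem {h φ : ℝ} (hφ : φ ∈ Icc 0 Real.pi) :
    polarPt h φ = rightPt h φ ∧ polarPt h (-φ) = leftPt h φ := by
  have hs := Real.sin_nonneg_of_mem_Icc hφ
  refine ⟨if_pos hs, ?_⟩
  unfold polarPt
  split_ifs with h0
  · have e : Real.sin φ = 0 := by
      rw [Real.sin_neg] at h0
      linarith
    simp [rightPt, leftPt, polX, e, psiInv_zero]
  · rw [neg_neg]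

theorem exists_int_reduction (θ : ℝ) : ∃ (j : ℤ) (φ : ℝ), φ ∈ Icc 0 Real.pi ∧
    (θ = φ + j * (2 * Real.pi) ∨ θ = -φ + j * (2 * Real.pi)) := by
  obtain ⟨m, hm, -⟩ := existsUnique_add_zsmul_mem_Ioc Real.two_pi_pos θ (-Real.pi)
  rw [zsmul_eq_mul] at hm
  rcases le_total 0 (θ + m * (2 * Real.pi)) with h | h
  · refine ⟨-m, θ + m * (2 * Real.pi), ⟨h, by linarith [hm.2]⟩, Or.inl ?_⟩
    push_cast; ring
  · refine ⟨-m, -(θ + m * (2 * Real.pi)), ⟨by linarith, by linarith [hm.1]⟩, Or.inr ?_⟩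
    push_cast; ring

namespace IsFullSol

variable {a₀ a₁ b₀ b₁ c d ε L : ℝ} {h : ℝ → ℝ}

theorem right (hf : IsFullSol a₀ a₁ b₀ b₁ c d ε h) (j : ℤ) :
    IsHalfSol a₀ a₁ c d ε fun φ => h (φ + j * (2 * Real.pi)) := by
  refine ⟨(hf.cont.comp (by fun_prop)).continuousOn, fun _ _ => hf.mem _, fun φ hφ => ?_⟩
  have := (hf.deriv_pos (φ + j * (2 * Real.pi)) (by
    rw [Real.sin_add_int_mul_two_pi]; exact Real.sin_pos_of_mem_Ioo hφ)).comp_add_const φ _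
  rwa [rate_add_int_mul_two_pi] at this

/-- The left half-turn is read backwards, φ ↦ -φ, so that it starts at A like the right one and
solves an equation of the same form. -/
theorem left (hf : IsFullSol a₀ a₁ b₀ b₁ c d ε h) (j : ℤ) :
    IsHalfSol (-b₀) b₁ c d ε fun φ => h (-φ + j * (2 * Real.pi)) := by
  refine ⟨(hf.cont.comp (by fun_prop)).continuousOn, fun _ _ => hf.mem _, fun φ hφ => ?_⟩
  have h1 := hf.deriv_neg (-φ + j * (2 * Real.pi)) (by
    rw [Real.sin_add_int_mul_two_pi, Real.sin_neg]
    linarith [Real.sin_pos_of_mem_Ioo hφ])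
  have e : -(-φ + j * (2 * Real.pi)) = φ + ((-j : ℤ) : ℝ) * (2 * Real.pi) := by push_cast; ring
  rw [e, rate_add_int_mul_two_pi] at h1
  have h2 : HasDerivAt (fun φ : ℝ => -φ + j * (2 * Real.pi)) (-1) φ :=
    (hasDerivAt_neg φ).add_const _
  exact (h1.comp φ h2).congr_deriv (by ring)

theorem right_pi (h : ℝ → ℝ) (j : ℤ) : h (Real.pi + j * (2 * Real.pi)) =
    h (-Real.pi + ((j + 1 : ℤ) : ℝ) * (2 * Real.pi)) := by
  congr 1; push_cast; ring

/-- Order is preserved along a right half-turn from 0 to π, then along the next left half-turn,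
which is read from π back to 0. -/
theorem step_lt (Hp : RateBounds a₀ a₁ c d ε L) (Hm : RateBounds (-b₀) b₁ c d ε L)
    (hf : IsFullSol a₀ a₁ b₀ b₁ c d ε h) {i k : ℤ}
    (hlt : h (i * (2 * Real.pi)) < h (k * (2 * Real.pi))) :
    h ((i + 1 : ℤ) * (2 * Real.pi)) < h ((k + 1 : ℤ) * (2 * Real.pi)) := by
  have hpi := Real.pi_pos.le
  have h0 : (0 : ℝ) ∈ Icc 0 Real.pi := ⟨le_rfl, hpi⟩
  have h1 : Real.pi ∈ Icc 0 Real.pi := ⟨hpi, le_rfl⟩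
  have := (hf.right i).lt_of_lt Hp (hf.right k) h0 h1 (by simpa using hlt)
  rw [right_pi h i, right_pi h k] at this
  simpa using (hf.left (i + 1)).lt_of_lt Hm (hf.left (k + 1)) h1 h0 this

/-- A strictly increasing return map has no periodic points other than fixed points: a strict change
over one turn repeats in the same direction and never comes back. -/
theorem eq_next (Hp : RateBounds a₀ a₁ c d ε L) (Hm : RateBounds (-b₀) b₁ c d ε L)
    (hf : IsFullSol a₀ a₁ b₀ b₁ c d ε h) {n : ℕ} (hn : 0 < n)
    (hper : ∀ θ, h (θ + n * (2 * Real.pi)) = h θ) (j : ℤ) :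
    h (j * (2 * Real.pi)) = h ((j + 1 : ℤ) * (2 * Real.pi)) := by
  have hj : h ((j + n : ℤ) * (2 * Real.pi)) = h (j * (2 * Real.pi)) := by
    rw [← hper (j * (2 * Real.pi))]; congr 1; push_cast; ring
  obtain ⟨m, rfl⟩ : ∃ m, n = m + 1 := ⟨n - 1, by omega⟩
  rcases lt_trichotomy (h (j * (2 * Real.pi))) (h ((j + 1 : ℤ) * (2 * Real.pi))) with hlt | he | hlt
  · exfalso
    have step : ∀ m : ℕ, h ((j + m : ℤ) * (2 * Real.pi)) < h ((j + m + 1 : ℤ) * (2 * Real.pi)) := by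
      intro m
      induction m with
      | zero => simpa using hlt
      | succ m ih =>
        have := step_lt Hp Hm hf ih
        push_cast at this ⊢
        simpa only [add_assoc] using this
    have key : ∀ m : ℕ, h (j * (2 * Real.pi)) < h ((j + (m + 1 : ℕ) : ℤ) * (2 * Real.pi)) := by
      intro m
      induction m with
      | zero => simpa using hlt
      | succ m ih =>
        have := ih.trans (step (m + 1))
        push_cast at this ⊢
        simpa only [add_assoc] using this
    exact (key m).ne' hj
  · exact he
  · exfalso
    have step : ∀ m : ℕ, h ((j + m + 1 : ℤ) * (2 * Real.pi)) < h ((j + m : ℤ) * (2 * Real.pi)) := by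
      intro m
      induction m with
      | zero => simpa using hlt
      | succ m ih =>
        have := step_lt Hp Hm hf ih
        push_cast at this ⊢
        simpa only [add_assoc] using this
    have key : ∀ m : ℕ, h ((j + (m + 1 : ℕ) : ℤ) * (2 * Real.pi)) < h (j * (2 * Real.pi)) := by
      intro m
      induction m with
      | zero => simpa using hlt
      | succ m ih =>
        have := (step (m + 1)).trans ih
        push_cast at this ⊢
        simpa only [add_assoc] using this
    exact (key m).ne hj

end IsFullSol

/-- Periodic orbits in the annulus close up after one turn. -/
theorem exists_turnSet_eq {a₀ a₁ b₀ b₁ c d ε L : ℝ} (Hp : RateBounds a₀ a₁ c d ε L)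
    (Hm : RateBounds (-b₀) b₁ c d ε L) {C : Set (ℝ × ℝ)}
    (hC : IsPeriodicOrbit (fieldPlus a₀ a₁ ε) (fieldMinus b₀ b₁ ε) C)
    (hK : ∀ z ∈ C, |z.1| < 1 ∧ level z ∈ Icc c d) :
    ∃ h k : ℝ → ℝ, IsHalfSol a₀ a₁ c d ε h ∧ IsHalfSol (-b₀) b₁ c d ε k ∧ h 0 = k 0 ∧
      h Real.pi = k Real.pi ∧ C = turnSet h k := by
  obtain ⟨γ, T, hT, hγ, hper, -, rfl⟩ := hC
  obtain ⟨h, n, hn, hf, hhper, hrange⟩ := exists_isFullSol Hp Hm hT hγ hper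
    (fun t => (hK _ ⟨t, rfl⟩).1) (fun t => (hK _ ⟨t, rfl⟩).2)
  have hpi := Real.pi_pos.le
  have h0 : (0 : ℝ) ∈ Icc 0 Real.pi := ⟨le_rfl, hpi⟩
  have h1 : Real.pi ∈ Icc 0 Real.pi := ⟨hpi, le_rfl⟩
  have hall : ∀ j : ℤ, h (j * (2 * Real.pi)) = h 0 := by
    intro j
    induction j using Int.induction_on with
    | zero => simp
    | succ i ih => rw [← ih]; exact (hf.eq_next Hp Hm hn hhper i).symm
    | pred i ih =>
      rw [← ih, hf.eq_next Hp Hm hn hhper (-i - 1)]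
      congr 1; push_cast; ring
  -- All turns start at the same level, so by uniqueness all right halves coincide; likewise all
  -- left halves.
  have hR : ∀ (j : ℤ), ∀ φ ∈ Icc 0 Real.pi, h (φ + j * (2 * Real.pi)) = h φ := fun j φ hφ => by
    have := (hf.right j).eqOn Hp (hf.right 0) h0 (by simp only [zero_add]; rw [hall, hall]) hφ
    simpa using this
  have hL : ∀ (j : ℤ), ∀ φ ∈ Icc 0 Real.pi, h (-φ + j * (2 * Real.pi)) = h (-φ) := fun j φ hφ => by
    have := (hf.left j).eqOn Hm (hf.left 0) h0
      (by simp only [neg_zero, zero_add]; rw [hall, hall]) hφ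
    simpa using this
  have hr := hf.right 0
  have hl := hf.left 0
  simp only [Int.cast_zero, zero_mul, add_zero] at hr hl
  refine ⟨h, fun φ => h (-φ), hr, hl, by simp, ?_, ?_⟩
  · simp only
    rw [← hL 1 _ h1]; congr 1; push_cast; ring
  · rw [hrange]
    apply Subset.antisymm
    · rintro _ ⟨θ, rfl⟩
      obtain ⟨j, φ, hφ, rfl | rfl⟩ := exists_int_reduction θ
      · refine Or.inl ⟨φ, hφ, ?_⟩
        simp only
        rw [hR j φ hφ, polarPt_add_int_mul_two_pi, (polarPt_of_mem hφ).1]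
      · refine Or.inr ⟨φ, hφ, ?_⟩
        simp only
        rw [hL j φ hφ, polarPt_add_int_mul_two_pi, (polarPt_of_mem hφ).2]
    · rintro _ (⟨φ, hφ, rfl⟩ | ⟨φ, hφ, rfl⟩)
      · exact ⟨φ, (polarPt_of_mem hφ).1⟩
      · exact ⟨-φ, (polarPt_of_mem hφ).2⟩

end

noncomputable section

/-! ### Nearby half-turns -/

/-- Picard–Lindelöf on an interval, with the confinement to the ball. -/
theorem IsPicardLindelof.exists_forall_mem_closedBall {f : ℝ → ℝ → ℝ} {tmin tmax : ℝ}
    {t₀ : Icc tmin tmax} {x₀ : ℝ} {a L K : NNReal} (hf : IsPicardLindelof f t₀ x₀ a 0 L K) :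
    ∃ α : ℝ → ℝ, α t₀ = x₀ ∧ (∀ t, α t ∈ Metric.closedBall x₀ a) ∧
      ∀ t ∈ Icc tmin tmax, HasDerivWithinAt α (f t (α t)) (Icc tmin tmax) t := by
  obtain ⟨α, hα⟩ := ODE.FunSpace.exists_isFixedPt_next hf (Metric.mem_closedBall_self le_rfl)
  refine ⟨α.compProj, by rw [ODE.FunSpace.compProj_val, ← hα, ODE.FunSpace.next_apply₀],
    fun t => α.compProj_mem_closedBall hf.mul_max_le, fun t ht => ?_⟩
  refine (ODE.hasDerivWithinAt_picard_Icc t₀.2 hf.continuousOn_uncurry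
    α.continuous_compProj.continuousOn (fun _ _ => α.compProj_mem_closedBall hf.mul_max_le)
    x₀ ht).congr_of_mem (fun t' ht' => ?_) ht
  nth_rw 1 [← hα]
  rw [ODE.FunSpace.compProj_of_mem ht', ODE.FunSpace.next_apply]

/-- The level drifts by at most |ε| L π during a half-turn, so the solution stays within r of x₀ and
exists up to π. -/
theorem exists_isHalfSol {a b c d ε L r x₀ : ℝ} (H : RateBounds a b c d ε L) (hr : 0 ≤ r)
    (hx₀ : Icc (x₀ - r) (x₀ + r) ⊆ Icc c d) (hε : |ε| * L * Real.pi ≤ r) :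
    ∃ η : ℝ → ℝ, IsHalfSol a b c d ε η ∧ η 0 = x₀ := by
  have hpi := Real.pi_pos.le
  have hball : Metric.closedBall x₀ r ⊆ Icc c d := by rwa [Real.closedBall_eq_Icc]
  have hL := mul_nonneg (abs_nonneg ε) H.L_nonneg
  have hPL : IsPicardLindelof (fun θ u => ε * rate a b u θ ε) (tmin := 0) (tmax := Real.pi)
      ⟨0, le_rfl, hpi⟩ x₀ ⟨r, hr⟩ 0 ⟨|ε| * L, hL⟩ ⟨|ε| * L, hL⟩ := by
    refine ⟨fun θ hθ => LipschitzOnWith.of_dist_le_mul fun u hu v hv => ?_, fun u hu => ?_,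
      fun θ hθ u hu => ?_, ?_⟩
    · have := H.abs_sub_le (hball hv) (hball hu) hθ
      rw [Real.dist_eq, Real.dist_eq, ← mul_sub, abs_mul]
      exact (mul_le_mul_of_nonneg_left this (abs_nonneg ε)).trans_eq (mul_assoc _ _ _).symm
    · exact continuousOn_const.mul
        (H.continuousOn_rate (f := fun _ => u) continuousOn_const fun _ _ => hball hu)
    · rw [Real.norm_eq_abs, abs_mul]
      exact mul_le_mul_of_nonneg_left (H.le u (hball hu) θ hθ) (abs_nonneg ε)
    · have : |ε| * L * max (Real.pi - 0) (0 - 0) ≤ r - 0 := by simpa [hpi] using hε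
      exact this
  obtain ⟨η, h0, hmem, hd⟩ := hPL.exists_forall_mem_closedBall
  exact ⟨η, ⟨fun θ hθ => (hd θ hθ).continuousWithinAt, fun θ _ => hball (hmem θ), fun θ hθ =>
    (hd θ (Ioo_subset_Icc_self hθ)).hasDerivAt (Icc_mem_nhds hθ.1 hθ.2)⟩, h0⟩

theorem turnSet_congr {h h' k k' : ℝ → ℝ} (hh : EqOn h h' (Icc 0 Real.pi))
    (hk : EqOn k k' (Icc 0 Real.pi)) : turnSet h k = turnSet h' k' := by
  unfold turnSet
  rw [image_congr fun θ hθ => by rw [hh hθ], image_congr (s := Icc 0 Real.pi)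
    (f := fun θ => leftPt (k θ) θ) (g := fun θ => leftPt (k' θ) θ) fun θ hθ => by rw [hk hθ]]

theorem eq_zero_of_polX_eq_zero {l θ y : ℝ} (hl : l ∈ Ioo (0 : ℝ) (1 / 6))
    (hθ : θ ∈ Icc 0 Real.pi) (hX : polX l θ = 0) (hy : √l * Real.cos θ = y) (hy0 : 0 < y) :
    θ = 0 := by
  by_contra hne
  have h0 : 0 < θ := lt_of_le_of_ne hθ.1 (Ne.symm hne)
  rcases hθ.2.eq_or_lt with rfl | h1
  · rw [Real.cos_pi] at hy
    linarith [Real.sqrt_nonneg l]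
  · exact (polX_pos hl ⟨h0, h1⟩).ne' hX

/-- The initial level can be read off the curve. -/
theorem eq_of_turnSet_subset {c d : ℝ} {h k h' k' : ℝ → ℝ} (hc : 0 < c) (hd : d < 1 / 6)
    (hh : h 0 ∈ Icc c d) (hh' : ∀ θ ∈ Icc 0 Real.pi, h' θ ∈ Icc c d)
    (hk' : ∀ θ ∈ Icc 0 Real.pi, k' θ ∈ Icc c d) (e : h' 0 = k' 0)
    (hs : turnSet h k ⊆ turnSet h' k') : h 0 = h' 0 := by
  have hm : ∀ {l}, l ∈ Icc c d → l ∈ Ioo (0 : ℝ) (1 / 6) := fun hl =>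
    ⟨hc.trans_le hl.1, hl.2.trans_lt hd⟩
  have hpos : 0 < √(h 0) := Real.sqrt_pos.2 (hm hh).1
  have h00 : (0 : ℝ) ∈ Icc 0 Real.pi := ⟨le_rfl, Real.pi_pos.le⟩
  -- Either half of a curve meets the positive y-axis only at θ = 0, so this point determines the
  -- initial level.
  have hp : ((0, √(h 0)) : ℝ × ℝ) ∈ turnSet h k := Or.inl ⟨0, h00, by simp [rightPt, polX, psiInv_zero]⟩
  rcases hs hp with ⟨θ, hθ, e'⟩ | ⟨θ, hθ, e'⟩
  · obtain ⟨e1, e2⟩ := Prod.mk.inj e'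
    obtain rfl := eq_zero_of_polX_eq_zero (hm (hh' θ hθ)) hθ e1 e2 hpos
    rw [Real.cos_zero, mul_one] at e2
    exact ((Real.sqrt_inj (hm (hh' _ h00)).1.le (hm hh).1.le).1 e2).symm
  · obtain ⟨e1, e2⟩ := Prod.mk.inj e'
    obtain rfl := eq_zero_of_polX_eq_zero (hm (hk' θ hθ)) hθ (neg_eq_zero.1 e1) e2 hpos
    rw [Real.cos_zero, mul_one] at e2
    rw [e]
    exact ((Real.sqrt_inj (hm (hk' _ h00)).1.le (hm hh).1.le).1 e2).symm

theorem continuousOn_rightPt_leftPt {c d : ℝ} (hc : 0 < c) (hd : d < 1 / 6) :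
    ContinuousOn (fun q : ℝ × ℝ => rightPt q.1 q.2) (Icc c d ×ˢ Icc 0 Real.pi) ∧
    ContinuousOn (fun q : ℝ × ℝ => leftPt q.1 q.2) (Icc c d ×ˢ Icc 0 Real.pi) := by
  have hX : ContinuousOn (fun q : ℝ × ℝ => polX q.1 q.2) (Icc c d ×ˢ Icc 0 Real.pi) :=
    fun q hq => (ContinuousAt.comp (g := fun q : ℝ × ℝ × ℝ => polX q.1 q.2.1)
      (f := fun q : ℝ × ℝ => (q.1, q.2, (0 : ℝ))) (contDiffAt_polX (q := (q.1, q.2, 0))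
        ⟨hc.trans_le hq.1.1, hq.1.2.trans_lt hd⟩).continuousAt (by fun_prop)).continuousWithinAt
  unfold rightPt leftPt
  exact ⟨by fun_prop, by fun_prop⟩

/-- The compact curve has a uniform thickening inside U, and the polar maps are uniformly continuous
on [c, d] × [0, π]. -/
theorem exists_turnSet_subset {c d : ℝ} (hc : 0 < c) (hd : d < 1 / 6) {h k : ℝ → ℝ}
    (hh : ContinuousOn h (Icc 0 Real.pi)) (hk : ContinuousOn k (Icc 0 Real.pi))
    (hhm : ∀ θ ∈ Icc 0 Real.pi, h θ ∈ Icc c d) (hkm : ∀ θ ∈ Icc 0 Real.pi, k θ ∈ Icc c d)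
    {U : Set (ℝ × ℝ)} (hU : IsOpen U) (hs : turnSet h k ⊆ U) :
    ∃ r : ℝ, 0 < r ∧ ∀ h' k' : ℝ → ℝ, (∀ θ ∈ Icc 0 Real.pi, h' θ ∈ Icc c d ∧ |h' θ - h θ| < r) →
      (∀ θ ∈ Icc 0 Real.pi, k' θ ∈ Icc c d ∧ |k' θ - k θ| < r) → turnSet h' k' ⊆ U := by
  obtain ⟨hR, hL⟩ := continuousOn_rightPt_leftPt hc hd
  have hK : IsCompact (Icc c d ×ˢ Icc 0 Real.pi) := isCompact_Icc.prod isCompact_Icc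
  have one : ∀ G : ℝ × ℝ → ℝ × ℝ, ContinuousOn G (Icc c d ×ˢ Icc 0 Real.pi) → ∀ h : ℝ → ℝ,
      ContinuousOn h (Icc 0 Real.pi) → (∀ θ ∈ Icc 0 Real.pi, h θ ∈ Icc c d) →
      (fun θ => G (h θ, θ)) '' Icc 0 Real.pi ⊆ U → ∃ r : ℝ, 0 < r ∧ ∀ h' : ℝ → ℝ,
      (∀ θ ∈ Icc 0 Real.pi, h' θ ∈ Icc c d ∧ |h' θ - h θ| < r) →
      (fun θ => G (h' θ, θ)) '' Icc 0 Real.pi ⊆ U := by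
    intro G hG h hh hhm hs
    have hcomp : IsCompact ((fun θ => G (h θ, θ)) '' Icc 0 Real.pi) :=
      isCompact_Icc.image_of_continuousOn
        (hG.comp (hh.prodMk continuousOn_id) fun θ hθ => ⟨hhm θ hθ, hθ⟩)
    obtain ⟨ρ, hρ, hsub⟩ := hcomp.exists_thickening_subset_open hU hs
    obtain ⟨r, hr, hr'⟩ := Metric.uniformContinuousOn_iff.1
      (hK.uniformContinuousOn_of_continuous hG) ρ hρ
    refine ⟨r, hr, fun h' hh' => ?_⟩
    rintro _ ⟨θ, hθ, rfl⟩
    refine hsub (Metric.mem_thickening_iff.2 ⟨_, ⟨θ, hθ, rfl⟩, ?_⟩)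
    refine hr' _ ⟨(hh' θ hθ).1, hθ⟩ _ ⟨hhm θ hθ, hθ⟩ ?_
    rw [Prod.dist_eq, dist_self, Real.dist_eq]
    exact max_lt (hh' θ hθ).2 hr
  obtain ⟨r₁, hr₁, h1⟩ := one _ hR h hh hhm (subset_union_left.trans hs)
  obtain ⟨r₂, hr₂, h2⟩ := one _ hL k hk hkm (subset_union_right.trans hs)
  exact ⟨min r₁ r₂, lt_min hr₁ hr₂, fun h' k' hh' hk' => union_subset
    (h1 h' fun θ hθ => ⟨(hh' θ hθ).1, (hh' θ hθ).2.trans_le (min_le_left _ _)⟩)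
    (h2 k' fun θ hθ => ⟨(hk' θ hθ).1, (hk' θ hθ).2.trans_le (min_le_right _ _)⟩)⟩

/-- If the two half-turns satisfy the same equation, periodic orbits are not isolated. -/
theorem not_isLimitCycle_of_symm {a b c d ε L δ : ℝ} (H : RateBounds a b c d ε L) (hδ : 0 < δ)
    (hε : |ε| * L * Real.pi ≤ δ / 2) {C : Set (ℝ × ℝ)}
    (hK : ∀ z ∈ C, |z.1| < 1 ∧ level z ∈ Icc (c + δ) (d - δ)) :
    ¬ IsLimitCycle (fieldPlus a b ε) (fieldMinus (-a) b ε) C := by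
  rintro ⟨hC, U, hU, hCU, hiso⟩
  have hpi := Real.pi_pos.le
  have h00 : (0 : ℝ) ∈ Icc 0 Real.pi := ⟨le_rfl, hpi⟩
  have hcd : ∀ {l}, l ∈ Icc (c + δ) (d - δ) → l ∈ Icc c d := fun hl =>
    ⟨by linarith [hl.1], by linarith [hl.2]⟩
  obtain ⟨h, k, hh, hk, e0, -, rfl⟩ := exists_turnSet_eq H (b₀ := -a) (b₁ := b)
    (by rwa [neg_neg]) hC fun z hz => ⟨(hK z hz).1, hcd (hK z hz).2⟩
  rw [neg_neg] at hk
  have hhk := hh.eqOn H hk h00 e0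
  rw [turnSet_congr (h' := h) (fun _ _ => rfl) hhk.symm] at hK hCU hiso
  have hh0 : h 0 ∈ Icc (c + δ) (d - δ) := by
    have := (hK _ (Or.inl ⟨0, h00, rfl⟩)).2
    simpa [level, rightPt, polX, psiInv_zero, PsiOne, Real.sq_sqrt (H.mem (hh.mem 0 h00)).1.le]
      using this
  obtain ⟨r, hr, hr'⟩ := exists_turnSet_subset H.c_pos H.d_lt hh.cont hh.cont hh.mem hh.mem hU hCU
  set E := Real.exp (|ε| * L * Real.pi) with hE
  have hEpos : 0 < E := Real.exp_pos _
  -- The first bound keeps the shifted solution in [c, d]; the second, with the Grönwall factor E,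
  -- keeps it closer than r to h over the whole half-turn.
  set s := min (δ / 2) (r / (2 * E)) with hs
  have hspos : 0 < s := lt_min (by linarith) (by positivity)
  have hs1 : s ≤ δ / 2 := min_le_left _ _
  have hs2 : E * s < r := by
    have : s ≤ r / (2 * E) := min_le_right _ _
    rw [le_div_iff₀ (by positivity)] at this
    nlinarith
  obtain ⟨η, hη, hη0⟩ := exists_isHalfSol (x₀ := h 0 + s) H (by linarith : 0 ≤ δ / 2)
    (Icc_subset_Icc (by linarith [hh0.1]) (by linarith [hh0.2])) hε
  have hclose : ∀ θ ∈ Icc 0 Real.pi, η θ ∈ Icc c d ∧ |η θ - h θ| < r := fun θ hθ => by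
    refine ⟨hη.mem θ hθ, (hh.abs_sub_le H hη h00 hθ).trans_lt (lt_of_le_of_lt ?_ hs2)⟩
    rw [hη0, add_sub_cancel_left, abs_of_pos hspos, sub_zero, abs_of_nonneg hθ.1]
    refine mul_le_mul_of_nonneg_right (Real.exp_le_exp.2 ?_) hspos.le
    exact mul_le_mul_of_nonneg_left hθ.2 (mul_nonneg (abs_nonneg _) H.L_nonneg)
  have := hiso _ (isPeriodicOrbit_turnSet H hη) (hr' η η hclose hclose)
  have := eq_of_turnSet_subset H.c_pos H.d_lt (hη.mem 0 h00) hh.mem hh.mem rfl this.subset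
  linarith

end

noncomputable section

open Filter Topology

/-! ### Sequences of half-turns with vanishing perturbation -/

theorem IsHalfSol.integral_rate {a b c d ε L : ℝ} {h : ℝ → ℝ} (H : RateBounds a b c d ε L)
    (hh : IsHalfSol a b c d ε h) :
    ε * ∫ θ in (0 : ℝ)..Real.pi, rate a b (h θ) θ ε = h Real.pi - h 0 := by
  rw [← intervalIntegral.integral_const_mul]
  refine intervalIntegral.integral_eq_sub_of_hasDerivAt_of_le Real.pi_pos.le hh.cont hh.deriv ?_
  refine ContinuousOn.intervalIntegrable_of_Icc Real.pi_pos.le ?_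
  exact continuousOn_const.mul (H.continuousOn_rate hh.cont hh.mem)

/-- The difference quotient of `rate` between two half-turns. -/
def rateSlope (a b ε : ℝ) (h k : ℝ → ℝ) (θ : ℝ) : ℝ :=
  (rate a b (k θ) θ ε - rate a b (h θ) θ ε) / (k θ - h θ)

theorem continuousOn_rateSlope {a b c d ε L : ℝ} {h k : ℝ → ℝ} (H : RateBounds a b c d ε L)
    (hh : IsHalfSol a b c d ε h) (hk : IsHalfSol a b c d ε k)
    (hlt : ∀ θ ∈ Icc 0 Real.pi, h θ < k θ) :
    ContinuousOn (rateSlope a b ε h k) (Icc 0 Real.pi) :=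
  ((H.continuousOn_rate hk.cont hk.mem).sub (H.continuousOn_rate hh.cont hh.mem)).div
    (hk.cont.sub hh.cont) fun θ hθ => (sub_pos.2 (hlt θ hθ)).ne'

/-- The logarithmic derivative of the gap k - h is ε times the difference quotient. Unlike the gap
itself, this survives division by ε when the two solutions merge. -/
theorem integral_rateSlope {a b c d ε L : ℝ} {h k : ℝ → ℝ} (H : RateBounds a b c d ε L)
    (hh : IsHalfSol a b c d ε h) (hk : IsHalfSol a b c d ε k)
    (hlt : ∀ θ ∈ Icc 0 Real.pi, h θ < k θ) :
    ε * ∫ θ in (0 : ℝ)..Real.pi, rateSlope a b ε h k θ =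
      Real.log (k Real.pi - h Real.pi) - Real.log (k 0 - h 0) := by
  rw [← intervalIntegral.integral_const_mul]
  refine intervalIntegral.integral_eq_sub_of_hasDerivAt_of_le
    (f := fun θ => Real.log (k θ - h θ)) Real.pi_pos.le
    ((hk.cont.sub hh.cont).log fun θ hθ => (sub_pos.2 (hlt θ hθ)).ne') (fun θ hθ => ?_) ?_
  · refine (((hk.deriv θ hθ).sub (hh.deriv θ hθ)).log
      (sub_pos.2 (hlt θ (Ioo_subset_Icc_self hθ))).ne').congr_deriv ?_
    rw [rateSlope, ← mul_sub, mul_div_assoc]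
    rfl
  · refine ContinuousOn.intervalIntegrable_of_Icc Real.pi_pos.le ?_
    exact continuousOn_const.mul (continuousOn_rateSlope H hh hk hlt)

section Limits

variable {a b c d L x : ℝ} {e : ℕ → ℝ} {h k : ℕ → ℝ → ℝ}

theorem tendsto_apply_of_isHalfSol (H : ∀ n, RateBounds a b c d (e n) L)
    (he : Tendsto e atTop (𝓝 0)) (hh : ∀ n, IsHalfSol a b c d (e n) (h n))
    (hx : Tendsto (fun n => h n 0) atTop (𝓝 x)) {θ : ℝ} (hθ : θ ∈ Icc 0 Real.pi) :
    Tendsto (fun n => h n θ) atTop (𝓝 x) := by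
  have h1 : Tendsto (fun n => |e n| * L * Real.pi) atTop (𝓝 0) := by
    simpa using ((he.abs.mul_const L).mul_const Real.pi)
  have h2 : Tendsto (fun n => h n θ - h n 0) atTop (𝓝 0) :=
    squeeze_zero_norm (fun n => (hh n).abs_sub_initial_le (H n) hθ) h1
  simpa using h2.add hx

theorem tendsto_integral_rate (H : ∀ n, RateBounds a b c d (e n) L)
    (he : Tendsto e atTop (𝓝 0)) (hh : ∀ n, IsHalfSol a b c d (e n) (h n))
    (hx : Tendsto (fun n => h n 0) atTop (𝓝 x)) (hx0 : x ∈ Ioo (0 : ℝ) (1 / 6)) :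
    Tendsto (fun n => ∫ θ in (0 : ℝ)..Real.pi, rate a b (h n θ) θ (e n)) atTop
      (𝓝 (arcInt a b x)) := by
  have hsub : uIoc 0 Real.pi ⊆ Icc 0 Real.pi := by
    rw [uIoc_of_le Real.pi_pos.le]; exact Ioc_subset_Icc_self
  refine intervalIntegral.tendsto_integral_filter_of_dominated_convergence (fun _ => L)
    (Eventually.of_forall fun n => (((H n).continuousOn_rate (hh n).cont (hh n).mem).mono
      hsub).aestronglyMeasurable measurableSet_uIoc)
    (Eventually.of_forall fun n => Eventually.of_forall fun θ hθ =>
      (H n).le _ ((hh n).mem θ (hsub hθ)) θ (hsub hθ))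
    intervalIntegrable_const (Eventually.of_forall fun θ hθ => ?_)
  have hc := (contDiffAt_rate a b (q := (x, θ, 0)) hx0 (angSpeed_zero_pos hx0 θ).ne').continuousAt
  exact hc.tendsto.comp ((tendsto_apply_of_isHalfSol H he hh hx (hsub hθ)).prodMk_nhds
    (tendsto_const_nhds.prodMk_nhds he))

/-- By the mean value theorem each difference quotient is `rateDeriv` at a level between the two
solutions, hence at a level tending to x. The common bound L permits dominated convergence. -/
theorem tendsto_integral_rateSlope (H : ∀ n, RateBounds a b c d (e n) L)
    (he : Tendsto e atTop (𝓝 0)) (hh : ∀ n, IsHalfSol a b c d (e n) (h n))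
    (hk : ∀ n, IsHalfSol a b c d (e n) (k n)) (hlt : ∀ n, ∀ θ ∈ Icc 0 Real.pi, h n θ < k n θ)
    (hx : Tendsto (fun n => h n 0) atTop (𝓝 x)) (hy : Tendsto (fun n => k n 0) atTop (𝓝 x))
    (hx0 : x ∈ Ioo (0 : ℝ) (1 / 6)) :
    Tendsto (fun n => ∫ θ in (0 : ℝ)..Real.pi, rateSlope a b (e n) (h n) (k n) θ) atTop
      (𝓝 (arcIntDeriv a b x)) := by
  have hsub : uIoc 0 Real.pi ⊆ Icc 0 Real.pi := by
    rw [uIoc_of_le Real.pi_pos.le]; exact Ioc_subset_Icc_self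
  rw [← integral_rateDeriv_zero a b hx0]
  refine intervalIntegral.tendsto_integral_filter_of_dominated_convergence (fun _ => L)
    (Eventually.of_forall fun n => ((continuousOn_rateSlope (H n) (hh n) (hk n) (hlt n)).mono
      hsub).aestronglyMeasurable measurableSet_uIoc)
    (Eventually.of_forall fun n => Eventually.of_forall fun θ hθ => ?_)
    intervalIntegrable_const (Eventually.of_forall fun θ hθ => ?_)
  · have hpos := sub_pos.2 (hlt n θ (hsub hθ))
    rw [rateSlope, norm_div, Real.norm_eq_abs, Real.norm_eq_abs, div_le_iff₀ (abs_pos.2 hpos.ne')]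
    exact (H n).abs_sub_le ((hh n).mem θ (hsub hθ)) ((hk n).mem θ (hsub hθ)) (hsub hθ)
  · have hθ' := hsub hθ
    have hmvt : ∀ n, ∃ ξ ∈ Ioo (h n θ) (k n θ),
        rateDeriv a b ξ θ (e n) = rateSlope a b (e n) (h n) (k n) θ := fun n => by
      have hin : ∀ u ∈ Icc (h n θ) (k n θ), u ∈ Icc c d := fun u hu =>
        ⟨((hh n).mem θ hθ').1.trans hu.1, hu.2.trans ((hk n).mem θ hθ').2⟩
      have hd : ∀ u ∈ Icc (h n θ) (k n θ), HasDerivAt (fun u => rate a b u θ (e n))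
          (rateDeriv a b u θ (e n)) u := fun u hu =>
        hasDerivAt_rate ((H n).mem (hin u hu)) ((H n).pos u (hin u hu) θ hθ').ne'
      exact exists_hasDerivAt_eq_slope _ _ (hlt n θ hθ')
        (fun u hu => (hd u hu).continuousAt.continuousWithinAt)
        fun u hu => hd u (Ioo_subset_Icc_self hu)
    choose ξ hξ hξ' using hmvt
    have hξx : Tendsto ξ atTop (𝓝 x) := tendsto_of_tendsto_of_tendsto_of_le_of_le
      (tendsto_apply_of_isHalfSol H he hh hx hθ') (tendsto_apply_of_isHalfSol H he hk hy hθ')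
      (fun n => (hξ n).1.le) fun n => (hξ n).2.le
    simp only [← hξ']
    have hc := continuousAt_rateDeriv a b (q := (x, θ, 0)) hx0 (angSpeed_zero_pos hx0 θ).ne'
    exact hc.tendsto.comp (hξx.prodMk_nhds (tendsto_const_nhds.prodMk_nhds he))

end Limits

theorem arcIntDeriv_eq (a b : ℝ) {h : ℝ} (hh : h ∈ Ioo (0 : ℝ) (1 / 6)) :
    arcIntDeriv a b h = a * arcIntDeriv 1 0 h + b * arcIntDeriv 0 1 h := by
  refine (hasDerivAt_arcInt a b hh).unique ?_
  refine (((hasDerivAt_arcInt 1 0 hh).const_mul a).add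
    ((hasDerivAt_arcInt 0 1 hh).const_mul b)).congr_of_eventuallyEq ?_
  filter_upwards [Ioo_mem_nhds hh.1 hh.2] with x hx
  exact arcInt_eq a b hx

/-- If the first order Melnikov function is nontrivial, then for small `ε` at most one pair of
half-turns with levels in `[c, d]` closes up. -/
theorem exists_unique_closing {a₀ a₁ b₀ b₁ c d : ℝ} (hc : 0 < c) (hd : d < 1 / 6)
    (hne : a₀ - b₀ ≠ 0 ∨ a₁ - b₁ ≠ 0) :
    ∃ ε₀ : ℝ, 0 < ε₀ ∧ ∀ ε : ℝ, 0 < |ε| → |ε| < ε₀ → ∀ h h' k k' : ℝ → ℝ,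
      IsHalfSol a₀ a₁ c d ε h → IsHalfSol a₀ a₁ c d ε k →
      IsHalfSol b₀ b₁ c d ε h' → IsHalfSol b₀ b₁ c d ε k' →
      h 0 = h' 0 → h Real.pi = h' Real.pi → k 0 = k' 0 → k Real.pi = k' Real.pi → h 0 = k 0 := by
  have hpi := Real.pi_pos.le
  have h00 : (0 : ℝ) ∈ Icc 0 Real.pi := ⟨le_rfl, hpi⟩
  obtain ⟨e₁, L₁, he₁, H₁⟩ := exists_rateBounds a₀ a₁ hc hd
  obtain ⟨e₂, L₂, he₂, H₂⟩ := exists_rateBounds b₀ b₁ hc hd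
  -- Failure for every bound gives a sequence ε → 0 with two distinct closing pairs each; they are
  -- labelled so that h starts below k.
  by_contra! hcon
  have hstep : ∀ n : ℕ, ∃ (ε : ℝ) (h h' k k' : ℝ → ℝ), 0 < |ε| ∧ |ε| < 1 / ((n : ℝ) + 1) ∧
      RateBounds a₀ a₁ c d ε L₁ ∧ RateBounds b₀ b₁ c d ε L₂ ∧
      IsHalfSol a₀ a₁ c d ε h ∧ IsHalfSol a₀ a₁ c d ε k ∧
      IsHalfSol b₀ b₁ c d ε h' ∧ IsHalfSol b₀ b₁ c d ε k' ∧
      (h 0 = h' 0 ∧ h Real.pi = h' Real.pi) ∧ (k 0 = k' 0 ∧ k Real.pi = k' Real.pi) ∧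
      h 0 < k 0 := by
    intro n
    obtain ⟨ε, hε0, hε, h, h', k, k', hh, hk, hh', hk', p1, p2, p3, p4, hne⟩ :=
      hcon (min (min e₁ e₂) (1 / ((n : ℝ) + 1))) (lt_min (lt_min he₁ he₂) (by positivity))
    rw [lt_min_iff, lt_min_iff] at hε
    rcases lt_or_gt_of_ne hne with hlt | hlt
    · exact ⟨ε, h, h', k, k', hε0, hε.2, H₁ ε hε.1.1.le, H₂ ε hε.1.2.le, hh, hk, hh', hk',
        ⟨p1, p2⟩, ⟨p3, p4⟩, hlt⟩
    · exact ⟨ε, k, k', h, h', hε0, hε.2, H₁ ε hε.1.1.le, H₂ ε hε.1.2.le, hk, hh, hk', hh',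
        ⟨p3, p4⟩, ⟨p1, p2⟩, hlt⟩
  choose e h h' k k' hpos he R₁ R₂ hh hk hh' hk' ph pk hlt using hstep
  obtain ⟨⟨x, y⟩, hxy, φ, hφ, hlim⟩ := (isCompact_Icc.prod isCompact_Icc).tendsto_subseq
    (x := fun n => (h n 0, k n 0)) (s := Icc c d ×ˢ Icc c d)
    fun n => ⟨(hh n).mem 0 h00, (hk n).mem 0 h00⟩
  have he0 : Tendsto (fun n => e (φ n)) atTop (𝓝 0) :=
    (squeeze_zero_norm (fun n => (he n).le) tendsto_one_div_add_atTop_nhds_zero_nat).comp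
      hφ.tendsto_atTop
  have hx : Tendsto (fun n => h (φ n) 0) atTop (𝓝 x) := hlim.fst_nhds
  have hy : Tendsto (fun n => k (φ n) 0) atTop (𝓝 y) := hlim.snd_nhds
  have hx' : Tendsto (fun n => h' (φ n) 0) atTop (𝓝 x) := by simpa only [(ph _).1] using hx
  have hy' : Tendsto (fun n => k' (φ n) 0) atTop (𝓝 y) := by simpa only [(pk _).1] using hy
  have hx0 : x ∈ Ioo (0 : ℝ) (1 / 6) := ⟨hc.trans_le hxy.1.1, hxy.1.2.trans_lt hd⟩
  have hy0 : y ∈ Ioo (0 : ℝ) (1 / 6) := ⟨hc.trans_le hxy.2.1, hxy.2.2.trans_lt hd⟩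
  have zero : ∀ x : ℝ, x ∈ Ioo (0 : ℝ) (1 / 6) → arcInt a₀ a₁ x = arcInt b₀ b₁ x →
      (a₀ - b₀) * arcInt 1 0 x + (a₁ - b₁) * arcInt 0 1 x = 0 := fun x hx e => by
    rw [arcInt_eq a₀ a₁ hx, arcInt_eq b₀ b₁ hx] at e
    linarith
  -- The two half-turns have the same net change of level. Dividing by ε and passing to the limit
  -- shows that the limit level is a zero of M.
  have zx := zero x hx0 <| tendsto_nhds_unique
    (tendsto_integral_rate (fun n => R₁ (φ n)) he0 (fun n => hh (φ n)) hx hx0) <|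
    (tendsto_integral_rate (fun n => R₂ (φ n)) he0 (fun n => hh' (φ n)) hx' hx0).congr fun n => by
      have := ((hh (φ n)).integral_rate (R₁ _)).trans
        (((ph (φ n)).1 ▸ (ph (φ n)).2 ▸ (hh' (φ n)).integral_rate (R₂ _)).symm)
      exact (mul_left_cancel₀ (abs_pos.1 (hpos _)) this).symm
  have zy := zero y hy0 <| tendsto_nhds_unique
    (tendsto_integral_rate (fun n => R₁ (φ n)) he0 (fun n => hk (φ n)) hy hy0) <|
    (tendsto_integral_rate (fun n => R₂ (φ n)) he0 (fun n => hk' (φ n)) hy' hy0).congr fun n => by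
      have := ((hk (φ n)).integral_rate (R₁ _)).trans
        (((pk (φ n)).1 ▸ (pk (φ n)).2 ▸ (hk' (φ n)).integral_rate (R₂ _)).symm)
      exact (mul_left_cancel₀ (abs_pos.1 (hpos _)) this).symm
  have hA := arcInt_one_zero_pos hx0
  -- Otherwise M would be a nonzero multiple of the positive function I₀.
  have hβ : a₁ - b₁ ≠ 0 := by
    intro h0
    rw [h0, zero_mul, add_zero] at zx
    rcases mul_eq_zero.1 zx with h1 | h1
    · exact hne.elim (fun h => h h1) fun h => h h0
    · exact hA.ne' h1
  obtain rfl : x = y := injOn_of_wronskian_pos hβ (fun x hx => hasDerivAt_arcInt 1 0 hx)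
    (fun x hx => hasDerivAt_arcInt 0 1 hx) (fun x hx => arcInt_one_zero_pos hx)
    (fun x hx => wronskian_arcInt_pos hx) hx0 hy0 zx zy
  have lt₁ : ∀ n, ∀ θ ∈ Icc 0 Real.pi, h n θ < k n θ := fun n θ hθ =>
    (hh n).lt_of_lt (R₁ n) (hk n) h00 hθ (hlt n)
  have lt₂ : ∀ n, ∀ θ ∈ Icc 0 Real.pi, h' n θ < k' n θ := fun n θ hθ =>
    (hh' n).lt_of_lt (R₂ n) (hk' n) h00 hθ (by rw [← (ph n).1, ← (pk n).1]; exact hlt n)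
  -- The gaps agree at both ends, so the logarithmic changes on the two sides agree; divided by ε
  -- they give M'(x) = 0 in the limit.
  have hD : arcIntDeriv a₀ a₁ x = arcIntDeriv b₀ b₁ x := tendsto_nhds_unique
    (tendsto_integral_rateSlope (fun n => R₁ (φ n)) he0 (fun n => hh (φ n)) (fun n => hk (φ n))
      (fun n => lt₁ (φ n)) hx hy hx0) <|
    (tendsto_integral_rateSlope (fun n => R₂ (φ n)) he0 (fun n => hh' (φ n)) (fun n => hk' (φ n))
      (fun n => lt₂ (φ n)) hx' hy' hx0).congr fun n => by
      have e1 := integral_rateSlope (R₁ (φ n)) (hh _) (hk _) (lt₁ _)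
      have e2 := integral_rateSlope (R₂ (φ n)) (hh' _) (hk' _) (lt₂ _)
      rw [← (ph (φ n)).1, ← (ph (φ n)).2, ← (pk (φ n)).1, ← (pk (φ n)).2, ← e1] at e2
      exact mul_left_cancel₀ (abs_pos.1 (hpos _)) e2
  rw [arcIntDeriv_eq a₀ a₁ hx0, arcIntDeriv_eq b₀ b₁ hx0] at hD
  have hW := wronskian_arcInt_pos hx0
  have : (a₁ - b₁) * (arcIntDeriv 0 1 x * arcInt 1 0 x - arcIntDeriv 1 0 x * arcInt 0 1 x) = 0 := by
    linear_combination arcInt 1 0 x * hD - arcIntDeriv 1 0 x * zx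
  exact (mul_ne_zero hβ hW.ne') this

end

noncomputable section

/-! ### Limit cycles in compact subsets of the period annulus -/

theorem level_of_mem_oval {h : ℝ} {z : ℝ × ℝ} (hz : z ∈ oval h) : |z.1| < 1 ∧ level z = h := by
  rcases hz with ⟨h0, h1, e⟩ | ⟨h1, h0, e⟩
  · rw [level, abs_of_nonneg h0]
    exact ⟨h1, e⟩
  · rw [level, abs_of_nonpos h0, ← PsiTwo_eq]
    exact ⟨by linarith, e⟩

theorem exists_level_mem_Icc {K : Set (ℝ × ℝ)} (hK : IsCompact K) (hsub : K ⊆ periodAnnulus) :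
    ∃ c d δ : ℝ, 0 < c ∧ d < 1 / 6 ∧ 0 < δ ∧
      ∀ z ∈ K, |z.1| < 1 ∧ level z ∈ Icc (c + δ) (d - δ) := by
  have hmem : ∀ z ∈ K, |z.1| < 1 ∧ level z ∈ Ioo (0 : ℝ) (1 / 6) := fun z hz => by
    obtain ⟨h, hh, hz'⟩ := mem_iUnion₂.1 (hsub hz)
    obtain ⟨h1, e⟩ := level_of_mem_oval hz'
    exact ⟨h1, e ▸ hh⟩
  rcases K.eq_empty_or_nonempty with rfl | hne
  · exact ⟨1 / 12, 1 / 12, 1, by norm_num, by norm_num, one_pos, fun z hz => hz.elim⟩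
  have lc : Continuous level := by unfold level PsiOne; fun_prop
  obtain ⟨z₁, hz₁, h1⟩ := hK.exists_isMinOn hne lc.continuousOn
  obtain ⟨z₂, hz₂, h2⟩ := hK.exists_isMaxOn hne lc.continuousOn
  have p1 := (hmem z₁ hz₁).2.1
  have p2 := (hmem z₂ hz₂).2.2
  -- Half the distance to the ends of (0, 1/6) leaves a margin δ around the levels of K that still
  -- lies inside the annulus.
  set δ := min (level z₁) (1 / 6 - level z₂) / 2 with hδ
  have q1 : δ ≤ level z₁ / 2 := by rw [hδ]; gcongr; exact min_le_left _ _
  have q2 : δ ≤ (1 / 6 - level z₂) / 2 := by rw [hδ]; gcongr; exact min_le_right _ _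
  have q0 : 0 < δ := half_pos (lt_min p1 (by linarith))
  exact ⟨level z₁ - δ, level z₂ + δ, δ, by linarith, by linarith, q0, fun z hz =>
    ⟨(hmem z hz).1, by linarith [isMinOn_iff.1 h1 z hz], by linarith [isMaxOn_iff.1 h2 z hz]⟩⟩

theorem exists_no_limitCycle (a b : ℝ) {c d δ : ℝ} (hc : 0 < c) (hd : d < 1 / 6) (hδ : 0 < δ) :
    ∃ ε₀ : ℝ, 0 < ε₀ ∧ ∀ ε : ℝ, |ε| < ε₀ → ∀ C : Set (ℝ × ℝ),
      (∀ z ∈ C, |z.1| < 1 ∧ level z ∈ Icc (c + δ) (d - δ)) →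
      ¬ IsLimitCycle (fieldPlus a b ε) (fieldMinus (-a) b ε) C := by
  obtain ⟨ε₁, L, hε₁, H⟩ := exists_rateBounds a b hc hd
  have hL : 0 ≤ L := (H 0 (by simpa using hε₁.le)).L_nonneg
  have hpi := Real.pi_pos
  -- This makes the drift |ε| L π at most δ/2; L + 1 keeps the quotient meaningful when L = 0.
  refine ⟨min ε₁ (δ / 2 / ((L + 1) * Real.pi)), lt_min hε₁ (by positivity), fun ε hε C hC => ?_⟩
  rw [lt_min_iff, lt_div_iff₀ (by positivity)] at hε
  refine not_isLimitCycle_of_symm (H ε hε.1.le) hδ ?_ hC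
  nlinarith [mul_nonneg (abs_nonneg ε) hpi.le]

theorem exists_unique_periodicOrbit {a₀ a₁ b₀ b₁ c d : ℝ} (hc : 0 < c) (hd : d < 1 / 6)
    (hne : a₀ + b₀ ≠ 0 ∨ a₁ - b₁ ≠ 0) :
    ∃ ε₀ : ℝ, 0 < ε₀ ∧ ∀ ε : ℝ, 0 < |ε| → |ε| < ε₀ → ∀ C C' : Set (ℝ × ℝ),
      (∀ z ∈ C, |z.1| < 1 ∧ level z ∈ Icc c d) → (∀ z ∈ C', |z.1| < 1 ∧ level z ∈ Icc c d) →
      IsPeriodicOrbit (fieldPlus a₀ a₁ ε) (fieldMinus b₀ b₁ ε) C →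
      IsPeriodicOrbit (fieldPlus a₀ a₁ ε) (fieldMinus b₀ b₁ ε) C' → C = C' := by
  obtain ⟨e₁, L₁, he₁, H₁⟩ := exists_rateBounds a₀ a₁ hc hd
  obtain ⟨e₂, L₂, he₂, H₂⟩ := exists_rateBounds (-b₀) b₁ hc hd
  obtain ⟨e₃, he₃, huniq⟩ := exists_unique_closing (a₀ := a₀) (a₁ := a₁) (b₀ := -b₀) (b₁ := b₁)
    hc hd (by rwa [sub_neg_eq_add])
  refine ⟨min (min e₁ e₂) e₃, lt_min (lt_min he₁ he₂) he₃, fun ε hpos hε C C' hC hC' p p' => ?_⟩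
  rw [lt_min_iff, lt_min_iff] at hε
  have R₁ := (H₁ ε hε.1.1.le).mono (le_max_left L₁ L₂)
  have R₂ := (H₂ ε hε.1.2.le).mono (le_max_right L₁ L₂)
  obtain ⟨h, h', hh, hh', h1, h2, rfl⟩ := exists_turnSet_eq R₁ R₂ p hC
  obtain ⟨k, k', hk, hk', k1, k2, rfl⟩ := exists_turnSet_eq R₁ R₂ p' hC'
  have h00 : (0 : ℝ) ∈ Icc 0 Real.pi := ⟨le_rfl, Real.pi_pos.le⟩
  have e := huniq ε hpos hε.2 h h' k k' hh hk hh' hk' h1 h2 k1 k2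
  -- The common initial level determines both halves by uniqueness, hence the whole orbit.
  exact turnSet_congr (hh.eqOn R₁ hk h00 e) (hh'.eqOn R₂ hk' h00 (by rw [← h1, e, k1]))

theorem atMostBifurcate_one (a₀ a₁ b₀ b₁ : ℝ) :
    AtMostBifurcate (fieldPlus a₀ a₁) (fieldMinus b₀ b₁) periodAnnulus 1 := by
  intro K hK hsub
  obtain ⟨c, d, δ, hc, hd, hδ, hlev⟩ := exists_level_mem_Icc hK hsub
  -- The case distinction is whether M is a nontrivial combination. In the trivial case the system
  -- is reversible and there is no limit cycle at all.
  by_cases hne : a₀ + b₀ ≠ 0 ∨ a₁ - b₁ ≠ 0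
  · obtain ⟨ε₀, hε₀, huniq⟩ := exists_unique_periodicOrbit hc hd hne
    refine ⟨ε₀, hε₀, fun ε hpos hε => ?_⟩
    rw [Nat.cast_one, Set.encard_le_one_iff]
    have hlev' : ∀ C ⊆ K, ∀ z ∈ C, |z.1| < 1 ∧ level z ∈ Icc c d := fun C hC z hz => by
      have := hlev z (hC hz)
      exact ⟨this.1, by linarith [this.2.1], by linarith [this.2.2]⟩
    exact fun C C' hC hC' =>
      huniq ε hpos hε C C' (hlev' C hC.2) (hlev' C' hC'.2) hC.1.1 hC'.1.1
  · push Not at hne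
    obtain ⟨ε₀, hε₀, hno⟩ := exists_no_limitCycle a₀ a₁ hc hd hδ
    refine ⟨ε₀, hε₀, fun ε _ hε => ?_⟩
    have e : {C : Set (ℝ × ℝ) | IsLimitCycle (fieldPlus a₀ a₁ ε) (fieldMinus b₀ b₁ ε) C ∧ C ⊆ K} =
        ∅ := by
      refine eq_empty_iff_forall_notMem.2 fun C hC => ?_
      obtain rfl : b₀ = -a₀ := by linarith [hne.1]
      obtain rfl : b₁ = a₁ := by linarith [hne.2]
      exact hno ε hε C (fun z hz => hlev z (hC.2 hz)) hC.1
    rw [e, encard_empty]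
    exact zero_le

end

/-! ### The system (1, x) and the assembly of the theorem. -/

theorem isECTSystem_pow : IsECTSystem (fun (i : Fin 2) (x : ℝ) => x ^ (i : ℕ)) (Ioo (0 : ℝ) 1) := by
  refine isECTSystem_of_wronskian_pos (f₀' := fun _ => 0) (f₁' := fun _ => 1)
    (fun i x _ => analyticAt_id.pow _) (fun x _ => ?_) (fun x _ => ?_) (fun x _ => ?_) fun x _ => ?_
  · simpa using hasDerivAt_const x (1 : ℝ)
  · simpa using hasDerivAt_id' x
  · simp
  · simp

theorem mainTheorem5 :
    -- the involution is `σ₁(x) = -x`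
    (∀ x ∈ Ioo (0 : ℝ) 1, ∀ z ∈ Ioo (-1 : ℝ) 0, PsiOne x = PsiTwo z ↔ z = -x) ∧
    -- the ovals are periodic orbits of the unperturbed system, made of two orbital arcs
    (∀ h ∈ Ioo (0 : ℝ) (1 / 6),
      IsPeriodicOrbit (hamField HamPlus) (hamField HamMinus) (oval h) ∧
      (∃ γ : Path (ptA h) (ptB h), IsArcPlus h γ) ∧
      (∃ γ : Path (ptB h) (ptA h), IsArcMinus h γ)) ∧
    -- the line integrals `I i h`, `J i h` along the arcs and the Melnikov function
    (∀ (Γp : ∀ h : ℝ, Path (ptA h) (ptB h)) (Γm : ∀ h : ℝ, Path (ptB h) (ptA h)),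
      (∀ h ∈ Ioo (0 : ℝ) (1 / 6), IsArcPlus h (Γp h) ∧ IsArcMinus h (Γm h)) →
      ∀ I J : Fin 2 → ℝ → ℝ,
      (∀ i h, I i h = lineIntegral (fun z => z.1 ^ (i : ℕ) * z.2) (fun _ => 0) (Γp h)) →
      (∀ i h, J i h = lineIntegral (fun z => z.1 ^ (i : ℕ) * z.2) (fun _ => 0) (Γm h)) →
      (∀ i, ∀ h ∈ Ioo (0 : ℝ) (1 / 6), J i h = (-1) ^ (i : ℕ) * I i h) ∧
      (∀ ap₀ ap₁ am₀ am₁ : ℝ, ∀ h ∈ Ioo (0 : ℝ) (1 / 6),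
        melnikov HamPlus HamMinus (fun _ => 0) (pertY ap₀ ap₁) (fun _ => 0) (pertY am₀ am₁)
            (Γp h) (Γm h)
          = ap₀ * I 0 h + am₀ * J 0 h + ap₁ * I 1 h + am₁ * J 1 h ∧
        melnikov HamPlus HamMinus (fun _ => 0) (pertY ap₀ ap₁) (fun _ => 0) (pertY am₀ am₁)
            (Γp h) (Γm h)
          = (ap₀ + am₀) * I 0 h + (ap₁ - am₁) * I 1 h) ∧
      IsECTSystem I (Ioo (0 : ℝ) (1 / 6))) ∧
    -- the functions `l i x = x ^ i` form an ECT-system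
    IsECTSystem (fun (i : Fin 2) (x : ℝ) => x ^ (i : ℕ)) (Ioo (0 : ℝ) 1) ∧
    -- at most one limit cycle bifurcates from the period annulus
    (∀ ap₀ ap₁ am₀ am₁ : ℝ,
      AtMostBifurcate (fieldPlus ap₀ ap₁) (fieldMinus am₀ am₁) periodAnnulus 1) := by
  refine ⟨fun x hx z hz => involution_iff hx hz, fun h hh => ⟨isPeriodicOrbit_oval hh,
    exists_isArcPlus_isArcMinus hh⟩, fun Γp Γm hΓ I J hI hJ => ?_, isECTSystem_pow,
    atMostBifurcate_one⟩
  have eI : ∀ i, ∀ h ∈ Ioo (0 : ℝ) (1 / 6), I i h = arcInt (1 - (i : ℕ)) (i : ℕ) h :=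
    fun i h hh => by rw [hI, pow_mul_eq_pertY, lineIntegral_arcPlus _ _ hh (hΓ h hh).1]
  have eJ : ∀ i, ∀ h ∈ Ioo (0 : ℝ) (1 / 6), J i h = arcInt (1 - (i : ℕ)) (-(i : ℕ)) h :=
    fun i h hh => by rw [hJ, pow_mul_eq_pertY, lineIntegral_arcMinus _ _ hh (hΓ h hh).2]
  have I0 : ∀ h ∈ Ioo (0 : ℝ) (1 / 6), I 0 h = arcInt 1 0 h := fun h hh => by simp [eI 0 h hh]
  have I1 : ∀ h ∈ Ioo (0 : ℝ) (1 / 6), I 1 h = arcInt 0 1 h := fun h hh => by simp [eI 1 h hh]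
  have hIJ : ∀ i, ∀ h ∈ Ioo (0 : ℝ) (1 / 6), J i h = (-1) ^ (i : ℕ) * I i h := fun i h hh => by
    rw [eJ i h hh, eI i h hh, arcInt_eq _ _ hh, arcInt_eq _ (i : ℕ) hh]
    fin_cases i <;> simp
  have hev : ∀ h ∈ Ioo (0 : ℝ) (1 / 6), ∀ᶠ t in nhds h, t ∈ Ioo (0 : ℝ) (1 / 6) := fun h hh =>
    Ioo_mem_nhds hh.1 hh.2
  refine ⟨hIJ, fun ap₀ ap₁ am₀ am₁ h hh => ?_, ?_⟩
  · have key : melnikov HamPlus HamMinus (fun _ => 0) (pertY ap₀ ap₁) (fun _ => 0)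
        (pertY am₀ am₁) (Γp h) (Γm h) = (ap₀ + am₀) * I 0 h + (ap₁ - am₁) * I 1 h := by
      rw [melnikov_eq hh.1, lineIntegral_arcPlus _ _ hh (hΓ h hh).1,
        lineIntegral_arcMinus _ _ hh (hΓ h hh).2, I0 h hh, I1 h hh, arcInt_eq ap₀ ap₁ hh,
        arcInt_eq am₀ _ hh]
      ring
    refine ⟨key.trans ?_, key⟩
    rw [hIJ 0 h hh, hIJ 1 h hh]
    simp only [Fin.val_zero, Fin.val_one, pow_zero, pow_one]
    ring
  · refine isECTSystem_of_wronskian_pos (f₀' := arcIntDeriv 1 0) (f₁' := arcIntDeriv 0 1)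
      (fun i h hh => (analyticAt_arcInt (1 - (i : ℕ)) (i : ℕ) hh).congr ?_) (fun h hh => ?_) (fun h hh => ?_)
      (fun h hh => ?_) fun h hh => ?_
    · filter_upwards [hev h hh] with t ht
      exact (eI i t ht).symm
    · exact (hasDerivAt_arcInt 1 0 hh).congr_of_eventuallyEq (by
        filter_upwards [hev h hh] with t ht
        exact I0 t ht)
    · exact (hasDerivAt_arcInt 0 1 hh).congr_of_eventuallyEq (by
        filter_upwards [hev h hh] with t ht
        exact I1 t ht)
    · rw [I0 h hh]
      exact arcInt_one_zero_pos hh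
    · rw [I0 h hh, I1 h hh]
      exact wronskian_arcInt_pos hh
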